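/- Let $G$ be a compact connected semisimple Lie group, $H\subset G$ a closed subgroup, $\mathfrak g,\mathfrak h$ their Lie algebras, $B$ the Killing form of $\mathfrak g$, and let $\mathfrak g=\mathfrak h\oplus\mathfrak m$ with $\mathrm{Ad}(H)\mathfrak m\subset\mathfrak m$ be a reductive decomposition; write $X_{\mathfrak m}$ for the projection of $X\in\mathfrak g$ to $\mathfrak m$ along $\mathfrak h$, and identify $\mathfrak m$ with the tangent space of $G/H$ at $o=H$. Suppose that $\mathfrak m=\mathfrak m_1\oplus\mathfrak m_2\oplus\mathfrak m_3$ is a $B$-orthogonal direct sum of $\mathrm{Ad}(H)$-invariant, irreducible, pairwise inequivalent submodules such that $0\neq[\mathfrak m_s,\mathfrak m_{s+1}]\subset\mathfrak m_{s+2}$ (indices mod $3$) and $[\mathfrak m_s,\mathfrak m_s]\subset\mathfrak h$ for $s=1,2,3$. Let $g=\langle\cdot,\cdot\rangle$ be a $G$-invariant Riemannian metric on $G/H$ with characteristic numbers $(a_1,a_2,a_3)$, that is, $a_1,a_2,a_3>0$ and $g_o=-\sum_s a_s B|_{\mathfrak m_s\times\mathfrak m_s}$ on $\mathfrak m$, and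 let $\nabla$ be its Levi-Civita connection. Let $(f,g)$ be an invariant metric $f$-structure on $G/H$: $f$ is a $G$-invariant smooth field of endomorphisms of the tangent bundle with $f^3+f=0$ and $\langle fX,Y\rangle+\langle X,fY\rangle=0$. Write $f$ also for its value at $o$, a linear operator on $\mathfrak m$. Suppose that, for some $\{i,j,k\}=\{1,2,3\}$, $f|_{\mathfrak m_i}=0$ and $f|_{\mathfrak m_j\oplus\mathfrak m_k}=J$, where $J$ is an operator on $\mathfrak m_j\oplus\mathfrak m_k$ with $J^2=-\mathrm{id}$. Put $\nabla_X(f)Y=\nabla_X(fY)-f(\nabla_XY)$ and $T(X,Y)=\frac14 f\bigl(\nabla_{fX}(f)fY-\nabla_{f^2X}(f)f^2Y\bigr)$. Then: 1. $(f,g)$ is a $G_1f$-structure, that is, $T(X,X)=0$ for all smooth vector fields $X$ on $G/H$. 2. $(f,g)$ is a nearly Kähler $f$-structure, that is, $\nabla_{fX}(f)fX=0$ for all smooth vector fields $X$ on $G/H$, if and only if $a_j=a_k$ and $[fX,f^2X]_{\mathfrak m}=0$ for all $X\in\mathfrak m$. 3. $(f,g)$ is a Killing $f$-structure, that is, $\nabla_X(f)X=0$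 for all smooth vector fields $X$ on $G/H$, if and only if $a_j=a_k=\frac34 a_i$ and, for all $Y\in\mathfrak m_i$ and $Z\in\mathfrak m_j\oplus\mathfrak m_k$, $[Z,fZ]_{\mathfrak m}=0$ and $[Y,fZ]+f([Y,Z])=0$. -/

import Mathlib

open scoped Manifold ContDiff
open Bundle

noncomputable section

/-! ### Metric `f`-structures on a Riemannian manifold -/

namespace MetricF

variable {F : Type*} [NormedAddCommGroup F] [NormedSpace ℝ F] [FiniteDimensional ℝ F]
  {M : Type*} [TopologicalSpace M] [ChartedSpace F M]

/-- Fields of endomorphisms of the tangent bundle (affinor structures, before smoothness). -/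
abbrev EndoField (F : Type*) [NormedAddCommGroup F] [NormedSpace ℝ F]
    (M : Type*) [TopologicalSpace M] [ChartedSpace F M] : Type _ :=
  (x : M) → TangentSpace 𝓘(ℝ, F) x →L[ℝ] TangentSpace 𝓘(ℝ, F) x

/-- Vector fields, before smoothness. -/
abbrev VField (F : Type*) [NormedAddCommGroup F] [NormedSpace ℝ F]
    (M : Type*) [TopologicalSpace M] [ChartedSpace F M] : Type _ :=
  (x : M) → TangentSpace 𝓘(ℝ, F) x

variable [IsManifold 𝓘(ℝ, F) ∞ M]

/-- Smooth vector fields: the elements of `𝔛(M)`. -/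
def SmoothVField (X : VField F M) : Prop :=
  ContMDiff 𝓘(ℝ, F) (𝓘(ℝ, F).prod 𝓘(ℝ, F)) ∞
    (fun x : M => TotalSpace.mk' F (E := fun x : M => TangentSpace 𝓘(ℝ, F) x) x (X x))

/-- Smooth tensor fields of type `(1,1)`. -/
def SmoothEndoField (f : EndoField F M) : Prop :=
  ContMDiff 𝓘(ℝ, F) (𝓘(ℝ, F).prod 𝓘(ℝ, F →L[ℝ] F)) ∞
    (fun x : M => TotalSpace.mk' (F →L[ℝ] F)
      (E := fun x : M => TangentSpace 𝓘(ℝ, F) x →L[ℝ] TangentSpace 𝓘(ℝ, F) x) x (f x))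

/-- Smooth Riemannian metrics on `M`. -/
abbrev Metric (F : Type*) [NormedAddCommGroup F] [NormedSpace ℝ F]
    (M : Type*) [TopologicalSpace M] [ChartedSpace F M] [IsManifold 𝓘(ℝ, F) ∞ M] : Type _ :=
  ContMDiffRiemannianMetric 𝓘(ℝ, F) ∞ F (fun x : M => TangentSpace 𝓘(ℝ, F) x)

/-- Affine connections on `M`. -/
abbrev Connection (F : Type*) [NormedAddCommGroup F] [NormedSpace ℝ F]
    (M : Type*) [TopologicalSpace M] [ChartedSpace F M] [IsManifold 𝓘(ℝ, F) ∞ M] : Type _ :=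
  CovariantDerivative 𝓘(ℝ, F) F (fun x : M => TangentSpace 𝓘(ℝ, F) x)

/-- A metric `f`-structure: a smooth field of endomorphisms `f` with `f³ + f = 0` and
`⟨fX, Y⟩ + ⟨X, fY⟩ = 0`. -/
structure IsMetricFStructure (g : Metric F M) (f : EndoField F M) : Prop where
  smooth : SmoothEndoField f
  cube_add : ∀ (x : M) (v : TangentSpace 𝓘(ℝ, F) x), f x (f x (f x v)) + f x v = 0
  compatible : ∀ (x : M) (v w : TangentSpace 𝓘(ℝ, F) x),
    g.inner x (f x v) w + g.inner x v (f x w) = 0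

/-- `cov` is the Levi-Civita connection of `g`: it has no torsion, and
`v⟨σ, τ⟩ = ⟨∇_v σ, τ⟩ + ⟨σ, ∇_v τ⟩`.  (`cov σ x v` is `∇_v σ` at `x`.) -/
structure IsLeviCivita (g : Metric F M) (cov : Connection F M) : Prop where
  torsion_eq_zero : cov.torsion = 0
  metric : ∀ (σ τ : VField F M) (x : M),
    MDifferentiableAt 𝓘(ℝ, F) (𝓘(ℝ, F).prod 𝓘(ℝ, F))
      (fun y : M => TotalSpace.mk' F (E := fun x : M => TangentSpace 𝓘(ℝ, F) x) y (σ y)) x →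
    MDifferentiableAt 𝓘(ℝ, F) (𝓘(ℝ, F).prod 𝓘(ℝ, F))
      (fun y : M => TotalSpace.mk' F (E := fun x : M => TangentSpace 𝓘(ℝ, F) x) y (τ y)) x →
    ∀ v : TangentSpace 𝓘(ℝ, F) x,
      mvfderiv 𝓘(ℝ, F) (fun y : M => g.inner y (σ y) (τ y)) x v =
        g.inner x (cov σ x v) (τ x) + g.inner x (σ x) (cov τ x v)

/-- The vector field `f X`. -/
def app (f : EndoField F M) (X : VField F M) : VField F M := fun x => f x (X x)

/-- The vector field `∇_X (f) Y = ∇_X (f Y) - f (∇_X Y)`. -/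
def covEndo (cov : Connection F M) (f : EndoField F M) (X Y : VField F M) : VField F M :=
  fun x => cov (app f Y) x (X x) - f x (cov Y x (X x))

/-- The composition tensor
`T(X, Y) = (1/4) f (∇_{fX} (f) fY - ∇_{f²X} (f) f²Y)`. -/
def compositionTensor (cov : Connection F M) (f : EndoField F M) (X Y : VField F M) :
    VField F M :=
  fun x => (1 / 4 : ℝ) • f x (covEndo cov f (app f X) (app f Y) x -
    covEndo cov f (app f (app f X)) (app f (app f Y)) x)

/-- `G₁f`-structures: `T(X, X) = 0` for all `X ∈ 𝔛(M)`. -/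
def IsG1f (cov : Connection F M) (f : EndoField F M) : Prop :=
  ∀ X : VField F M, SmoothVField X → ∀ x : M, compositionTensor cov f X X x = 0

/-- Nearly Kähler `f`-structures: `∇_{fX} (f) fX = 0` for all `X ∈ 𝔛(M)`. -/
def IsNKf (cov : Connection F M) (f : EndoField F M) : Prop :=
  ∀ X : VField F M, SmoothVField X → ∀ x : M, covEndo cov f (app f X) (app f X) x = 0

/-- Killing `f`-structures: `∇_X (f) X = 0` for all `X ∈ 𝔛(M)`. -/
def IsKillf (cov : Connection F M) (f : EndoField F M) : Prop :=
  ∀ X : VField F M, SmoothVField X → ∀ x : M, covEndo cov f X X x = 0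

end MetricF

/-! ### Homogeneous reductive spaces -/

namespace HomSpace

open MetricF Topology

instance instLEInftyMinSmoothness : ENat.LEInfty (minSmoothness ℝ 3) :=
  ⟨by rw [minSmoothness_of_isRCLikeNormedField]; exact ENat.LEInfty.out⟩

variable {E : Type*} [NormedAddCommGroup E] [NormedSpace ℝ E]
  {F : Type*} [NormedAddCommGroup F] [NormedSpace ℝ F]
  {G : Type*} [TopologicalSpace G] [ChartedSpace E G] [Group G]

/-- The adjoint action of `G` on its Lie algebra `𝔤 = T₁G`. -/
def Ad (h : G) : GroupLieAlgebra 𝓘(ℝ, E) G →L[ℝ] GroupLieAlgebra 𝓘(ℝ, E) G :=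
  mfderiv 𝓘(ℝ, E) 𝓘(ℝ, E) (fun x : G => h * x * h⁻¹) 1

/-- Velocities at `1` of curves that run in `H`. -/
def IsVelocity (H : Subgroup G) (X : GroupLieAlgebra 𝓘(ℝ, E) G) : Prop :=
  ∃ γ : ℝ → G, γ 0 = 1 ∧ (∀ t, γ t ∈ H) ∧ MDifferentiableAt 𝓘(ℝ, ℝ) 𝓘(ℝ, E) γ 0 ∧
    (mfderiv 𝓘(ℝ, ℝ) 𝓘(ℝ, E) γ 0 (1 : ℝ) : E) = X

theorem isVelocity_smul (H : Subgroup G) (c : ℝ) {X : GroupLieAlgebra 𝓘(ℝ, E) G}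
    (hX : IsVelocity H X) : IsVelocity H (c • X) := by
  obtain ⟨γ, h0, hH, hd, hv⟩ := hX
  have hc : HasMFDerivAt 𝓘(ℝ, ℝ) 𝓘(ℝ, ℝ) (fun t : ℝ => c * t) 0
      (c • ContinuousLinearMap.id ℝ ℝ : ℝ →L[ℝ] ℝ) :=
    hasMFDerivAt_iff_hasFDerivAt.2 ((hasFDerivAt_id (𝕜 := ℝ) (0 : ℝ)).const_smul c)
  have hd' : HasMFDerivAt 𝓘(ℝ, ℝ) 𝓘(ℝ, E) γ ((fun t : ℝ => c * t) 0)
      (mfderiv 𝓘(ℝ, ℝ) 𝓘(ℝ, E) γ 0 : ℝ →L[ℝ] E) := by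
    have : (fun t : ℝ => c * t) 0 = 0 := mul_zero c
    rw [this]; exact hd.hasMFDerivAt
  have := hd'.comp 0 hc
  refine ⟨fun t => γ (c * t), by simpa using h0, fun t => hH _, this.mdifferentiableAt, ?_⟩
  have e := this.mfderiv
  subst hv
  have h2 : (mfderiv 𝓘(ℝ, ℝ) 𝓘(ℝ, E) γ 0 (c • (1:ℝ)) : E) =
      c • (mfderiv 𝓘(ℝ, ℝ) 𝓘(ℝ, E) γ 0 (1 : ℝ) : E) :=
    ContinuousLinearMap.map_smul (mfderiv 𝓘(ℝ, ℝ) 𝓘(ℝ, E) γ 0 : ℝ →L[ℝ] E) _ _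
  refine Eq.trans ?_ h2
  exact congrArg (fun L : ℝ →L[ℝ] E => L (1 : ℝ)) e

theorem mfderiv_mul_right_one {a b : G} (ha : a = 1) (hb : b = 1) (v : E) :
    (mfderiv 𝓘(ℝ, E) 𝓘(ℝ, E) (fun z : G => z * b) a v : E) = v := by
  subst ha hb
  have h : (fun z : G => z * 1) = id := by ext; simp
  have e : (mfderiv 𝓘(ℝ, E) 𝓘(ℝ, E) (fun z : G => z * 1) 1 : E →L[ℝ] E)
    = (mfderiv 𝓘(ℝ, E) 𝓘(ℝ, E) (id : G → G) 1 : E →L[ℝ] E) := by rw [h]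
  have e' : (mfderiv 𝓘(ℝ, E) 𝓘(ℝ, E) (id : G → G) 1 : E →L[ℝ] E) = ContinuousLinearMap.id ℝ E :=
    mfderiv_id
  exact congrArg (fun L : E →L[ℝ] E => L v) (e.trans e')

theorem mfderiv_mul_left_one {a b : G} (ha : a = 1) (hb : b = 1) (v : E) :
    (mfderiv 𝓘(ℝ, E) 𝓘(ℝ, E) (fun z : G => a * z) b v : E) = v := by
  subst ha hb
  have h : (fun z : G => 1 * z) = id := by ext; simp
  have e : (mfderiv 𝓘(ℝ, E) 𝓘(ℝ, E) (fun z : G => 1 * z) 1 : E →L[ℝ] E)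
    = (mfderiv 𝓘(ℝ, E) 𝓘(ℝ, E) (id : G → G) 1 : E →L[ℝ] E) := by rw [h]
  have e' : (mfderiv 𝓘(ℝ, E) 𝓘(ℝ, E) (id : G → G) 1 : E →L[ℝ] E) = ContinuousLinearMap.id ℝ E :=
    mfderiv_id
  exact congrArg (fun L : E →L[ℝ] E => L v) (e.trans e')

theorem isVelocity_add [LieGroup 𝓘(ℝ, E) ∞ G] (H : Subgroup G) {X Y : GroupLieAlgebra 𝓘(ℝ, E) G}
    (hX : IsVelocity H X) (hY : IsVelocity H Y) : IsVelocity H (X + Y) := by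
  obtain ⟨γ, h0, hH, hd, hv⟩ := hX
  obtain ⟨δ, k0, kH, kd, kv⟩ := hY
  have hp := hd.prodMk kd
  have hm : MDifferentiableAt (𝓘(ℝ, E).prod 𝓘(ℝ, E)) 𝓘(ℝ, E) (fun p : G × G => p.1 * p.2)
      ((fun t => (γ t, δ t)) 0) :=
    (contMDiff_mul 𝓘(ℝ, E) ∞).mdifferentiableAt (by simp)
  have hc := hm.comp (0:ℝ) hp
  refine ⟨fun t => γ t * δ t, by simp [h0, k0], fun t => H.mul_mem (hH t) (kH t), hc, ?_⟩
  have e := mfderiv_comp_apply (0:ℝ) hm hp (1:ℝ)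
  refine Eq.trans e ?_
  rw [mfderiv_prodMk hd kd]
  refine Eq.trans (mfderiv_prod_eq_add_apply hm) ?_
  subst hv kv
  exact congrArg₂ (fun x y : E => x + y) (mfderiv_mul_right_one h0 k0 _)
    (mfderiv_mul_left_one h0 k0 _)

/-- The Lie algebra `𝔥` of a closed subgroup `H`: the velocities at `1` of curves in `H`. -/
def lieAlg [LieGroup 𝓘(ℝ, E) ∞ G] (H : Subgroup G) :
    Submodule ℝ (GroupLieAlgebra 𝓘(ℝ, E) G) where
  carrier := {X | IsVelocity H X}
  add_mem' := isVelocity_add H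
  zero_mem' := ⟨fun _ => 1, rfl, fun _ => H.one_mem, mdifferentiableAt_const,
    congrArg (fun L : ℝ →L[ℝ] E => L (1 : ℝ)) mfderiv_const⟩
  smul_mem' c _ h := isVelocity_smul H c h

/-- The smooth structure of `G ⧸ H` is that of the homogeneous space: the projection
`G → G ⧸ H` is a smooth submersion (this determines the smooth structure). -/
structure IsHomogeneousManifold (E F : Type*) [NormedAddCommGroup E] [NormedSpace ℝ E]
    [NormedAddCommGroup F] [NormedSpace ℝ F] {G : Type*} [TopologicalSpace G] [ChartedSpace E G]
    [Group G] (H : Subgroup G) [ChartedSpace F (G ⧸ H)] : Prop where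
  contMDiff_mk : ContMDiff 𝓘(ℝ, E) 𝓘(ℝ, F) ∞ (QuotientGroup.mk : G → G ⧸ H)
  surjective_mfderiv : ∀ x : G,
    Function.Surjective (mfderiv 𝓘(ℝ, E) 𝓘(ℝ, F) (QuotientGroup.mk : G → G ⧸ H) x)

/-- The differential at `1` of the projection `G → G ⧸ H`. -/
def dproj (E F : Type*) [NormedAddCommGroup E] [NormedSpace ℝ E]
    [NormedAddCommGroup F] [NormedSpace ℝ F] {G : Type*} [TopologicalSpace G] [ChartedSpace E G]
    [Group G] (H : Subgroup G) [ChartedSpace F (G ⧸ H)] :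
    GroupLieAlgebra 𝓘(ℝ, E) G →L[ℝ] TangentSpace 𝓘(ℝ, F) (QuotientGroup.mk 1 : G ⧸ H) :=
  mfderiv 𝓘(ℝ, E) 𝓘(ℝ, F) (QuotientGroup.mk : G → G ⧸ H) 1

theorem lieAlg_le_ker [LieGroup 𝓘(ℝ, E) ∞ G] (H : Subgroup G) [ChartedSpace F (G ⧸ H)]
    [IsManifold 𝓘(ℝ, F) ∞ (G ⧸ H)] (hM : IsHomogeneousManifold E F H)
    {X : GroupLieAlgebra 𝓘(ℝ, E) G} (hX : X ∈ lieAlg H) : dproj E F H X = 0 := by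
  obtain ⟨γ, h0, hH, hd, hv⟩ := hX
  have hp : MDifferentiableAt 𝓘(ℝ, E) 𝓘(ℝ, F) (QuotientGroup.mk : G → G ⧸ H) (γ 0) :=
    hM.contMDiff_mk.mdifferentiableAt (by simp)
  have e := mfderiv_comp_apply (0:ℝ) hp hd (1:ℝ)
  have hc : (QuotientGroup.mk : G → G ⧸ H) ∘ γ = fun _ => (QuotientGroup.mk 1 : G ⧸ H) := by
    ext t
    exact (QuotientGroup.eq.2 (by simpa using hH t)).symm
  have e2 : (mfderiv 𝓘(ℝ, ℝ) 𝓘(ℝ, F) ((QuotientGroup.mk : G → G ⧸ H) ∘ γ) 0 : ℝ →L[ℝ] F) = 0 := by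
    rw [hc]; exact mfderiv_const
  subst hv
  have e3 : (mfderiv 𝓘(ℝ, E) 𝓘(ℝ, F) (QuotientGroup.mk : G → G ⧸ H) 1 : E →L[ℝ] F)
      = mfderiv 𝓘(ℝ, E) 𝓘(ℝ, F) (QuotientGroup.mk : G → G ⧸ H) (γ 0) := by rw [h0]
  refine (congrArg (fun L : E →L[ℝ] F => L _) e3).trans ?_
  exact e.symm.trans (congrArg (fun L : ℝ →L[ℝ] F => L (1:ℝ)) e2)

theorem ker_le_lieAlg [FiniteDimensional ℝ E] [FiniteDimensional ℝ F] [LieGroup 𝓘(ℝ, E) ∞ G] (H : Subgroup G) [ChartedSpace F (G ⧸ H)]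
    [IsManifold 𝓘(ℝ, F) ∞ (G ⧸ H)] (hM : IsHomogeneousManifold E F H)
    {X : GroupLieAlgebra 𝓘(ℝ, E) G} (hX : dproj E F H X = 0) : X ∈ lieAlg H := by
  classical
  have : CompleteSpace E := FiniteDimensional.complete ℝ E
  let q : G → G ⧸ H := QuotientGroup.mk
  let φ := extChartAt 𝓘(ℝ, E) (1 : G)
  let ψ := extChartAt 𝓘(ℝ, F) (q 1)
  let a : E := φ 1
  let p : E → F := writtenInExtChartAt 𝓘(ℝ, E) 𝓘(ℝ, F) (1 : G) q
  have hp : ∀ y, p y = ψ (q (φ.symm y)) := fun y => rfl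
  have hpc : ContDiffAt ℝ ∞ p a := by
    have := (contMDiffAt_iff (I := 𝓘(ℝ, E)) (I' := 𝓘(ℝ, F)) (x := (1 : G))).1
      (hM.contMDiff_mk.contMDiffAt (x := 1))
    simpa [contDiffWithinAt_univ] using! this.2
  have hps := hpc.hasStrictFDerivAt (by simp)
  have hqd : MDifferentiableAt 𝓘(ℝ, E) 𝓘(ℝ, F) q 1 :=
    hM.contMDiff_mk.mdifferentiableAt (by simp)
  have hfd : (mfderiv 𝓘(ℝ, E) 𝓘(ℝ, F) q 1 : E →L[ℝ] F) = fderiv ℝ p a := by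
    refine hqd.mfderiv.trans ?_
    simp [fderivWithin_univ]
    rfl
  have hsurj : (fderiv ℝ p a).range = ⊤ := by
    rw [← hfd]
    exact LinearMap.range_eq_top.2 (hM.surjective_mfderiv 1)
  have hker : fderiv ℝ p a (X : E) = 0 := by rw [← hfd]; exact hX
  let X' : (fderiv ℝ p a).ker := ⟨X, hker⟩
  let c : ℝ → E := fun t => hps.implicitFunction p (fderiv ℝ p a) hsurj (p a) (t • X')
  have hl : HasFDerivAt (fun t : ℝ => t • X') (ContinuousLinearMap.toSpanSingleton ℝ X') 0 :=
    (ContinuousLinearMap.toSpanSingleton ℝ X').hasFDerivAt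
  have hc : HasFDerivAt c (ContinuousLinearMap.toSpanSingleton ℝ (X : E)) 0 := by
    have h1 := hps.to_implicitFunction hsurj
    have h2 : HasFDerivAt (hps.implicitFunction p (fderiv ℝ p a) hsurj (p a))
      (fderiv ℝ p a).ker.subtypeL ((0 : ℝ) • X') := by rw [zero_smul]; exact h1.hasFDerivAt
    have h3 := h2.comp (0 : ℝ) hl
    refine h3.congr_fderiv ?_
    ext
    simp [X']
    exact (one_smul ℝ (X : E)).symm
  have hc0 : c 0 = a := by
    change hps.implicitFunction p (fderiv ℝ p a) hsurj (p a) ((0 : ℝ) • X') = a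
    rw [zero_smul, hps.implicitFunction_apply_image hsurj]
  have hpcev : ∀ᶠ t in 𝓝 (0 : ℝ), p (c t) = p a := by
    have h1 := hps.map_implicitFunction_eq hsurj
    have h2 : Filter.Tendsto (fun t : ℝ => (p a, t • X')) (𝓝 0) (𝓝 (p a, 0)) := by
      have : Continuous (fun t : ℝ => (p a, t • X')) := by fun_prop
      simpa using this.tendsto 0
    exact h2.eventually h1
  let S : Set ℝ := {t | c t ∈ φ.target ∧ q (φ.symm (c t)) ∈ ψ.source ∧ p (c t) = p a}
  have hcc : ContinuousAt c 0 := hc.continuousAt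
  have hS : S ∈ 𝓝 (0 : ℝ) := by
    have h1 : ∀ᶠ t in 𝓝 (0 : ℝ), c t ∈ φ.target :=
      hcc.eventually_mem (by rw [hc0]; exact extChartAt_target_mem_nhds (1 : G))
    have h2 : ∀ᶠ t in 𝓝 (0 : ℝ), q (φ.symm (c t)) ∈ ψ.source := by
      have hs : ContinuousAt (fun y => q (φ.symm y)) a := by
        have : ContinuousAt q (φ.symm a) := hM.contMDiff_mk.continuous.continuousAt
        exact this.comp (continuousAt_extChartAt_symm (1 : G))
      have hs' : ContinuousAt (fun y => q (φ.symm y)) (c 0) := by rw [hc0]; exact hs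
      refine (hs'.comp hcc).eventually_mem ?_
      have e : φ.symm (c 0) = 1 := by rw [hc0]; exact extChartAt_to_inv (1 : G)
      change ψ.source ∈ 𝓝 (q (φ.symm (c 0)))
      rw [e]
      exact extChartAt_source_mem_nhds (q 1)
    filter_upwards [h1, h2, hpcev] with t a1 a2 a3 using ⟨a1, a2, a3⟩
  have h0S : (0 : ℝ) ∈ S := mem_of_mem_nhds hS
  let γ : ℝ → G := fun t => if t ∈ S then φ.symm (c t) else 1
  have hγ0 : γ 0 = 1 := by
    change (if (0 : ℝ) ∈ S then φ.symm (c 0) else 1) = 1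
    rw [if_pos h0S, hc0]
    exact extChartAt_to_inv (1 : G)
  have hγ : HasMFDerivAt 𝓘(ℝ, ℝ) 𝓘(ℝ, E) γ 0
      (ContinuousLinearMap.toSpanSingleton ℝ (X : E) : ℝ →L[ℝ] E) := by
    have hev : ∀ᶠ t in 𝓝 (0 : ℝ), γ t = φ.symm (c t) := by
      filter_upwards [hS] with t ht using if_pos ht
    constructor
    · have : ContinuousAt (fun t => φ.symm (c t)) 0 := by
        have h1 : ContinuousAt φ.symm (c 0) := by
          rw [hc0]; exact continuousAt_extChartAt_symm (1 : G)
        exact h1.comp hcc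
      exact this.congr (hev.mono fun t ht => ht.symm)
    · have hw : writtenInExtChartAt 𝓘(ℝ, ℝ) 𝓘(ℝ, E) 0 γ =ᶠ[𝓝 (0 : ℝ)] c := by
        filter_upwards [hS] with t ht
        change extChartAt 𝓘(ℝ, E) (γ 0) (γ t) = c t
        rw [hγ0, show γ t = φ.symm (c t) from if_pos ht]
        exact φ.right_inv ht.1
      exact (hc.congr_of_eventuallyEq hw).hasFDerivWithinAt
  refine ⟨γ, hγ0, fun t => ?_, hγ.mdifferentiableAt, ?_⟩
  · by_cases ht : t ∈ S
    · have e : γ t = φ.symm (c t) := if_pos ht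
      rw [e]
      have h1 : ψ (q (φ.symm (c t))) = ψ (q (φ.symm a)) := ht.2.2
      have h2 : φ.symm a = 1 := extChartAt_to_inv (1 : G)
      rw [h2] at h1
      have h3 := ψ.injOn ht.2.1 (mem_extChartAt_source (q 1)) h1
      simpa using QuotientGroup.eq.1 h3.symm
    · have e : γ t = 1 := if_neg ht
      rw [e]; exact H.one_mem
  · have e := congrArg (fun L : ℝ →L[ℝ] E => L (1 : ℝ)) hγ.mfderiv
    refine e.trans ?_
    exact one_smul ℝ (X : E)

/-- A reductive decomposition `𝔤 = 𝔥 ⊕ 𝔪`. -/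
structure IsReductive [LieGroup 𝓘(ℝ, E) ∞ G] (H : Subgroup G)
    (𝔪 : Submodule ℝ (GroupLieAlgebra 𝓘(ℝ, E) G)) : Prop where
  isCompl : IsCompl 𝔪 (lieAlg H)
  ad_mem : ∀ h ∈ H, ∀ X ∈ 𝔪, Ad h X ∈ 𝔪

/-- The projection `X ↦ X_𝔪` of `𝔤 = 𝔥 ⊕ 𝔪` onto `𝔪`. -/
def projM [LieGroup 𝓘(ℝ, E) ∞ G] {H : Subgroup G}
    {𝔪 : Submodule ℝ (GroupLieAlgebra 𝓘(ℝ, E) G)} (h𝔪 : IsReductive H 𝔪) :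
    GroupLieAlgebra 𝓘(ℝ, E) G →ₗ[ℝ] 𝔪 :=
  Submodule.projectionOnto 𝔪 (lieAlg H) h𝔪.isCompl

theorem dproj_bijective [FiniteDimensional ℝ E] [FiniteDimensional ℝ F]
    [LieGroup 𝓘(ℝ, E) ∞ G] {H : Subgroup G} [ChartedSpace F (G ⧸ H)]
    [IsManifold 𝓘(ℝ, F) ∞ (G ⧸ H)] (hM : IsHomogeneousManifold E F H)
    {𝔪 : Submodule ℝ (GroupLieAlgebra 𝓘(ℝ, E) G)} (h𝔪 : IsReductive H 𝔪) :
    Function.Bijective ((dproj E F H).toLinearMap ∘ₗ 𝔪.subtype) := by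
  constructor
  · rw [← LinearMap.ker_eq_bot, LinearMap.ker_eq_bot']
    intro X hX
    have h1 : (X : GroupLieAlgebra 𝓘(ℝ, E) G) ∈ lieAlg H := ker_le_lieAlg H hM hX
    exact Subtype.ext (Submodule.disjoint_def.1 h𝔪.isCompl.disjoint _ X.2 h1)
  · intro v
    obtain ⟨X, hX⟩ := hM.surjective_mfderiv 1 v
    obtain ⟨Y, hY, Z, hZ, rfl⟩ := Submodule.mem_sup.1
      ((h𝔪.isCompl.sup_eq_top).symm ▸ Submodule.mem_top : X ∈ 𝔪 ⊔ lieAlg H)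
    refine ⟨⟨Y, hY⟩, ?_⟩
    have h1 := lieAlg_le_ker (F := F) H hM hZ
    have h2 : dproj E F H (Y + Z) = v := hX
    rw [map_add, h1, add_zero] at h2
    exact h2

/-- The identification of `𝔪` with the tangent space of `G ⧸ H` at `o`. -/
def tangentEquiv [FiniteDimensional ℝ E] [FiniteDimensional ℝ F]
    [LieGroup 𝓘(ℝ, E) ∞ G] {H : Subgroup G} [ChartedSpace F (G ⧸ H)]
    [IsManifold 𝓘(ℝ, F) ∞ (G ⧸ H)] (hM : IsHomogeneousManifold E F H)
    {𝔪 : Submodule ℝ (GroupLieAlgebra 𝓘(ℝ, E) G)} (h𝔪 : IsReductive H 𝔪) :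
    𝔪 ≃ₗ[ℝ] TangentSpace 𝓘(ℝ, F) (QuotientGroup.mk 1 : G ⧸ H) :=
  LinearEquiv.ofBijective _ (dproj_bijective hM h𝔪)

/-- The value at `o` of a field of endomorphisms, as a linear operator on `𝔪`. -/
def atO [FiniteDimensional ℝ E] [FiniteDimensional ℝ F]
    [LieGroup 𝓘(ℝ, E) ∞ G] {H : Subgroup G} [ChartedSpace F (G ⧸ H)]
    [IsManifold 𝓘(ℝ, F) ∞ (G ⧸ H)] (hM : IsHomogeneousManifold E F H)
    {𝔪 : Submodule ℝ (GroupLieAlgebra 𝓘(ℝ, E) G)} (h𝔪 : IsReductive H 𝔪)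
    (f : EndoField F (G ⧸ H)) : 𝔪 →ₗ[ℝ] 𝔪 :=
  (tangentEquiv hM h𝔪).symm.toLinearMap ∘ₗ
    (f (QuotientGroup.mk 1 : G ⧸ H)).toLinearMap ∘ₗ (tangentEquiv hM h𝔪).toLinearMap

/-- The conditions imposed on the reductive complement: `𝔪 = 𝔪₁ ⊕ 𝔪₂ ⊕ 𝔪₃` with
`Ad(H)`-invariant irreducible pairwise inequivalent summands, orthogonal for the Killing form,
`0 ≠ [𝔪ᵢ, 𝔪ᵢ₊₁] ⊆ 𝔪ᵢ₊₂` (indices mod 3) and `[𝔪ᵢ, 𝔪ᵢ] ⊆ 𝔥`. -/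
structure IsThreeSummand [FiniteDimensional ℝ E] [LieGroup 𝓘(ℝ, E) ∞ G] (H : Subgroup G)
    (𝔪 : Submodule ℝ (GroupLieAlgebra 𝓘(ℝ, E) G))
    (m : Fin 3 → Submodule ℝ (GroupLieAlgebra 𝓘(ℝ, E) G)) : Prop where
  indep : iSupIndep m
  iSup_eq : ⨆ i, m i = 𝔪
  ad_mem : ∀ i, ∀ h ∈ H, ∀ X ∈ m i, Ad h X ∈ m i
  ne_bot : ∀ i, m i ≠ ⊥
  irreducible : ∀ i, ∀ W : Submodule ℝ (GroupLieAlgebra 𝓘(ℝ, E) G), W ≤ m i →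
    (∀ h ∈ H, ∀ X ∈ W, Ad h X ∈ W) → W = ⊥ ∨ W = m i
  inequivalent : ∀ i j, i ≠ j → ¬ ∃ e : m i ≃ₗ[ℝ] m j, ∀ (h : G) (hh : h ∈ H) (X : m i),
    (e ⟨Ad h X, ad_mem i h hh X X.2⟩ : GroupLieAlgebra 𝓘(ℝ, E) G) =
      Ad h (e X : GroupLieAlgebra 𝓘(ℝ, E) G)
  orthogonal : ∀ i j, i ≠ j → ∀ X ∈ m i, ∀ Y ∈ m j,
    killingForm ℝ (GroupLieAlgebra 𝓘(ℝ, E) G) X Y = 0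
  bracket_ne : ∀ i, ∃ X ∈ m i, ∃ Y ∈ m (i + 1), ⁅X, Y⁆ ≠ 0
  bracket_mem : ∀ i, ∀ X ∈ m i, ∀ Y ∈ m (i + 1), ⁅X, Y⁆ ∈ m (i + 2)
  bracket_self : ∀ i, ∀ X ∈ m i, ∀ Y ∈ m i, ⁅X, Y⁆ ∈ lieAlg H

/-- The differential of the translation `τ(a) : xH ↦ (ax)H` at a point of `G ⧸ H`. -/
def dtau {H : Subgroup G} [ChartedSpace F (G ⧸ H)] (a : G) (x : G ⧸ H) :
    TangentSpace 𝓘(ℝ, F) x →L[ℝ] TangentSpace 𝓘(ℝ, F) (a • x) :=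
  mfderiv 𝓘(ℝ, F) 𝓘(ℝ, F) (fun y : G ⧸ H => a • y) x

/-- `G`-invariant Riemannian metrics. -/
def IsInvariantMetric {H : Subgroup G} [ChartedSpace F (G ⧸ H)]
    [IsManifold 𝓘(ℝ, F) ∞ (G ⧸ H)] (g : Metric F (G ⧸ H)) : Prop :=
  ∀ (a : G) (x : G ⧸ H) (v w : TangentSpace 𝓘(ℝ, F) x),
    g.inner (a • x) (dtau a x v) (dtau a x w) = g.inner x v w

/-- `G`-invariant fields of endomorphisms: `dτ(a) ∘ f = f ∘ dτ(a)`. -/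
def IsInvariantEndo {H : Subgroup G} [ChartedSpace F (G ⧸ H)]
    (f : EndoField F (G ⧸ H)) : Prop :=
  ∀ (a : G) (x : G ⧸ H) (v : TangentSpace 𝓘(ℝ, F) x),
    dtau a x (f x v) = f (a • x) (dtau a x v)

/-- `a` are the characteristic numbers of `g`: on `𝔪`, identified with the tangent space at `o`,
`g = a₁ g₀|𝔪₁×𝔪₁ + a₂ g₀|𝔪₂×𝔪₂ + a₃ g₀|𝔪₃×𝔪₃`, where `g₀` is minus the Killing form. -/
structure HasCharNumbers [FiniteDimensional ℝ E] [LieGroup 𝓘(ℝ, E) ∞ G]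
    {H : Subgroup G} [ChartedSpace F (G ⧸ H)] [IsManifold 𝓘(ℝ, F) ∞ (G ⧸ H)] (m : Fin 3 → Submodule ℝ (GroupLieAlgebra 𝓘(ℝ, E) G))
    (g : Metric F (G ⧸ H)) (a : Fin 3 → ℝ) : Prop where
  pos : ∀ i, 0 < a i
  inner_same : ∀ i, ∀ X ∈ m i, ∀ Y ∈ m i,
    g.inner (QuotientGroup.mk 1 : G ⧸ H) (dproj E F H X) (dproj E F H Y) =
      a i * -(killingForm ℝ (GroupLieAlgebra 𝓘(ℝ, E) G) X Y)
  inner_ne : ∀ i j, i ≠ j → ∀ X ∈ m i, ∀ Y ∈ m j,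
    g.inner (QuotientGroup.mk 1 : G ⧸ H) (dproj E F H X) (dproj E F H Y) = 0

end HomSpace

end

/-!
A `G`-invariant metric `f`-structure is determined by what happens at the origin, so everything is
reduced to a computation with brackets in `𝔤`.

*From the manifold to the Lie algebra.* Each `X ∈ 𝔤` gives a fundamental field `X*` on `G ⧸ H`,
whose value at `bH` is the translate (`push`) of `Ad(b⁻¹) X`. The projection `G → G ⧸ H` relates the
right-invariant field of `X` to `X*`, and `f X*` lifts to the field `b ↦ (A Ad(b⁻¹) X)^L` on `G`, where
`A` lifts `f_o`. Since left- and right-invariant fields commute, the derivative of `b ↦ Ad(b⁻¹) Y`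
along `X^R` is `-[Ad(b⁻¹) X, Ad(b⁻¹) Y]` (`mfderiv_Ad_inv_rightField`). This gives the brackets
`[X*, Y*]` and `[X*, f Y*]` (`mlieBracket_fundField`) and the derivatives `X*⟨Y*, Z*⟩`
(`mvfderiv_inner_fundField`). The Koszul formula follows, and with it an expression for
`⟨∇_X (f) Y, Z⟩` at every point in terms of `pullInner`, the pullback of `g_o` to `𝔤`
(`two_mul_inner_covEndo`). As `∇_X (f) Y` is tensorial and fundamental fields take all values, the
three classes of `f`-structures become conditions on the form `covForm` on `𝔪`.

*The Lie algebra.* By Schur's lemma `f_o`, which commutes with `Ad(H)`, preserves the inequivalent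
irreducible modules `𝔪ⱼ` and `𝔪ₖ` separately. All brackets of elements of `𝔪` are therefore seen by
the single trilinear form `t(x, y, z) = κ([x, y], z)` on `𝔪ᵢ × 𝔪ⱼ × 𝔪ₖ`, where `κ` is minus the
Killing form (`IsFTriple.P_lie`). For `u = x + y + z`, the component of `2 ∇_u (f) u` along
`x' ∈ 𝔪ᵢ` is
`aᵢ (t(x', y, fz) - t(x', fy, z)) + (aₖ - aⱼ) (t(x', y, fz) + t(x', fy, z))`,
and the components along `𝔪ⱼ`, `𝔪ₖ` are similar and vanish when `x = 0` (`IsFTriple.covForm_self`). The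
last fact gives the `G₁f` property, because `f` kills `𝔪ᵢ`. Replacing `(y, z)` by `(fy, fz)` swaps
`t(x', y, fz)` and `t(x', fy, z)` up to sign, so that `∇_p (f) p = 0` on `𝔪ⱼ ⊕ 𝔪ₖ` splits into
`t(x, y, fz) = t(x, fy, z)` (`IsBalanced`) and `aⱼ = aₖ`, because `t ≠ 0`. The remaining components
add `aₖ = ¾ aᵢ` in the Killing case. The bracket conditions `[p, fp]_𝔪 = 0` and
`[x, fp] + f [x, p] = 0` say the same as `IsBalanced`, since `g_o` is positive definite on `𝔪`.
-/

open scoped Manifold ContDiff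
open Bundle

noncomputable section

namespace HomSpace
open MetricF Topology VectorField

/-! ### Brackets of related vector fields -/

section Related

variable {E : Type*} [NormedAddCommGroup E] [NormedSpace ℝ E]
  {H : Type*} [TopologicalSpace H] {I : ModelWithCorners ℝ E H}
  {M : Type*} [TopologicalSpace M] [ChartedSpace H M] [IsManifold I 2 M]
  {E' : Type*} [NormedAddCommGroup E'] [NormedSpace ℝ E']
  {H' : Type*} [TopologicalSpace H'] {I' : ModelWithCorners ℝ E' H'}
  {M' : Type*} [TopologicalSpace M'] [ChartedSpace H' M'] [IsManifold I' 2 M']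

/-- The representative of a vector field in the chart at `x₀`. -/
def chartField (I : ModelWithCorners ℝ E H) (x₀ : M) (V : (x : M) → TangentSpace I x) : E → E :=
  mpullbackWithin 𝓘(ℝ, E) I (extChartAt I x₀).symm V (Set.range I)

theorem inverse_mfderivWithin_extChartAt_symm {x₀ x : M} (hx : x ∈ (extChartAt I x₀).source) :
    (mfderivWithin 𝓘(ℝ, E) I (extChartAt I x₀).symm (Set.range I)
      (extChartAt I x₀ x)).inverse = mfderiv I 𝓘(ℝ, E) (extChartAt I x₀) x := by
  have : IsManifold I 1 M := IsManifold.of_le (n := 2) (by norm_num)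
  apply ContinuousLinearMap.inverse_eq
  · exact mfderivWithin_extChartAt_symm_comp_mfderiv_extChartAt' hx
  · exact mfderiv_extChartAt_comp_mfderivWithin_extChartAt_symm' hx

theorem chartField_apply {x₀ x : M} (hx : x ∈ (extChartAt I x₀).source)
    (V : (x : M) → TangentSpace I x) :
    chartField I x₀ V (extChartAt I x₀ x) = mfderiv I 𝓘(ℝ, E) (extChartAt I x₀) x (V x) := by
  rw [← inverse_mfderivWithin_extChartAt_symm hx]
  have h : (extChartAt I x₀).symm (extChartAt I x₀ x) = x := (extChartAt I x₀).left_inv hx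
  unfold chartField
  rw [mpullbackWithin_apply, h]

theorem differentiableAt_chartField [I.Boundaryless] [CompleteSpace E] {x₀ : M}
    {V : (x : M) → TangentSpace I x}
    (hV : MDifferentiableAt I I.tangent (fun x => (V x : TangentBundle I M)) x₀) :
    DifferentiableAt ℝ (chartField I x₀ V) (extChartAt I x₀ x₀) := by
  have h := (mdifferentiableWithinAt_univ.2 hV).differentiableWithinAt_mpullbackWithin_vectorField
  rw [Set.preimage_univ, Set.univ_inter, I.range_eq_univ] at h
  simpa [chartField, I.range_eq_univ] using h.differentiableAt Filter.univ_mem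

/-- The manifold bracket, read in the chart at `x₀`, is the bracket of the chart representatives. -/
theorem mfderiv_extChartAt_mlieBracket [I.Boundaryless] (x₀ : M)
    (V W : (x : M) → TangentSpace I x) :
    (mfderiv I 𝓘(ℝ, E) (extChartAt I x₀) x₀ (mlieBracket I V W x₀) : E) =
      lieBracket ℝ (chartField I x₀ V) (chartField I x₀ W) (extChartAt I x₀ x₀) := by
  have : IsManifold I 1 M := IsManifold.of_le (n := 2) (by norm_num)
  have h := isInvertible_mfderiv_extChartAt (I := I) (mem_extChartAt_source (I := I) x₀)
  have e : lieBracketWithin ℝ (chartField I x₀ V) (chartField I x₀ W)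
      ((extChartAt I x₀).symm ⁻¹' Set.univ ∩ Set.range I) (extChartAt I x₀ x₀) =
      lieBracket ℝ (chartField I x₀ V) (chartField I x₀ W) (extChartAt I x₀ x₀) := by
    rw [Set.preimage_univ, Set.univ_inter, I.range_eq_univ, lieBracketWithin_univ]
  rw [← e, ← mlieBracketWithin_univ, mlieBracketWithin_apply]
  exact h.self_apply_inverse _

/-- Vector fields related by a smooth map `q` have brackets related by `q`. -/
theorem mfderiv_mlieBracket_of_related [I.Boundaryless] [I'.Boundaryless] [CompleteSpace E]
    [CompleteSpace E'] {q : M → M'} {x₀ : M} (hq : ContMDiff I I' 2 q)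
    {V W : (x : M) → TangentSpace I x} {V' W' : (x : M') → TangentSpace I' x}
    (hV : MDifferentiableAt I I.tangent (fun x => (V x : TangentBundle I M)) x₀)
    (hW : MDifferentiableAt I I.tangent (fun x => (W x : TangentBundle I M)) x₀)
    (hV' : MDifferentiableAt I' I'.tangent (fun x => (V' x : TangentBundle I' M')) (q x₀))
    (hW' : MDifferentiableAt I' I'.tangent (fun x => (W' x : TangentBundle I' M')) (q x₀))
    (hVV' : ∀ x, mfderiv I I' q x (V x) = V' (q x))
    (hWW' : ∀ x, mfderiv I I' q x (W x) = W' (q x)) :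
    mfderiv I I' q x₀ (mlieBracket I V W x₀) = mlieBracket I' V' W' (q x₀) := by
  have : IsManifold I 1 M := IsManifold.of_le (n := 2) (by norm_num)
  have : IsManifold I' 1 M' := IsManifold.of_le (n := 2) (by norm_num)
  let φ := extChartAt I x₀
  let ψ := extChartAt I' (q x₀)
  let a : E := φ x₀
  let p : E → E' := writtenInExtChartAt I I' x₀ q
  have hφs : φ.symm a = x₀ := extChartAt_to_inv x₀
  have hpc : ContDiffAt ℝ 2 p a := by
    have := (contMDiffAt_iff (I := I) (I' := I') (x := x₀)).1 (hq x₀)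
    simpa [contDiffWithinAt_univ, I.range_eq_univ] using! this.2
  have hpa : p a = ψ (q x₀) := by
    change ψ (q (φ.symm a)) = _; rw [hφs]
  -- near `x₀` the chain rule holds for `ψ ∘ q = p ∘ φ`
  have hsrc : ∀ᶠ x in 𝓝 x₀, x ∈ φ.source := extChartAt_source_mem_nhds x₀
  have hsrc' : ∀ᶠ x in 𝓝 x₀, q x ∈ ψ.source :=
    hq.continuous.continuousAt.eventually_mem (extChartAt_source_mem_nhds (q x₀))
  have hpe : ∀ᶠ y in 𝓝 a, ContDiffAt ℝ 2 p y := hpc.eventually (by simp)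
  have hpe' : ∀ᶠ x in 𝓝 x₀, ContDiffAt ℝ 2 p (φ x) :=
    (continuousAt_extChartAt x₀).eventually hpe
  have chain : ∀ᶠ x in 𝓝 x₀, ∀ v : TangentSpace I x,
      (mfderiv I' 𝓘(ℝ, E') ψ (q x) (mfderiv I I' q x v) : E') =
        fderiv ℝ p (φ x) (mfderiv I 𝓘(ℝ, E) φ x v : E) := by
    filter_upwards [hsrc, hsrc', hpe', eventually_mem_nhds_iff.2 hsrc] with x h2 h3 h4 h5 v
    have d1 : MDifferentiableAt I 𝓘(ℝ, E) φ x :=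
      mdifferentiableAt_extChartAt (by simpa [φ] using h2)
    have d2 : MDifferentiableAt I' 𝓘(ℝ, E') ψ (q x) :=
      mdifferentiableAt_extChartAt (by simpa [ψ] using h3)
    have d3 := (hq x).mdifferentiableAt (by simp)
    have d4 : MDifferentiableAt 𝓘(ℝ, E) 𝓘(ℝ, E') p (φ x) :=
      (h4.differentiableAt (by simp)).mdifferentiableAt
    have e1 := mfderiv_comp_apply x d2 d3 v
    have e2 := mfderiv_comp_apply x d4 d1 v
    have e3 : (ψ ∘ q) =ᶠ[𝓝 x] (p ∘ φ) := by
      filter_upwards [h5] with z hz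
      change ψ (q z) = ψ (q (φ.symm (φ z)))
      rw [φ.left_inv hz]
    have e4 := congrArg (fun L : E →L[ℝ] E' => L v)
      (e3.mfderiv_eq (I := I) (I' := 𝓘(ℝ, E')))
    rw [mfderiv_eq_fderiv] at e2
    exact e1.symm.trans (e4.trans e2)
  -- the chart representatives are related by `p` near `a`
  have rel : ∀ (V : (x : M) → TangentSpace I x) (V' : (x : M') → TangentSpace I' x),
      (∀ x, mfderiv I I' q x (V x) = V' (q x)) →
      (fun y => fderiv ℝ p y (chartField I x₀ V y)) =ᶠ[𝓝 a]
        (fun y => chartField I' (q x₀) V' (p y)) := by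
    intro V V' h
    have c : ContinuousAt φ.symm a := continuousAt_extChartAt_symm x₀
    have c' : Filter.Tendsto φ.symm (𝓝 a) (𝓝 x₀) := by simpa [hφs] using c.tendsto
    filter_upwards [c'.eventually chain, c'.eventually hsrc, c'.eventually hsrc',
      extChartAt_target_mem_nhds (I := I) x₀] with y h1 h2 h3 h4
    have e : φ (φ.symm y) = y := φ.right_inv h4
    have h1 := h1 (V (φ.symm y))
    rw [h] at h1
    have e1 := chartField_apply (I := I) h2 V
    have e2 := chartField_apply (I := I') h3 V'
    change _ = chartField I' (q x₀) V' (ψ (q (φ.symm y)))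
    refine Eq.trans ?_ (h1.symm.trans e2.symm)
    change chartField I x₀ V (φ (φ.symm y)) = _ at e1
    rw [e] at e1 h1 ⊢
    rw [e1]
  have dV := differentiableAt_chartField hV
  have dW := differentiableAt_chartField hW
  have dV' := differentiableAt_chartField hV'
  have dW' := differentiableAt_chartField hW'
  -- the vector space version: `Dp [V, W] = D(Dp W) V - D(Dp V) W`, and `Dp V = V' ∘ p`
  have key : fderiv ℝ p a (lieBracket ℝ (chartField I x₀ V) (chartField I x₀ W) a) =
      lieBracket ℝ (chartField I' (q x₀) V') (chartField I' (q x₀) W') (ψ (q x₀)) := by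
    rw [fderiv_apply_lieBracket hpc (by simp) dW dV, (rel V V' hVV').fderiv_eq,
      (rel W W' hWW').fderiv_eq]
    have dp : HasFDerivAt p (fderiv ℝ p a) a := (hpc.differentiableAt (by simp)).hasFDerivAt
    have hV'' : DifferentiableAt ℝ (chartField I' (q x₀) V') (p a) := by rw [hpa]; exact dV'
    have hW'' : DifferentiableAt ℝ (chartField I' (q x₀) W') (p a) := by rw [hpa]; exact dW'
    have r1 := (hV''.hasFDerivAt.comp a dp).fderiv
    have r2 := (hW''.hasFDerivAt.comp a dp).fderiv
    have s1 := (rel V V' hVV').self_of_nhds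
    have s2 := (rel W W' hWW').self_of_nhds
    change fderiv ℝ (fun y => chartField I' (q x₀) V' (p y)) a = _ at r1
    change fderiv ℝ (fun y => chartField I' (q x₀) W' (p y)) a = _ at r2
    rw [r1, r2, lieBracket, ← hpa]
    simp only [ContinuousLinearMap.comp_apply]
    change fderiv ℝ p a (chartField I x₀ V a) = _ at s1
    change fderiv ℝ p a (chartField I x₀ W a) = _ at s2
    rw [s1, s2]
  have e1 := mfderiv_extChartAt_mlieBracket (I := I) x₀ V W
  have e2 := mfderiv_extChartAt_mlieBracket (I := I') (q x₀) V' W'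
  have e3 := chain.self_of_nhds (mlieBracket I V W x₀)
  have hinj : Function.Injective (mfderiv I' 𝓘(ℝ, E') ψ (q x₀)) :=
    (isInvertible_mfderiv_extChartAt (I := I') (mem_extChartAt_source (I := I') (q x₀))).injective
  apply hinj
  refine e3.trans (Eq.trans ?_ e2.symm)
  exact (congrArg (fderiv ℝ p a) e1).trans key

end Related
/-! ### Partial derivatives of smooth maps -/

section Generator

variable {E : Type*} [NormedAddCommGroup E] [NormedSpace ℝ E]
  {G : Type*} [TopologicalSpace G] [ChartedSpace E G] [IsManifold 𝓘(ℝ, E) ∞ G]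
  {E₁ : Type*} [NormedAddCommGroup E₁] [NormedSpace ℝ E₁]
  {N : Type*} [TopologicalSpace N] [ChartedSpace E₁ N]
  {E₂ : Type*} [NormedAddCommGroup E₂] [NormedSpace ℝ E₂]
  {M : Type*} [TopologicalSpace M] [ChartedSpace E₂ M] [IsManifold 𝓘(ℝ, E₂) ∞ M]

/-- The partial derivative of a smooth map in a fixed direction `X` of the first factor depends
smoothly on the second factor. -/
theorem contMDiff_partial_left [IsManifold 𝓘(ℝ, E₁) ∞ N] {Φ : G × N → M}
    (hΦ : ContMDiff (𝓘(ℝ, E).prod 𝓘(ℝ, E₁)) 𝓘(ℝ, E₂) ∞ Φ) (p : G)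
    (X : E) :
    ContMDiff 𝓘(ℝ, E₁) 𝓘(ℝ, E₂).tangent ∞ (fun y : N =>
      (⟨Φ (p, y), mfderiv 𝓘(ℝ, E) 𝓘(ℝ, E₂) (fun x : G => Φ (x, y)) p X⟩ : TangentBundle 𝓘(ℝ, E₂) M)) := by
  have s0 : ContMDiff 𝓘(ℝ, E₁) 𝓘(ℝ, E₁).tangent ∞
      (fun y : N => (⟨y, 0⟩ : TangentBundle 𝓘(ℝ, E₁) N)) := contMDiff_zeroSection _ _
  have s1 : ContMDiff 𝓘(ℝ, E₁) 𝓘(ℝ, E).tangent ∞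
      (fun _ : N => (TotalSpace.mk p X : TangentBundle 𝓘(ℝ, E) G)) := contMDiff_const
  have s2 := s1.prodMk s0
  have s3 : ContMDiff (𝓘(ℝ, E).tangent.prod 𝓘(ℝ, E₁).tangent) (𝓘(ℝ, E).prod 𝓘(ℝ, E₁)).tangent ∞
    (equivTangentBundleProd 𝓘(ℝ, E) G 𝓘(ℝ, E₁) N).symm := contMDiff_equivTangentBundleProd_symm
  have s4 : ContMDiff (𝓘(ℝ, E).prod 𝓘(ℝ, E₁)).tangent 𝓘(ℝ, E₂).tangent ∞
    (tangentMap (𝓘(ℝ, E).prod 𝓘(ℝ, E₁)) 𝓘(ℝ, E₂) Φ) := hΦ.contMDiff_tangentMap (by simp)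
  refine ((s4.comp s3).comp s2).congr fun y => ?_
  have hd : MDifferentiableAt (𝓘(ℝ, E).prod 𝓘(ℝ, E₁)) 𝓘(ℝ, E₂) Φ (p, y) :=
    (hΦ (p, y)).mdifferentiableAt (by simp)
  have e := mfderiv_prod_eq_add_apply hd (v := (X, (0 : E₁)))
  change _ = (⟨Φ (p, y), mfderiv (𝓘(ℝ, E).prod 𝓘(ℝ, E₁)) 𝓘(ℝ, E₂) Φ (p, y) (X, (0 : E₁))⟩ :
    TangentBundle 𝓘(ℝ, E₂) M)
  have e0 : mfderiv 𝓘(ℝ, E₁) 𝓘(ℝ, E₂) (fun z : N => Φ (p, z)) y (0 : E₁) = 0 :=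
    map_zero (mfderiv 𝓘(ℝ, E₁) 𝓘(ℝ, E₂) (fun z : N => Φ (p, z)) y)
  refine congrArg (TotalSpace.mk' E₂ (Φ (p, y))) (Eq.trans ?_ e.symm)
  refine (add_zero _).symm.trans ?_
  exact congrArg₂ (fun u v : E₂ => u + v) rfl e0.symm

/-- A family of tangent vectors at a fixed point is differentiable as a map to the tangent
bundle only if it is differentiable as a map to the model space. -/
theorem mdifferentiableAt_of_mk {p : M} {v : N → E₂} {y : N}
    (h : MDifferentiableAt 𝓘(ℝ, E₁) 𝓘(ℝ, E₂).tangent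
      (fun y : N => (⟨p, v y⟩ : TangentBundle 𝓘(ℝ, E₂) M)) y) :
    MDifferentiableAt 𝓘(ℝ, E₁) 𝓘(ℝ, E₂) v y := by
  have h1 := ((mdifferentiableAt_totalSpace 𝓘(ℝ, E₂) (F := E₂)
    (E := fun x : M => TangentSpace 𝓘(ℝ, E₂) x)
    (fun y : N => (⟨p, v y⟩ : TangentBundle 𝓘(ℝ, E₂) M))).1 h).2
  refine h1.congr_of_eventuallyEq (Filter.Eventually.of_forall fun z => ?_)
  exact ((tangentBundleCore 𝓘(ℝ, E₂) M).coordChange_self (achart E₂ p) p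
    (mem_chart_source E₂ p) (v z)).symm

end Generator

/-! ### Invariant vector fields on a Lie group and the derivative of `Ad` -/

section Fields

variable {E : Type*} [NormedAddCommGroup E] [NormedSpace ℝ E]
  {G : Type*} [TopologicalSpace G] [ChartedSpace E G] [Group G] [LieGroup 𝓘(ℝ, E) ∞ G]

/-- The left-invariant vector field with value `X` at `1`. -/
abbrev leftField (X : GroupLieAlgebra 𝓘(ℝ, E) G) (x : G) : TangentSpace 𝓘(ℝ, E) x :=
  mulInvariantVectorField X x

/-- The right-invariant vector field with value `X` at `1`. -/
def rightField (X : GroupLieAlgebra 𝓘(ℝ, E) G) (x : G) : TangentSpace 𝓘(ℝ, E) x :=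
  (mfderiv 𝓘(ℝ, E) 𝓘(ℝ, E) (fun y : G => y * x) 1 : E →L[ℝ] E) X

theorem contMDiff_rightField (X : GroupLieAlgebra 𝓘(ℝ, E) G) :
    ContMDiff 𝓘(ℝ, E) 𝓘(ℝ, E).tangent ∞
      (fun x : G => (rightField X x : TangentBundle 𝓘(ℝ, E) G)) := by
  refine (contMDiff_partial_left (contMDiff_mul 𝓘(ℝ, E) ∞ (G := G)) 1 X).congr fun x => ?_
  -- the curve of base points is `1 * x`, which equals `x` only propositionally
  have h : ∀ (z : G), z = x → (⟨x, rightField X x⟩ : TangentBundle 𝓘(ℝ, E) G) =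
    ⟨z, rightField X x⟩ := by rintro _ rfl; rfl
  exact h _ (one_mul x)

theorem mdifferentiableAt_rightField (X : GroupLieAlgebra 𝓘(ℝ, E) G) (x : G) :
    MDifferentiableAt 𝓘(ℝ, E) 𝓘(ℝ, E).tangent
      (fun x : G => (rightField X x : TangentBundle 𝓘(ℝ, E) G)) x :=
  (contMDiff_rightField X x).mdifferentiableAt (by simp)

theorem mdifferentiableAt_leftField (X : GroupLieAlgebra 𝓘(ℝ, E) G) (x : G) :
    MDifferentiableAt 𝓘(ℝ, E) 𝓘(ℝ, E).tangent
      (fun x : G => (leftField X x : TangentBundle 𝓘(ℝ, E) G)) x :=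
  mdifferentiableAt_mulInvariantVectorField X

theorem mdifferentiableAt_mul_left (a x : G) :
    MDifferentiableAt 𝓘(ℝ, E) 𝓘(ℝ, E) (fun y : G => a * y) x :=
  (contMDiff_mul_left (I := 𝓘(ℝ, E)) (n := ∞)).mdifferentiableAt (by simp)

theorem mdifferentiableAt_mul_right (a x : G) :
    MDifferentiableAt 𝓘(ℝ, E) 𝓘(ℝ, E) (fun y : G => y * a) x :=
  (contMDiff_mul_right (I := 𝓘(ℝ, E)) (n := ∞)).mdifferentiableAt (by simp)

theorem mfderiv_mul_left_leftField (a b : G) (X : GroupLieAlgebra 𝓘(ℝ, E) G) :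
    (mfderiv 𝓘(ℝ, E) 𝓘(ℝ, E) (fun y : G => a * y) b (leftField X b) : E) =
      leftField X (a * b) := by
  have e := mfderiv_comp_apply_of_eq (I := 𝓘(ℝ, E)) (I' := 𝓘(ℝ, E)) (I'' := 𝓘(ℝ, E)) (1 : G)
    (mdifferentiableAt_mul_left a b) (mdifferentiableAt_mul_left b 1) (mul_one b) X
  have h : (fun y : G => a * y) ∘ (fun y : G => b * y) = fun y => a * b * y := by
    ext; simp [mul_assoc]
  rw [h] at e
  exact e.symm

theorem mfderiv_mul_right_rightField (a b : G) (X : GroupLieAlgebra 𝓘(ℝ, E) G) :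
    (mfderiv 𝓘(ℝ, E) 𝓘(ℝ, E) (fun y : G => y * b) a (rightField X a) : E) =
      rightField X (a * b) := by
  have e := mfderiv_comp_apply_of_eq (I := 𝓘(ℝ, E)) (I' := 𝓘(ℝ, E)) (I'' := 𝓘(ℝ, E)) (1 : G)
    (mdifferentiableAt_mul_right b a) (mdifferentiableAt_mul_right a 1) (one_mul a) X
  have h : (fun y : G => y * b) ∘ (fun y : G => y * a) = fun y => y * (a * b) := by
    ext; simp [mul_assoc]
  rw [h] at e
  exact e.symm

/-- `Y^R_b = (Ad(b⁻¹) Y)^L_b`. -/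
theorem rightField_eq (Y : GroupLieAlgebra 𝓘(ℝ, E) G) (b : G) :
    rightField Y b = leftField (Ad b⁻¹ Y) b := by
  have hd : MDifferentiableAt 𝓘(ℝ, E) 𝓘(ℝ, E) (fun x : G => b⁻¹ * x * b⁻¹⁻¹) 1 :=
    (mdifferentiableAt_mul_right b⁻¹⁻¹ (b⁻¹ * 1)).comp (1 : G) (mdifferentiableAt_mul_left b⁻¹ 1)
  have e := mfderiv_comp_apply_of_eq (I := 𝓘(ℝ, E)) (I' := 𝓘(ℝ, E)) (I'' := 𝓘(ℝ, E)) (1 : G)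
    (mdifferentiableAt_mul_left b 1) hd (by simp) Y
  have h : (fun y : G => b * y) ∘ (fun x : G => b⁻¹ * x * b⁻¹⁻¹) = fun y => y * b := by
    ext; simp [mul_assoc]
  rw [h] at e
  exact e

/-- `b ↦ Ad(b⁻¹) Y` is differentiable. -/
theorem mdifferentiableAt_Ad_inv (Y : GroupLieAlgebra 𝓘(ℝ, E) G) (b : G) :
    MDifferentiableAt 𝓘(ℝ, E) 𝓘(ℝ, E) (M' := E) (fun x : G => Ad x⁻¹ Y) b := by
  refine mdifferentiableAt_of_mk (E₂ := E) (M := G) (p := 1) (v := fun x : G => (Ad x⁻¹ Y : E)) ?_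
  have hc : ContMDiff (𝓘(ℝ, E).prod 𝓘(ℝ, E)) 𝓘(ℝ, E) ∞
      (fun p : G × G => p.2⁻¹ * p.1 * p.2⁻¹⁻¹) :=
    (contMDiff_snd.inv.mul contMDiff_fst).mul contMDiff_snd.inv.inv
  have := ((contMDiff_partial_left hc 1 Y).congr (f₁ := fun x : G =>
    (⟨1, (Ad x⁻¹ Y : E)⟩ : TangentBundle 𝓘(ℝ, E) G)) fun x => ?_)
  · exact (this b).mdifferentiableAt (by simp)
  · have h : ∀ (z : G), z = 1 → (⟨1, (Ad x⁻¹ Y : E)⟩ : TangentBundle 𝓘(ℝ, E) G) =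
      ⟨z, (Ad x⁻¹ Y : E)⟩ := by rintro _ rfl; rfl
    exact h _ (by simp)

/-- Left-invariant and right-invariant vector fields commute. On `G × G` the fields `(Y^R, 0)` and
`(0, X^L)` have bracket zero, and multiplication `G × G → G` relates them to `Y^R` and `X^L`. -/
theorem mlieBracket_rightField_leftField [CompleteSpace E] (X Y : GroupLieAlgebra 𝓘(ℝ, E) G) (x : G) :
    mlieBracket 𝓘(ℝ, E) (rightField Y) (leftField X) x = 0 := by
  let V : (p : G × G) → TangentSpace (𝓘(ℝ, E).prod 𝓘(ℝ, E)) p := fun p => (rightField Y p.1, (0 : E))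
  let W : (p : G × G) → TangentSpace (𝓘(ℝ, E).prod 𝓘(ℝ, E)) p := fun p => ((0 : E), leftField X p.2)
  have zs : ∀ p : G, MDifferentiableAt 𝓘(ℝ, E) 𝓘(ℝ, E).tangent
      (fun y : G => (⟨y, 0⟩ : TangentBundle 𝓘(ℝ, E) G)) p := fun p =>
    ((contMDiff_zeroSection (n := ∞) ℝ (fun x : G => TangentSpace 𝓘(ℝ, E) x)) p).mdifferentiableAt (by simp)
  have hsym : ∀ q, MDifferentiableAt (𝓘(ℝ, E).tangent.prod 𝓘(ℝ, E).tangent)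
      (𝓘(ℝ, E).prod 𝓘(ℝ, E)).tangent (equivTangentBundleProd 𝓘(ℝ, E) G 𝓘(ℝ, E) G).symm q :=
    fun q => (contMDiff_equivTangentBundleProd_symm (n := ∞) q).mdifferentiableAt (by simp)
  have hV : ∀ p, MDifferentiableAt (𝓘(ℝ, E).prod 𝓘(ℝ, E)) (𝓘(ℝ, E).prod 𝓘(ℝ, E)).tangent
      (fun p => (V p : TangentBundle (𝓘(ℝ, E).prod 𝓘(ℝ, E)) (G × G))) p := fun p =>
    (hsym _).comp p (((mdifferentiableAt_rightField Y p.1).comp p mdifferentiableAt_fst).prodMk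
      ((zs p.2).comp p mdifferentiableAt_snd))
  have hW : ∀ p, MDifferentiableAt (𝓘(ℝ, E).prod 𝓘(ℝ, E)) (𝓘(ℝ, E).prod 𝓘(ℝ, E)).tangent
      (fun p => (W p : TangentBundle (𝓘(ℝ, E).prod 𝓘(ℝ, E)) (G × G))) p := fun p =>
    (hsym _).comp p (((zs p.1).comp p mdifferentiableAt_fst).prodMk
      ((mdifferentiableAt_leftField X p.2).comp p mdifferentiableAt_snd))
  -- both components of the bracket on `G × G` vanish, since the projections relate one of the two
  -- fields to `0`
  let B : E × E := mlieBracket (𝓘(ℝ, E).prod 𝓘(ℝ, E)) V W (x, 1)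
  have h1 : B.1 = 0 := by
    have e := mfderiv_mlieBracket_of_related (x₀ := ((x, 1) : G × G))
      (contMDiff_fst (I := 𝓘(ℝ, E)) (J := 𝓘(ℝ, E)) (M := G) (N := G) (n := 2)) (hV (x, 1)) (hW (x, 1))
      (mdifferentiableAt_rightField Y x) (zs x)
      (fun p => congrArg (fun L : E × E →L[ℝ] E => L (rightField Y p.1, (0 : E))) mfderiv_fst)
      (fun p => congrArg (fun L : E × E →L[ℝ] E => L ((0 : E), leftField X p.2)) mfderiv_fst)
    have e' := congrArg (fun L : E × E →L[ℝ] E => L B)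
      (mfderiv_fst (I := 𝓘(ℝ, E)) (I' := 𝓘(ℝ, E)) (x := ((x, 1) : G × G)))
    refine e'.symm.trans (e.trans ?_)
    exact congrFun (mlieBracket_zero_right (W := rightField Y)) x
  have h2 : B.2 = 0 := by
    have e := mfderiv_mlieBracket_of_related (x₀ := ((x, 1) : G × G))
      (contMDiff_snd (I := 𝓘(ℝ, E)) (J := 𝓘(ℝ, E)) (M := G) (N := G) (n := 2)) (hV (x, 1)) (hW (x, 1))
      (zs 1) (mdifferentiableAt_leftField X 1)
      (fun p => congrArg (fun L : E × E →L[ℝ] E => L (rightField Y p.1, (0 : E))) mfderiv_snd)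
      (fun p => congrArg (fun L : E × E →L[ℝ] E => L ((0 : E), leftField X p.2)) mfderiv_snd)
    have e' := congrArg (fun L : E × E →L[ℝ] E => L B)
      (mfderiv_snd (I := 𝓘(ℝ, E)) (I' := 𝓘(ℝ, E)) (x := ((x, 1) : G × G)))
    refine e'.symm.trans (e.trans ?_)
    exact congrFun (mlieBracket_zero_left (W := leftField X)) 1
  have hB : B = 0 := Prod.ext h1 h2
  have hmul : ContMDiff (𝓘(ℝ, E).prod 𝓘(ℝ, E)) 𝓘(ℝ, E) 2 (fun p : G × G => p.1 * p.2) :=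
    contMDiff_mul 𝓘(ℝ, E) 2
  have hd : ∀ (p : G × G) (u v : E),
      (mfderiv (𝓘(ℝ, E).prod 𝓘(ℝ, E)) 𝓘(ℝ, E) (fun p : G × G => p.1 * p.2) p : E × E →L[ℝ] E)
        (u, v) = (mfderiv 𝓘(ℝ, E) 𝓘(ℝ, E) (fun y : G => y * p.2) p.1 : E →L[ℝ] E) u +
        (mfderiv 𝓘(ℝ, E) 𝓘(ℝ, E) (fun y : G => p.1 * y) p.2 : E →L[ℝ] E) v := fun p u v =>
    mfderiv_prod_eq_add_apply (v := ((u, v) : E × E)) ((hmul p).mdifferentiableAt (by simp))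
  have z1 : ∀ (L L' : E →L[ℝ] E) (u : E), L u + L' 0 = L u := by simp
  have z2 : ∀ (L L' : E →L[ℝ] E) (u : E), L 0 + L' u = L' u := by simp
  have z3 : ∀ (L : E × E →L[ℝ] E) (u : E × E), u = 0 → L u = 0 := by
    rintro L _ rfl; exact map_zero L
  have e := mfderiv_mlieBracket_of_related (x₀ := ((x, 1) : G × G)) hmul (hV (x, 1)) (hW (x, 1))
    (mdifferentiableAt_rightField Y (x * 1)) (mdifferentiableAt_leftField X (x * 1))
    (fun p => (hd p _ _).trans
      ((z1 _ _ _).trans (mfderiv_mul_right_rightField p.1 p.2 Y)))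
    (fun p => (hd p _ _).trans
      ((z2 _ _ _).trans (mfderiv_mul_left_leftField p.1 p.2 X)))
  have e2 : (mlieBracket 𝓘(ℝ, E) (rightField Y) (leftField X) (x * 1) : E) = 0 := by
    refine e.symm.trans ?_
    exact z3 (mfderiv (𝓘(ℝ, E).prod 𝓘(ℝ, E)) 𝓘(ℝ, E) (fun p : G × G => p.1 * p.2) (x, 1)) B hB
  rwa [mul_one] at e2

/-- The vector field `x ↦ (C x)^L_x` attached to a Lie algebra valued function `C`. -/
def varField (C : G → E) (x : G) : TangentSpace 𝓘(ℝ, E) x :=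
  leftField (C x : GroupLieAlgebra 𝓘(ℝ, E) G) x

theorem leftField_injective (x : G) :
    Function.Injective (fun X : GroupLieAlgebra 𝓘(ℝ, E) G => leftField X x) := by
  intro X Y h
  have key : ∀ Z : GroupLieAlgebra 𝓘(ℝ, E) G, (mfderiv 𝓘(ℝ, E) 𝓘(ℝ, E) (fun y : G => x⁻¹ * y) x
      (leftField Z x) : E) = Z := fun Z => by
    refine (mfderiv_mul_left_leftField x⁻¹ x Z).trans ?_
    exact mfderiv_mul_left_one (E := E) (inv_mul_cancel x) rfl Z
  rw [← key X, ← key Y]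
  exact congrArg (mfderiv 𝓘(ℝ, E) 𝓘(ℝ, E) (fun y : G => x⁻¹ * y) x) h

variable [FiniteDimensional ℝ E]

theorem mlieBracket_sum_right {ι : Type*} (s : Finset ι) (V : (x : G) → TangentSpace 𝓘(ℝ, E) x)
    (W : ι → (x : G) → TangentSpace 𝓘(ℝ, E) x) (b : G)
    (hW : ∀ i, MDifferentiableAt 𝓘(ℝ, E) 𝓘(ℝ, E).tangent
      (fun x : G => (W i x : TangentBundle 𝓘(ℝ, E) G)) b) :
    mlieBracket 𝓘(ℝ, E) V (∑ i ∈ s, W i) b = ∑ i ∈ s, mlieBracket 𝓘(ℝ, E) V (W i) b ∧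
    MDifferentiableAt 𝓘(ℝ, E) 𝓘(ℝ, E).tangent
      (fun x : G => ((∑ i ∈ s, W i) x : TangentBundle 𝓘(ℝ, E) G)) b := by
  classical
  induction s using Finset.induction_on with
  | empty =>
    simp only [Finset.sum_empty]
    exact ⟨congrFun mlieBracket_zero_right b,
      ((contMDiff_zeroSection (n := ∞) ℝ (fun x : G => TangentSpace 𝓘(ℝ, E) x)) b).mdifferentiableAt
        (by simp)⟩
  | insert a s ha h =>
    simp only [Finset.sum_insert ha]
    exact ⟨by rw [mlieBracket_add_right (hW a) h.2, h.1],
      mdifferentiableAt_add_section (hW a) h.2⟩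

/-- The expansion of `varField C` in the left-invariant frame of a basis of `𝔤`. -/
theorem varField_eq_sum (C : G → E) : varField C =
    ∑ i, (fun x => (Module.finBasis ℝ E).repr (C x) i) •
      (varField fun _ => Module.finBasis ℝ E i) := by
  have h : ∀ (L : E →L[ℝ] E) (v : E), L v =
      ∑ i, (Module.finBasis ℝ E).repr v i • L (Module.finBasis ℝ E i) := fun L v => by
    conv_lhs => rw [← (Module.finBasis ℝ E).sum_repr v, map_sum]
    simp only [map_smul]
  funext x
  rw [Finset.sum_apply]
  exact h (mfderiv 𝓘(ℝ, E) 𝓘(ℝ, E) (fun y : G => x * y) 1) (C x)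

/-- The Leibniz rule for the bracket with `x ↦ (C x)^L_x`. -/
theorem mlieBracket_varField {C : G → E} {b : G} (hC : MDifferentiableAt 𝓘(ℝ, E) 𝓘(ℝ, E) C b)
    (V : (x : G) → TangentSpace 𝓘(ℝ, E) x) :
    mlieBracket 𝓘(ℝ, E) V (varField C) b =
      leftField ((mfderiv 𝓘(ℝ, E) 𝓘(ℝ, E) C b : E →L[ℝ] E) (V b) : GroupLieAlgebra 𝓘(ℝ, E) G) b +
        mlieBracket 𝓘(ℝ, E) V (leftField (C b : GroupLieAlgebra 𝓘(ℝ, E) G)) b := by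
  let B := Module.finBasis ℝ E
  let f : Fin (Module.finrank ℝ E) → G → ℝ := fun i x => B.repr (C x) i
  let D : E := (mfderiv 𝓘(ℝ, E) 𝓘(ℝ, E) C b : E →L[ℝ] E) (V b)
  have hf : ∀ i, HasMFDerivAt 𝓘(ℝ, E) 𝓘(ℝ, ℝ) (f i) b
      (((B.coord i).toContinuousLinearMap : E →L[ℝ] ℝ).comp
        (mfderiv 𝓘(ℝ, E) 𝓘(ℝ, E) C b : E →L[ℝ] E)) := fun i =>
    ((B.coord i).toContinuousLinearMap.hasMFDerivAt (x := C b)).comp b hC.hasMFDerivAt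
  have hE : ∀ X : E, MDifferentiableAt 𝓘(ℝ, E) 𝓘(ℝ, E).tangent
      (fun x : G => (varField (fun _ => X) x : TangentBundle 𝓘(ℝ, E) G)) b :=
    fun X => mdifferentiableAt_leftField X b
  have e1 : mlieBracket 𝓘(ℝ, E) V (varField C) b =
      ∑ i, (B.repr D i • varField (fun _ : G => B i) b +
        f i b • mlieBracket 𝓘(ℝ, E) V (varField fun _ : G => B i) b) := by
    rw [varField_eq_sum, (mlieBracket_sum_right _ V _ b fun i =>
      (hf i).mdifferentiableAt.smul_section (hE _)).1]
    refine Finset.sum_congr rfl fun i _ => ?_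
    refine (mlieBracket_smul_right (hf i).mdifferentiableAt (hE _)).trans ?_
    have : mvfderiv 𝓘(ℝ, E) (f i) b (V b) = B.repr D i :=
      congrArg (fun L : E →L[ℝ] ℝ => L (V b)) (hf i).mfderiv
    rw [← this]
  have e2 : mlieBracket 𝓘(ℝ, E) V (varField fun _ : G => C b) b =
      ∑ i, f i b • mlieBracket 𝓘(ℝ, E) V (varField fun _ : G => B i) b := by
    rw [varField_eq_sum, (mlieBracket_sum_right _ V _ b fun i =>
      mdifferentiableAt_const.smul_section (hE _)).1]
    exact Finset.sum_congr rfl fun i _ => mlieBracket_const_smul_right (hE _)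
  have e3 : leftField (D : GroupLieAlgebra 𝓘(ℝ, E) G) b =
      ∑ i, B.repr D i • varField (fun _ : G => B i) b := by
    have := congrFun (varField_eq_sum (G := G) fun _ => D) b
    rw [Finset.sum_apply] at this
    exact this
  rw [e1, Finset.sum_add_distrib]
  exact congrArg₂ (fun u v : E => u + v) e3.symm e2.symm

/-- The derivative of `b ↦ Ad(b⁻¹) Y` along left-invariant fields. It is read off from
`[X^L, Y^R] = 0` by the Leibniz rule, as `Y^R` is `varField` of `b ↦ Ad(b⁻¹) Y`. -/
theorem mfderiv_Ad_inv_leftField (X Y : GroupLieAlgebra 𝓘(ℝ, E) G) (b : G) :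
    ((mfderiv 𝓘(ℝ, E) 𝓘(ℝ, E) (M' := E) (fun x : G => Ad x⁻¹ Y) b : E →L[ℝ] E) (leftField X b)
      : GroupLieAlgebra 𝓘(ℝ, E) G) = -⁅X, Ad b⁻¹ Y⁆ := by
  have e := mlieBracket_varField (E := E) (C := fun x : G => (Ad x⁻¹ Y : E))
    (mdifferentiableAt_Ad_inv Y b) (leftField X)
  have h : varField (E := E) (fun x : G => Ad x⁻¹ Y) = rightField Y :=
    funext fun x => (rightField_eq Y x).symm
  have e0 : mlieBracket 𝓘(ℝ, E) (leftField X) (rightField Y) b = 0 := by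
    rw [mlieBracket_swap_apply, mlieBracket_rightField_leftField, neg_zero]
  rw [h, e0] at e
  have e1 : mlieBracket 𝓘(ℝ, E) (leftField X) (leftField (Ad b⁻¹ Y)) b =
      leftField ⁅X, Ad b⁻¹ Y⁆ b :=
    (congrFun (mulInvariantVector_mlieBracket X (Ad b⁻¹ Y)) b).symm
  apply leftField_injective b
  have e2 : leftField (-⁅X, Ad b⁻¹ Y⁆) b = -leftField ⁅X, Ad b⁻¹ Y⁆ b :=
    map_neg (mfderiv 𝓘(ℝ, E) 𝓘(ℝ, E) (fun y : G => b * y) 1) _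
  refine Eq.trans ?_ e2.symm
  rw [← e1]
  exact eq_neg_of_add_eq_zero_left e.symm

/-- The derivative of `b ↦ Ad(b⁻¹) Y` along right-invariant fields. -/
theorem mfderiv_Ad_inv_rightField (X Y : GroupLieAlgebra 𝓘(ℝ, E) G) (b : G) :
    ((mfderiv 𝓘(ℝ, E) 𝓘(ℝ, E) (M' := E) (fun x : G => Ad x⁻¹ Y) b : E →L[ℝ] E) (rightField X b)
      : GroupLieAlgebra 𝓘(ℝ, E) G) = -⁅Ad b⁻¹ X, Ad b⁻¹ Y⁆ := by
  rw [rightField_eq]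
  exact mfderiv_Ad_inv_leftField _ Y b

/-- The bracket of a right-invariant field with the left translates of `A (Ad(b⁻¹) Y)`. -/
theorem mlieBracket_rightField_varField (A : E →L[ℝ] E) (X Y : GroupLieAlgebra 𝓘(ℝ, E) G) (b : G) :
    mlieBracket 𝓘(ℝ, E) (rightField X) (varField fun x : G => A (Ad x⁻¹ Y)) b =
      leftField (A (-⁅Ad b⁻¹ X, Ad b⁻¹ Y⁆ : GroupLieAlgebra 𝓘(ℝ, E) G) :
        GroupLieAlgebra 𝓘(ℝ, E) G) b := by
  have hA : HasMFDerivAt 𝓘(ℝ, E) 𝓘(ℝ, E) (fun x : G => A (Ad x⁻¹ Y)) b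
      (A.comp (mfderiv 𝓘(ℝ, E) 𝓘(ℝ, E) (M' := E) (fun x : G => Ad x⁻¹ Y) b : E →L[ℝ] E)) :=
    HasMFDerivAt.comp (M' := E) (f := fun x : G => Ad x⁻¹ Y) b A.hasMFDerivAt
      (mdifferentiableAt_Ad_inv Y b).hasMFDerivAt
  have e := mlieBracket_varField hA.mdifferentiableAt (rightField X)
  have e0 := mlieBracket_rightField_leftField (A (Ad b⁻¹ Y) : GroupLieAlgebra 𝓘(ℝ, E) G) X b
  refine (e.trans (congrArg (HAdd.hAdd _) e0)).trans ((add_zero _).trans ?_)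
  rw [← mfderiv_Ad_inv_rightField]
  exact congrArg (fun Z : E => leftField (Z : GroupLieAlgebra 𝓘(ℝ, E) G) b)
    (congrArg (fun L : E →L[ℝ] E => L (rightField X b)) hA.mfderiv)

theorem mdifferentiableAt_varField {C : G → E} {b : G}
    (hC : MDifferentiableAt 𝓘(ℝ, E) 𝓘(ℝ, E) C b) :
    MDifferentiableAt 𝓘(ℝ, E) 𝓘(ℝ, E).tangent
      (fun x : G => (varField C x : TangentBundle 𝓘(ℝ, E) G)) b := by
  let B := Module.finBasis ℝ E
  have hf : ∀ i, MDifferentiableAt 𝓘(ℝ, E) 𝓘(ℝ, ℝ) (fun x => B.repr (C x) i) b := fun i =>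
    (((B.coord i).toContinuousLinearMap.hasMFDerivAt (x := C b)).comp b
      hC.hasMFDerivAt).mdifferentiableAt
  rw [varField_eq_sum]
  exact (mlieBracket_sum_right Finset.univ (0 : (x : G) → TangentSpace 𝓘(ℝ, E) x) _ b fun i =>
      (hf i).smul_section (mdifferentiableAt_leftField (Module.finBasis ℝ E i) b)).2

end Fields

/-! ### Local sections of submersions -/

section LocalSection

variable {E : Type*} [NormedAddCommGroup E] [NormedSpace ℝ E]
  {N : Type*} [TopologicalSpace N] [ChartedSpace E N] [IsManifold 𝓘(ℝ, E) ∞ N]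
  {F : Type*} [NormedAddCommGroup F] [NormedSpace ℝ F] [FiniteDimensional ℝ F]
  {M : Type*} [TopologicalSpace M] [ChartedSpace F M] [IsManifold 𝓘(ℝ, F) ∞ M]

/-- A smooth map with surjective differential at `b` has a smooth local section through `b`. -/
theorem exists_local_section {q : N → M} {b : N} (hq : ContMDiffAt 𝓘(ℝ, E) 𝓘(ℝ, F) ∞ q b)
    (hc : Continuous q)
    (hs : Function.Surjective (mfderiv 𝓘(ℝ, E) 𝓘(ℝ, F) q b)) :
    ∃ s : M → N, ContMDiffAt 𝓘(ℝ, F) 𝓘(ℝ, E) ∞ s (q b) ∧ s (q b) = b ∧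
      ∀ᶠ y in 𝓝 (q b), q (s y) = y := by
  let φ := extChartAt 𝓘(ℝ, E) b
  let ψ := extChartAt 𝓘(ℝ, F) (q b)
  let a : E := φ b
  have hφs : φ.symm a = b := extChartAt_to_inv b
  let p : E → F := writtenInExtChartAt 𝓘(ℝ, E) 𝓘(ℝ, F) b q
  have hpc : ContDiffAt ℝ ∞ p a := by
    have := (contMDiffAt_iff (I := 𝓘(ℝ, E)) (I' := 𝓘(ℝ, F)) (x := b)).1 hq
    simpa [contDiffWithinAt_univ] using! this.2
  have hpa : p a = ψ (q b) := by
    change ψ (q (φ.symm a)) = _; rw [hφs]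
  have hqd : MDifferentiableAt 𝓘(ℝ, E) 𝓘(ℝ, F) q b := hq.mdifferentiableAt (by simp)
  have hfd : (mfderiv 𝓘(ℝ, E) 𝓘(ℝ, F) q b : E →L[ℝ] F) = fderiv ℝ p a := by
    refine hqd.mfderiv.trans ?_
    simp [fderivWithin_univ]
    rfl
  have hsurj : (fderiv ℝ p a).range = ⊤ := by
    rw [← hfd]
    exact LinearMap.range_eq_top.2 hs
  -- with `R` a right inverse of `Dp`, the map `z ↦ p (a + R z)` is a local diffeomorphism
  obtain ⟨R, hR⟩ := (fderiv ℝ p a).exists_rightInverse_of_surjective hsurj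
  let r : F → F := fun z => p (a + R z)
  have hr0 : a + R 0 = a := by simp
  have hrc : ContDiffAt ℝ ∞ r 0 := by
    have h1 : ContDiffAt ℝ ∞ (fun z : F => a + R z) 0 := by fun_prop
    have h2 : ContDiffAt ℝ ∞ p (a + R 0) := by rw [hr0]; exact hpc
    exact ContDiffAt.comp (g := p) (f := fun z : F => a + R z) (0 : F) h2 h1
  have hrd : HasFDerivAt r ((ContinuousLinearEquiv.refl ℝ F : F ≃L[ℝ] F) : F →L[ℝ] F) 0 := by
    have h1 : HasFDerivAt (fun z : F => a + R z) R 0 := R.hasFDerivAt.const_add a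
    have h2 : HasFDerivAt p (fderiv ℝ p a) (a + R 0) := by
      rw [hr0]; exact (hpc.differentiableAt (by simp)).hasFDerivAt
    have h3 := h2.comp (0 : F) h1
    rw [hR] at h3
    exact h3
  have hr0' : r 0 = ψ (q b) := by
    change p (a + R 0) = _; rw [hr0, hpa]
  let l : F → F := hrc.localInverse hrd (by simp)
  have hlc : ContDiffAt ℝ ∞ l (ψ (q b)) := by
    rw [← hr0']; exact hrc.to_localInverse hrd (by simp)
  have hl0 : l (ψ (q b)) = 0 := by
    rw [← hr0']; exact hrc.localInverse_apply_image hrd (by simp)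
  have hlr : ∀ᶠ z in 𝓝 (ψ (q b)), r (l z) = z := by
    rw [← hr0']
    exact (hrc.hasStrictFDerivAt' hrd (by simp)).eventually_right_inverse
  let s : M → N := fun y => φ.symm (a + R (l (ψ y)))
  have hs0 : a + R (l (ψ (q b))) = a := by rw [hl0, hr0]
  have hsb : s (q b) = b := by
    change φ.symm (a + R (l (ψ (q b)))) = b
    rw [hs0, hφs]
  have hin : ContMDiffAt 𝓘(ℝ, F) 𝓘(ℝ, E) ∞ (fun y : M => a + R (l (ψ y))) (q b) := by
    have h1 : ContMDiffAt 𝓘(ℝ, F) 𝓘(ℝ, F) ∞ ψ (q b) := contMDiffAt_extChartAt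
    have h2 : ContDiffAt ℝ ∞ (fun z : F => a + R (l z)) (ψ (q b)) :=
      contDiffAt_const.add (R.contDiff.contDiffAt.comp _ hlc)
    exact h2.contMDiffAt.comp (q b) h1
  have hsm : ContMDiffAt 𝓘(ℝ, F) 𝓘(ℝ, E) ∞ s (q b) := by
    have h1 : ContMDiffAt 𝓘(ℝ, E) 𝓘(ℝ, E) ∞ φ.symm (a + R (l (ψ (q b)))) := by
      rw [hs0]
      exact (contMDiffOn_extChartAt_symm b).contMDiffAt (extChartAt_target_mem_nhds b)
    exact h1.comp (q b) hin
  refine ⟨s, hsm, hsb, ?_⟩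
  have h1 : ∀ᶠ y in 𝓝 (q b), r (l (ψ y)) = ψ y := (continuousAt_extChartAt (q b)).eventually hlr
  have h2 : ∀ᶠ y in 𝓝 (q b), y ∈ ψ.source := extChartAt_source_mem_nhds (q b)
  have h3 : ∀ᶠ y in 𝓝 (q b), q (s y) ∈ ψ.source := by
    refine (hc.continuousAt.comp hsm.continuousAt).eventually_mem ?_
    change ψ.source ∈ 𝓝 (q (s (q b)))
    rw [hsb]; exact extChartAt_source_mem_nhds (q b)
  filter_upwards [h1, h2, h3] with y k1 k2 k3
  exact ψ.injOn k3 k2 k1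

end LocalSection

/-! ### The action of `G` on `G ⧸ H` and its fundamental vector fields -/

section Action

variable {E : Type*} [NormedAddCommGroup E] [NormedSpace ℝ E]
  {F : Type*} [NormedAddCommGroup F] [NormedSpace ℝ F] [FiniteDimensional ℝ F]
  {G : Type*} [TopologicalSpace G] [ChartedSpace E G] [Group G] [LieGroup 𝓘(ℝ, E) ∞ G]
  {H : Subgroup G} [ChartedSpace F (G ⧸ H)] [IsManifold 𝓘(ℝ, F) ∞ (G ⧸ H)]

/-- The action map `G × G ⧸ H → G ⧸ H` is smooth: locally it is `(a, y) ↦ π (a * s y)` with `s` a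
local section of the projection. -/
theorem contMDiff_smul_quotient (hM : IsHomogeneousManifold E F H) :
    ContMDiff (𝓘(ℝ, E).prod 𝓘(ℝ, F)) 𝓘(ℝ, F) ∞ (fun p : G × (G ⧸ H) => p.1 • p.2) := by
  rintro ⟨a, y⟩
  obtain ⟨b, rfl⟩ := QuotientGroup.mk_surjective y
  obtain ⟨s, hs, hsb, hsq⟩ := exists_local_section (hM.contMDiff_mk b)
    hM.contMDiff_mk.continuous (hM.surjective_mfderiv b)
  have h1 : ContMDiffAt (𝓘(ℝ, E).prod 𝓘(ℝ, F)) 𝓘(ℝ, F) ∞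
      (fun p : G × (G ⧸ H) => (QuotientGroup.mk (p.1 * s p.2) : G ⧸ H)) (a, QuotientGroup.mk b) :=
    (hM.contMDiff_mk _).comp (a, (QuotientGroup.mk b : G ⧸ H))
      (contMDiffAt_fst.mul (ContMDiffAt.comp (a, (QuotientGroup.mk b : G ⧸ H)) hs contMDiffAt_snd))
  refine h1.congr_of_eventuallyEq ?_
  have h2 : ∀ᶠ p : G × (G ⧸ H) in 𝓝 (a, QuotientGroup.mk b),
      (QuotientGroup.mk (s p.2) : G ⧸ H) = p.2 :=
    (continuous_snd.tendsto (a, (QuotientGroup.mk b : G ⧸ H))).eventually hsq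
  filter_upwards [h2] with p hp
  change p.1 • p.2 = p.1 • (QuotientGroup.mk (s p.2) : G ⧸ H)
  rw [hp]

/-- The fundamental vector field of `X ∈ 𝔤` on `G ⧸ H`: the velocity of the action of `G`. -/
def fundField (H : Subgroup G) [ChartedSpace F (G ⧸ H)] (X : GroupLieAlgebra 𝓘(ℝ, E) G) :
    VField F (G ⧸ H) := fun y =>
  (mfderiv 𝓘(ℝ, E) 𝓘(ℝ, F) (fun a : G => a • y) 1 : E →L[ℝ] F) X

theorem smooth_fundField (hM : IsHomogeneousManifold E F H) (X : GroupLieAlgebra 𝓘(ℝ, E) G) :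
    SmoothVField (fundField (F := F) H X) := by
  refine (contMDiff_partial_left (contMDiff_smul_quotient hM) 1 X).congr fun y => ?_
  -- the base point of the partial derivative is `1 • y`
  have h : ∀ (z : G ⧸ H), z = y → (⟨y, fundField H X y⟩ : TangentBundle 𝓘(ℝ, F) (G ⧸ H)) =
    ⟨z, fundField (F := F) H X y⟩ := by rintro _ rfl; rfl
  exact h _ (one_smul G y)

theorem mdifferentiableAt_mk (hM : IsHomogeneousManifold E F H) (b : G) :
    MDifferentiableAt 𝓘(ℝ, E) 𝓘(ℝ, F) (QuotientGroup.mk : G → G ⧸ H) b :=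
  (hM.contMDiff_mk b).mdifferentiableAt (by simp)

/-- The tangent vector of `G ⧸ H` at `bH` obtained by translating `X` by `b` and projecting. -/
def push (F : Type*) [NormedAddCommGroup F] [NormedSpace ℝ F] (H : Subgroup G)
    [ChartedSpace F (G ⧸ H)] (b : G) :
    GroupLieAlgebra 𝓘(ℝ, E) G →L[ℝ] TangentSpace 𝓘(ℝ, F) (QuotientGroup.mk b : G ⧸ H) :=
  (mfderiv 𝓘(ℝ, E) 𝓘(ℝ, F) (QuotientGroup.mk : G → G ⧸ H) b : E →L[ℝ] F).comp
    (mfderiv 𝓘(ℝ, E) 𝓘(ℝ, E) (fun y : G => b * y) 1 : E →L[ℝ] E)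

/-- The projection relates right-invariant fields to fundamental fields. -/
theorem mfderiv_mk_rightField (hM : IsHomogeneousManifold E F H)
    (X : GroupLieAlgebra 𝓘(ℝ, E) G) (b : G) :
    mfderiv 𝓘(ℝ, E) 𝓘(ℝ, F) (QuotientGroup.mk : G → G ⧸ H) b (rightField X b) =
      fundField H X (QuotientGroup.mk b) := by
  have e := mfderiv_comp_apply_of_eq (I := 𝓘(ℝ, E)) (I' := 𝓘(ℝ, E)) (I'' := 𝓘(ℝ, F)) (1 : G)
    (mdifferentiableAt_mk hM b) (mdifferentiableAt_mul_right b 1) (one_mul b) X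
  exact e.symm

theorem fundField_mk (hM : IsHomogeneousManifold E F H) (X : GroupLieAlgebra 𝓘(ℝ, E) G) (b : G) :
    fundField H X (QuotientGroup.mk b) = push F H b (Ad b⁻¹ X) := by
  rw [← mfderiv_mk_rightField hM, rightField_eq]; rfl

theorem push_surjective (hM : IsHomogeneousManifold E F H) (b : G) :
    Function.Surjective (push (E := E) F H b) := by
  intro v
  obtain ⟨X, hX⟩ := hM.surjective_mfderiv b v
  let Y : GroupLieAlgebra 𝓘(ℝ, E) G :=
    (mfderiv 𝓘(ℝ, E) 𝓘(ℝ, E) (fun y : G => b⁻¹ * y) b : E →L[ℝ] E) X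
  refine ⟨Y, ?_⟩
  have e := mfderiv_comp_apply_of_eq (I := 𝓘(ℝ, E)) (I' := 𝓘(ℝ, E)) (I'' := 𝓘(ℝ, E)) b
    (mdifferentiableAt_mul_left b 1) (mdifferentiableAt_mul_left b⁻¹ b) (inv_mul_cancel b) X
  have h : (fun y : G => b * y) ∘ (fun y : G => b⁻¹ * y) = id := by ext; simp
  rw [h] at e
  have e' : (mfderiv 𝓘(ℝ, E) 𝓘(ℝ, E) (id : G → G) b : E →L[ℝ] E) X = X :=
    congrArg (fun L : E →L[ℝ] E => L X) mfderiv_id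
  exact (congrArg (mfderiv 𝓘(ℝ, E) 𝓘(ℝ, F) (QuotientGroup.mk : G → G ⧸ H) b : E →L[ℝ] F)
    (e.symm.trans e')).trans hX

theorem mdifferentiable_smul (hM : IsHomogeneousManifold E F H) (a : G) (y : G ⧸ H) :
    MDifferentiableAt 𝓘(ℝ, F) 𝓘(ℝ, F) (fun z : G ⧸ H => a • z) y := by
  have h : ContMDiff 𝓘(ℝ, F) (𝓘(ℝ, E).prod 𝓘(ℝ, F)) ∞ (fun z : G ⧸ H => (a, z)) :=
    contMDiff_const.prodMk contMDiff_id
  exact (((contMDiff_smul_quotient hM).comp h) y).mdifferentiableAt (by simp)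

/-- `dτ(a) ∘ dπ = dπ ∘ dL_a`. -/
theorem dtau_mfderiv_mk (hM : IsHomogeneousManifold E F H) (a b : G) (v : E) :
    (dtau a (QuotientGroup.mk b : G ⧸ H)
      ((mfderiv 𝓘(ℝ, E) 𝓘(ℝ, F) (QuotientGroup.mk : G → G ⧸ H) b : E →L[ℝ] F) v) : F) =
    (mfderiv 𝓘(ℝ, E) 𝓘(ℝ, F) (QuotientGroup.mk : G → G ⧸ H) (a * b) : E →L[ℝ] F)
      ((mfderiv 𝓘(ℝ, E) 𝓘(ℝ, E) (fun y : G => a * y) b : E →L[ℝ] E) v) := by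
  have e1 := mfderiv_comp_apply (I := 𝓘(ℝ, E)) (I' := 𝓘(ℝ, F)) (I'' := 𝓘(ℝ, F)) b
    (mdifferentiable_smul hM a (QuotientGroup.mk b)) (mdifferentiableAt_mk hM b) v
  have e2 := mfderiv_comp_apply (I := 𝓘(ℝ, E)) (I' := 𝓘(ℝ, E)) (I'' := 𝓘(ℝ, F)) b
    (mdifferentiableAt_mk hM (a * b)) (mdifferentiableAt_mul_left a b) v
  exact e1.symm.trans e2

theorem dproj_eq (X : GroupLieAlgebra 𝓘(ℝ, E) G) : dproj E F H X = push F H 1 X := by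
  refine congrArg (mfderiv 𝓘(ℝ, E) 𝓘(ℝ, F) (QuotientGroup.mk : G → G ⧸ H) 1 : E →L[ℝ] F) ?_
  exact (mfderiv_mul_left_one (E := E) (G := G) rfl rfl X).symm

theorem dtau_push (hM : IsHomogeneousManifold E F H) (a b : G) (X : GroupLieAlgebra 𝓘(ℝ, E) G) :
    (dtau a (QuotientGroup.mk b : G ⧸ H) (push F H b X) : F) = push F H (a * b) X := by
  refine (dtau_mfderiv_mk hM a b _).trans ?_
  exact congrArg (mfderiv 𝓘(ℝ, E) 𝓘(ℝ, F) (QuotientGroup.mk : G → G ⧸ H) (a * b) : E →L[ℝ] F)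
    (mfderiv_mul_left_leftField a b X)

theorem push_congr {b c : G} (h : b = c) (X : GroupLieAlgebra 𝓘(ℝ, E) G) :
    (push F H b X : F) = push F H c X := by
  subst h; rfl

/-- An invariant metric is given at `bH` by its value at `o`. -/
theorem inner_push (hM : IsHomogeneousManifold E F H) {g : Metric F (G ⧸ H)}
    (hg : IsInvariantMetric g) (b : G) (X Y : GroupLieAlgebra 𝓘(ℝ, E) G) :
    g.inner (QuotientGroup.mk b) (push F H b X) (push F H b Y) =
      g.inner (QuotientGroup.mk 1 : G ⧸ H) (dproj E F H X) (dproj E F H Y) := by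
  have h : ∀ (y z : G ⧸ H), y = z → ∀ u v u' v' : F, u = u' → v = v' →
      (g.inner y : F →L[ℝ] F →L[ℝ] ℝ) u v = (g.inner z : F →L[ℝ] F →L[ℝ] ℝ) u' v' := by
    rintro _ _ rfl _ _ _ _ rfl rfl; rfl
  have e := hg b (QuotientGroup.mk 1) (push F H 1 X) (push F H 1 Y)
  rw [dproj_eq, dproj_eq, ← e]
  have k : ∀ Z : GroupLieAlgebra 𝓘(ℝ, E) G, (push F H b Z : F) =
      dtau b (QuotientGroup.mk 1 : G ⧸ H) (push F H 1 Z) := fun Z =>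
    (push_congr (mul_one b).symm Z).trans (dtau_push hM b 1 Z).symm
  exact h _ _ (congrArg QuotientGroup.mk (mul_one b).symm) _ _ _ _ (k X) (k Y)

/-- An invariant field of endomorphisms is given at `bH` by its value at `o`. -/
theorem endo_push (hM : IsHomogeneousManifold E F H) {f : EndoField F (G ⧸ H)}
    (hf : IsInvariantEndo f) (b : G) {X Y : GroupLieAlgebra 𝓘(ℝ, E) G}
    (hXY : f (QuotientGroup.mk 1) (dproj E F H X) = dproj E F H Y) :
    f (QuotientGroup.mk b) (push F H b X) = push F H b Y := by
  have h : ∀ (y z : G ⧸ H), y = z → ∀ u u' : F, u = u' →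
      (f y : F →L[ℝ] F) u = (f z : F →L[ℝ] F) u' := by
    rintro _ _ rfl _ _ rfl; rfl
  have e := hf b (QuotientGroup.mk 1) (push F H 1 X)
  rw [dproj_eq, dproj_eq] at hXY
  rw [hXY] at e
  have k : ∀ Z : GroupLieAlgebra 𝓘(ℝ, E) G, (push F H b Z : F) =
      dtau b (QuotientGroup.mk 1 : G ⧸ H) (push F H 1 Z) := fun Z =>
    (push_congr (mul_one b).symm Z).trans (dtau_push hM b 1 Z).symm
  refine (h _ _ (congrArg QuotientGroup.mk (mul_one b).symm) _ _ (k X)).trans ?_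
  exact e.symm.trans (k Y).symm

/-- `dτ(h) dπ X = dπ Ad(h) X` for `h ∈ H`. -/
theorem dtau_dproj (hM : IsHomogeneousManifold E F H) {h : G} (hh : h ∈ H)
    (X : GroupLieAlgebra 𝓘(ℝ, E) G) :
    (dtau h (QuotientGroup.mk 1 : G ⧸ H) (dproj E F H X) : F) = dproj E F H (Ad h X) := by
  have e1 := mfderiv_comp_apply (I := 𝓘(ℝ, E)) (I' := 𝓘(ℝ, F)) (I'' := 𝓘(ℝ, F)) (1 : G)
    (mdifferentiable_smul hM h (QuotientGroup.mk 1)) (mdifferentiableAt_mk hM 1) X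
  have hd : MDifferentiableAt 𝓘(ℝ, E) 𝓘(ℝ, E) (fun x : G => h * x * h⁻¹) 1 :=
    (mdifferentiableAt_mul_right h⁻¹ (h * 1)).comp (1 : G) (mdifferentiableAt_mul_left h 1)
  have e2 := mfderiv_comp_apply_of_eq (I := 𝓘(ℝ, E)) (I' := 𝓘(ℝ, E)) (I'' := 𝓘(ℝ, F)) (1 : G)
    (mdifferentiableAt_mk hM 1) hd (by simp) X
  have e3 : (QuotientGroup.mk : G → G ⧸ H) ∘ (fun x : G => h * x * h⁻¹) =
      (fun y : G ⧸ H => h • y) ∘ (QuotientGroup.mk : G → G ⧸ H) := by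
    ext x
    exact QuotientGroup.mk_mul_of_mem (h * x) (H.inv_mem hh)
  rw [e3] at e2
  exact e1.symm.trans e2

end Action

/-! ### Derivatives and brackets along fundamental fields -/

section Koszul

variable {E : Type*} [NormedAddCommGroup E] [NormedSpace ℝ E] [FiniteDimensional ℝ E]
  {F : Type*} [NormedAddCommGroup F] [NormedSpace ℝ F] [FiniteDimensional ℝ F]
  {G : Type*} [TopologicalSpace G] [ChartedSpace E G] [Group G] [LieGroup 𝓘(ℝ, E) ∞ G]
  {H : Subgroup G} [ChartedSpace F (G ⧸ H)] [IsManifold 𝓘(ℝ, F) ∞ (G ⧸ H)]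

omit [FiniteDimensional ℝ E] in
theorem mdifferentiableAt_fundField (hM : IsHomogeneousManifold E F H)
    (X : GroupLieAlgebra 𝓘(ℝ, E) G) (p : G ⧸ H) :
    MDifferentiableAt 𝓘(ℝ, F) 𝓘(ℝ, F).tangent
      (fun y => (fundField (F := F) H X y : TangentBundle 𝓘(ℝ, F) (G ⧸ H))) p :=
  (smooth_fundField hM X p).mdifferentiableAt (by simp)

omit [FiniteDimensional ℝ E] in
theorem exists_Ad_inv_eq (b : G) (u : GroupLieAlgebra 𝓘(ℝ, E) G) : ∃ X, Ad b⁻¹ X = u := by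
  refine ⟨Ad b u, ?_⟩
  have hd : ∀ c x : G, MDifferentiableAt 𝓘(ℝ, E) 𝓘(ℝ, E) (fun x : G => c * x * c⁻¹) x := fun c x =>
    (mdifferentiableAt_mul_right c⁻¹ (c * x)).comp x (mdifferentiableAt_mul_left c x)
  have e := mfderiv_comp_apply_of_eq (I := 𝓘(ℝ, E)) (I' := 𝓘(ℝ, E)) (I'' := 𝓘(ℝ, E)) (1 : G)
    (hd b⁻¹ 1) (hd b 1) (by simp) u
  have h : (fun x : G => b⁻¹ * x * b⁻¹⁻¹) ∘ (fun x : G => b * x * b⁻¹) = id := by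
    ext; simp [mul_assoc]
  rw [h] at e
  exact e.symm.trans (congrArg (fun L : E →L[ℝ] E => L u) mfderiv_id)

/-- The bracket of a fundamental field with a field that lifts to `x ↦ (A (Ad(x⁻¹) Y))^L_x`. For
`A = 1` the latter is again a fundamental field; for `A` a lift of `f_o` it is `f` applied to one. -/
theorem mlieBracket_fundField (hM : IsHomogeneousManifold E F H) (A : E →L[ℝ] E)
    (X Y : GroupLieAlgebra 𝓘(ℝ, E) G) (b : G) {W : VField F (G ⧸ H)}
    (hW : MDifferentiableAt 𝓘(ℝ, F) 𝓘(ℝ, F).tangent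
      (fun y => (W y : TangentBundle 𝓘(ℝ, F) (G ⧸ H))) (QuotientGroup.mk b))
    (hWA : ∀ x : G, W (QuotientGroup.mk x) =
      push F H x (A (Ad x⁻¹ Y) : GroupLieAlgebra 𝓘(ℝ, E) G)) :
    mlieBracket 𝓘(ℝ, F) (fundField H X) W (QuotientGroup.mk b) =
      push F H b (A (-⁅Ad b⁻¹ X, Ad b⁻¹ Y⁆ : GroupLieAlgebra 𝓘(ℝ, E) G) :
        GroupLieAlgebra 𝓘(ℝ, E) G) := by
  have hA : MDifferentiableAt 𝓘(ℝ, E) 𝓘(ℝ, E) (fun x : G => A (Ad x⁻¹ Y)) b :=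
    (HasMFDerivAt.comp (M' := E) (f := fun x : G => Ad x⁻¹ Y) b A.hasMFDerivAt
      (mdifferentiableAt_Ad_inv Y b).hasMFDerivAt).mdifferentiableAt
  have e := mfderiv_mlieBracket_of_related (x₀ := b) (hM.contMDiff_mk.of_le ENat.LEInfty.out)
    (mdifferentiableAt_rightField X b) (mdifferentiableAt_varField hA)
    (mdifferentiableAt_fundField hM X _) hW (mfderiv_mk_rightField hM X) (fun x => (hWA x).symm)
  rw [← e, mlieBracket_rightField_varField]
  rfl

/-- The scalar product `B(u, v) = g_o(dπ u, dπ v)` on `𝔤`, degenerate along `𝔥`. -/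
def pullInner (g : Metric F (G ⧸ H)) (u v : GroupLieAlgebra 𝓘(ℝ, E) G) : ℝ :=
  g.inner (QuotientGroup.mk 1 : G ⧸ H) (dproj E F H u) (dproj E F H v)

theorem exists_pullInner_eq (g : Metric F (G ⧸ H)) : ∃ B : E →L[ℝ] E →L[ℝ] ℝ,
    ∀ u v : GroupLieAlgebra 𝓘(ℝ, E) G, pullInner g u v = B u v :=
  ⟨ContinuousLinearMap.bilinearComp (E := F) (F := F) (G := ℝ)
    (g.inner (QuotientGroup.mk 1 : G ⧸ H) : F →L[ℝ] F →L[ℝ] ℝ)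
    (dproj E F H : E →L[ℝ] F) (dproj E F H : E →L[ℝ] F), fun _ _ => rfl⟩

theorem inner_fundField (hM : IsHomogeneousManifold E F H) {g : Metric F (G ⧸ H)}
    (hg : IsInvariantMetric g) (X Y : GroupLieAlgebra 𝓘(ℝ, E) G) (b : G) :
    g.inner (QuotientGroup.mk b) (fundField H X (QuotientGroup.mk b))
      (fundField H Y (QuotientGroup.mk b)) = pullInner g (Ad b⁻¹ X) (Ad b⁻¹ Y) := by
  rw [fundField_mk hM, fundField_mk hM, inner_push hM hg]
  rfl

theorem pullInner_neg_left (g : Metric F (G ⧸ H)) (u v : GroupLieAlgebra 𝓘(ℝ, E) G) :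
    pullInner g (-u) v = -pullInner g u v := by
  obtain ⟨B, hB⟩ := exists_pullInner_eq (E := E) g
  rw [hB, hB]
  exact (congrArg (fun L : E →L[ℝ] ℝ => L v) (map_neg B u)).trans rfl

theorem pullInner_comm (g : Metric F (G ⧸ H)) (u v : GroupLieAlgebra 𝓘(ℝ, E) G) :
    pullInner g u v = pullInner g v u := g.symm _ _ _

theorem pullInner_neg_right (g : Metric F (G ⧸ H)) (u v : GroupLieAlgebra 𝓘(ℝ, E) G) :
    pullInner g u (-v) = -pullInner g u v := by
  rw [pullInner_comm, pullInner_neg_left, pullInner_comm]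

/-- The derivative `X*⟨Y*, Z*⟩` at `bH` for fundamental fields. -/
theorem mvfderiv_inner_fundField (hM : IsHomogeneousManifold E F H) {g : Metric F (G ⧸ H)}
    (hg : IsInvariantMetric g) (X Y Z : GroupLieAlgebra 𝓘(ℝ, E) G) (b : G) :
    mvfderiv 𝓘(ℝ, F) (fun y : G ⧸ H => g.inner y (fundField H Y y) (fundField H Z y))
      (QuotientGroup.mk b) (fundField H X (QuotientGroup.mk b)) =
      -pullInner g ⁅Ad b⁻¹ X, Ad b⁻¹ Y⁆ (Ad b⁻¹ Z) -
        pullInner g (Ad b⁻¹ Y) ⁅Ad b⁻¹ X, Ad b⁻¹ Z⁆ := by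
  obtain ⟨B, hB⟩ := exists_pullInner_eq (E := E) g
  let h : G ⧸ H → ℝ := fun y => g.inner y (fundField H Y y) (fundField H Z y)
  have hd : MDifferentiableAt 𝓘(ℝ, F) 𝓘(ℝ, ℝ) h (QuotientGroup.mk b) := by
    have h1 := MDifferentiableAt.clm_bundle_apply₂ (F₃ := ℝ) (E₃ := fun _ : G ⧸ H => ℝ)
      ((g.contMDiff (QuotientGroup.mk b)).mdifferentiableAt (by simp))
      (mdifferentiableAt_fundField (F := F) hM Y (QuotientGroup.mk b))
      (mdifferentiableAt_fundField (F := F) hM Z (QuotientGroup.mk b))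
    exact ((mdifferentiableAt_section 𝓘(ℝ, F) _).1 h1)
  have e1 := mvfderiv_comp_apply (I := 𝓘(ℝ, F)) (I' := 𝓘(ℝ, E)) b hd (mdifferentiableAt_mk hM b)
    (rightField X b)
  -- pulled back to `G`, the function is `B (Ad(x⁻¹) Y, Ad(x⁻¹) Z)`
  have hc : h ∘ (QuotientGroup.mk : G → G ⧸ H) =
      fun x => B (Ad x⁻¹ Y) (Ad x⁻¹ Z) :=
    funext fun x => (inner_fundField hM hg Y Z x).trans (hB _ _)
  rw [mfderiv_mk_rightField hM, hc] at e1
  refine e1.symm.trans ?_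
  have hY := (mdifferentiableAt_Ad_inv Y b).hasMFDerivAt
  have hZ := (mdifferentiableAt_Ad_inv Z b).hasMFDerivAt
  have hp : HasMFDerivAt 𝓘(ℝ, E) 𝓘(ℝ, E × E) (M' := E × E)
      (fun x : G => ((Ad x⁻¹ Y, Ad x⁻¹ Z) : E × E)) b
      (ContinuousLinearMap.prod
        (mfderiv 𝓘(ℝ, E) 𝓘(ℝ, E) (M' := E) (fun x : G => Ad x⁻¹ Y) b : E →L[ℝ] E)
        (mfderiv 𝓘(ℝ, E) 𝓘(ℝ, E) (M' := E) (fun x : G => Ad x⁻¹ Z) b : E →L[ℝ] E)) :=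
    ⟨hY.1.prodMk hZ.1, hY.2.prodMk hZ.2⟩
  have hBd : HasMFDerivAt 𝓘(ℝ, E × E) 𝓘(ℝ, ℝ) (fun p : E × E => B p.1 p.2)
      ((Ad b⁻¹ Y, Ad b⁻¹ Z) : E × E) _ :=
    (B.isBoundedBilinearMap.hasFDerivAt ((Ad b⁻¹ Y, Ad b⁻¹ Z) : E × E)).hasMFDerivAt
  have e2 := HasMFDerivAt.comp (M' := E × E) (f := fun x : G => ((Ad x⁻¹ Y, Ad x⁻¹ Z) : E × E)) b hBd hp
  have e3 := congrArg (fun L : E →L[ℝ] ℝ => L (rightField X b)) e2.mfderiv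
  refine e3.trans ?_
  have a1 := mfderiv_Ad_inv_rightField X Y b
  have a2 := mfderiv_Ad_inv_rightField X Z b
  rw [← pullInner_neg_left, sub_eq_add_neg, ← pullInner_neg_right, ← a1, ← a2]
  refine Eq.trans ?_ (congrArg₂ (fun s t : ℝ => s + t) (hB _ _).symm (hB _ _).symm)
  exact add_comm _ _

end Koszul

end HomSpace

namespace MetricF
open VectorField

/-! ### Tensoriality of `∇ f` -/

section CovEndo

variable {F : Type*} [NormedAddCommGroup F] [NormedSpace ℝ F] [FiniteDimensional ℝ F]
  {M : Type*} [TopologicalSpace M] [ChartedSpace F M] [IsManifold 𝓘(ℝ, F) ∞ M]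

theorem SmoothVField.mdifferentiableAt {X : VField F M} (hX : SmoothVField X) (x : M) :
    MDifferentiableAt 𝓘(ℝ, F) 𝓘(ℝ, F).tangent
      (fun y => (X y : TangentBundle 𝓘(ℝ, F) M)) x :=
  (hX x).mdifferentiableAt (by simp)

theorem mdifferentiableAt_app {f : EndoField F M} (hf : SmoothEndoField f) {Y : VField F M} {x : M}
    (hY : MDifferentiableAt 𝓘(ℝ, F) 𝓘(ℝ, F).tangent
      (fun y => (Y y : TangentBundle 𝓘(ℝ, F) M)) x) :
    MDifferentiableAt 𝓘(ℝ, F) 𝓘(ℝ, F).tangent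
      (fun y => (app f Y y : TangentBundle 𝓘(ℝ, F) M)) x :=
  MDifferentiableAt.clm_bundle_apply ((hf x).mdifferentiableAt (by simp)) hY

/-- `∇_v (f) Y` at `x` is tensorial in `Y`. -/
theorem tensorialAt_covEndo (cov : Connection F M) {f : EndoField F M} (hf : SmoothEndoField f)
    (x : M) (v : TangentSpace 𝓘(ℝ, F) x) :
    TensorialAt 𝓘(ℝ, F) F (fun Y : VField F M => cov (app f Y) x v - f x (cov Y x v)) x where
  smul {h Y} hh hY := by
    have e : app f (h • Y) = h • app f Y := funext fun y => map_smul (f y) (h y) (Y y)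
    have e1 := cov.isCovariantDerivativeOn.leibniz (mdifferentiableAt_app hf hY) hh
    have e2 := cov.isCovariantDerivativeOn.leibniz hY hh
    rw [e]
    change cov (h • app f Y) x v - f x (cov (h • Y) x v) = _
    erw [e1, e2]
    simp only [add_apply, smul_apply,
      ContinuousLinearMap.smulRight_apply, map_add, map_smul, app]
    module
  add {Y Z} hY hZ := by
    have e : app f (Y + Z) = app f Y + app f Z := funext fun y => map_add (f y) (Y y) (Z y)
    have e1 := cov.isCovariantDerivativeOn.add (mdifferentiableAt_app hf hY)
      (mdifferentiableAt_app hf hZ)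
    have e2 := cov.isCovariantDerivativeOn.add hY hZ
    rw [e]
    erw [e1, e2]
    simp only [add_apply, map_add]
    abel

/-- `∇_X (f) Y` at `x` depends only on the values of `X` and `Y` at `x`. -/
theorem covEndo_congr (cov : Connection F M) {f : EndoField F M} (hf : SmoothEndoField f)
    {X X' Y Y' : VField F M} {x : M} (hX : X x = X' x) (hYY' : Y x = Y' x)
    (hY : MDifferentiableAt 𝓘(ℝ, F) 𝓘(ℝ, F).tangent (fun y => (Y y : TangentBundle 𝓘(ℝ, F) M)) x)
    (hY' : MDifferentiableAt 𝓘(ℝ, F) 𝓘(ℝ, F).tangent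
      (fun y => (Y' y : TangentBundle 𝓘(ℝ, F) M)) x) :
    covEndo cov f X Y x = covEndo cov f X' Y' x := by
  unfold covEndo
  rw [hX]
  exact (tensorialAt_covEndo cov hf x (X' x)).pointwise hY hY' hYY'

end CovEndo

end MetricF

namespace HomSpace
open MetricF Topology VectorField

/-! ### The Levi-Civita connection on fundamental fields -/

section LeviCivita

variable {E : Type*} [NormedAddCommGroup E] [NormedSpace ℝ E] [FiniteDimensional ℝ E]
  {F : Type*} [NormedAddCommGroup F] [NormedSpace ℝ F] [FiniteDimensional ℝ F]
  {G : Type*} [TopologicalSpace G] [ChartedSpace E G] [Group G] [LieGroup 𝓘(ℝ, E) ∞ G]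
  {H : Subgroup G} [ChartedSpace F (G ⧸ H)] [IsManifold 𝓘(ℝ, F) ∞ (G ⧸ H)]

/-- The bracket of fundamental fields. -/
theorem mlieBracket_fundField_fundField (hM : IsHomogeneousManifold E F H)
    (X Y : GroupLieAlgebra 𝓘(ℝ, E) G) (b : G) :
    mlieBracket 𝓘(ℝ, F) (fundField H X) (fundField H Y) (QuotientGroup.mk b) =
      push F H b (-⁅Ad b⁻¹ X, Ad b⁻¹ Y⁆ : GroupLieAlgebra 𝓘(ℝ, E) G) :=
  mlieBracket_fundField hM (ContinuousLinearMap.id ℝ E) X Y b (mdifferentiableAt_fundField hM Y _)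
    (fundField_mk hM Y)

theorem cov_fundField_sub (hM : IsHomogeneousManifold E F H) {g : Metric F (G ⧸ H)}
    {cov : Connection F (G ⧸ H)} (hcov : IsLeviCivita g cov)
    (X Y : GroupLieAlgebra 𝓘(ℝ, E) G) (b : G) :
    cov (fundField H Y) (QuotientGroup.mk b) (fundField H X (QuotientGroup.mk b)) -
      cov (fundField H X) (QuotientGroup.mk b) (fundField H Y (QuotientGroup.mk b)) =
      push F H b (-⁅Ad b⁻¹ X, Ad b⁻¹ Y⁆ : GroupLieAlgebra 𝓘(ℝ, E) G) := by
  rw [← mlieBracket_fundField_fundField hM]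
  exact cov.torsion_eq_zero_iff.1 hcov.torsion_eq_zero (mdifferentiableAt_fundField hM X _)
    (mdifferentiableAt_fundField hM Y _)

/-- The Koszul formula for fundamental fields, at `bH`. -/
theorem two_mul_inner_cov_fundField (hM : IsHomogeneousManifold E F H) {g : Metric F (G ⧸ H)}
    (hg : IsInvariantMetric g) {cov : Connection F (G ⧸ H)} (hcov : IsLeviCivita g cov)
    (X Y Z : GroupLieAlgebra 𝓘(ℝ, E) G) (b : G) :
    2 * g.inner (QuotientGroup.mk b)
      (cov (fundField H Y) (QuotientGroup.mk b) (fundField H X (QuotientGroup.mk b)))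
      (fundField H Z (QuotientGroup.mk b)) =
      -pullInner g ⁅Ad b⁻¹ X, Ad b⁻¹ Y⁆ (Ad b⁻¹ Z) - pullInner g (Ad b⁻¹ Y) ⁅Ad b⁻¹ X, Ad b⁻¹ Z⁆ -
        pullInner g (Ad b⁻¹ X) ⁅Ad b⁻¹ Y, Ad b⁻¹ Z⁆ := by
  have hc : ∀ X Y Z : GroupLieAlgebra 𝓘(ℝ, E) G,
      g.inner (QuotientGroup.mk b)
        (cov (fundField H Y) (QuotientGroup.mk b) (fundField H X (QuotientGroup.mk b)))
        (fundField H Z (QuotientGroup.mk b)) +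
      g.inner (QuotientGroup.mk b)
        (cov (fundField H Z) (QuotientGroup.mk b) (fundField H X (QuotientGroup.mk b)))
        (fundField H Y (QuotientGroup.mk b)) =
      -pullInner g ⁅Ad b⁻¹ X, Ad b⁻¹ Y⁆ (Ad b⁻¹ Z) -
        pullInner g ⁅Ad b⁻¹ X, Ad b⁻¹ Z⁆ (Ad b⁻¹ Y) := by
    intro X Y Z
    rw [g.symm (QuotientGroup.mk b) _ (fundField H Y (QuotientGroup.mk b)),
      pullInner_comm g ⁅Ad b⁻¹ X, Ad b⁻¹ Z⁆]
    exact (hcov.metric (fundField H Y) (fundField H Z) (QuotientGroup.mk b)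
      (mdifferentiableAt_fundField hM Y _) (mdifferentiableAt_fundField hM Z _)
      (fundField H X (QuotientGroup.mk b))).symm.trans (mvfderiv_inner_fundField hM hg X Y Z b)
  have ht : ∀ X Y Z : GroupLieAlgebra 𝓘(ℝ, E) G,
      g.inner (QuotientGroup.mk b)
        (cov (fundField H Y) (QuotientGroup.mk b) (fundField H X (QuotientGroup.mk b)))
        (fundField H Z (QuotientGroup.mk b)) -
      g.inner (QuotientGroup.mk b)
        (cov (fundField H X) (QuotientGroup.mk b) (fundField H Y (QuotientGroup.mk b)))
        (fundField H Z (QuotientGroup.mk b)) =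
      -pullInner g ⁅Ad b⁻¹ X, Ad b⁻¹ Y⁆ (Ad b⁻¹ Z) := by
    intro X Y Z
    rw [← pullInner_neg_left]
    have e := cov_fundField_sub hM hcov X Y b
    have e1 := inner_push hM hg b (-⁅Ad b⁻¹ X, Ad b⁻¹ Y⁆) (Ad b⁻¹ Z)
    rw [← fundField_mk hM Z, ← e] at e1
    refine Eq.trans ?_ e1
    have hl : ∀ (B : F →L[ℝ] F →L[ℝ] ℝ) (p q r : F), B p r - B q r = B (p - q) r := by
      intro B p q r; simp
    exact hl (g.inner (QuotientGroup.mk b) : F →L[ℝ] F →L[ℝ] ℝ) _ _ _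
  have hn : ∀ u v w : GroupLieAlgebra 𝓘(ℝ, E) G, pullInner g ⁅u, v⁆ w = -pullInner g ⁅v, u⁆ w :=
    fun u v w => by rw [← lie_skew, pullInner_neg_left]
  rw [pullInner_comm g (Ad b⁻¹ Y), pullInner_comm g (Ad b⁻¹ X)]
  linarith [hc X Y Z, hc Y Z X, hc Z X Y, ht X Y Z, ht Y Z X, ht Z X Y,
    hn (Ad b⁻¹ X) (Ad b⁻¹ Y) (Ad b⁻¹ Z), hn (Ad b⁻¹ Y) (Ad b⁻¹ Z) (Ad b⁻¹ X),
    hn (Ad b⁻¹ Z) (Ad b⁻¹ X) (Ad b⁻¹ Y)]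

/-- The covariant derivative of an invariant metric `f`-structure at `bH`, in terms of the
brackets of `𝔤`; here `A` is any lift to `𝔤` of the value of `f` at `o`. -/
theorem two_mul_inner_covEndo (hM : IsHomogeneousManifold E F H) {g : Metric F (G ⧸ H)}
    (hg : IsInvariantMetric g) {cov : Connection F (G ⧸ H)} (hcov : IsLeviCivita g cov)
    {f : EndoField F (G ⧸ H)} (hf : IsMetricFStructure g f) (hfinv : IsInvariantEndo f)
    {A : GroupLieAlgebra 𝓘(ℝ, E) G →ₗ[ℝ] GroupLieAlgebra 𝓘(ℝ, E) G}
    (hA : ∀ u, f (QuotientGroup.mk 1) (dproj E F H u) = dproj E F H (A u))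
    {X Y : VField F (G ⧸ H)} {b : G} {u v : GroupLieAlgebra 𝓘(ℝ, E) G}
    (hX : X (QuotientGroup.mk b) = push F H b u) (hY : Y (QuotientGroup.mk b) = push F H b v)
    (hYd : MDifferentiableAt 𝓘(ℝ, F) 𝓘(ℝ, F).tangent
      (fun y => (Y y : TangentBundle 𝓘(ℝ, F) (G ⧸ H))) (QuotientGroup.mk b))
    (w : GroupLieAlgebra 𝓘(ℝ, E) G) :
    2 * g.inner (QuotientGroup.mk b) (covEndo cov f X Y (QuotientGroup.mk b)) (push F H b w) =
      -pullInner g ⁅A v, u⁆ w - pullInner g u ⁅A v, w⁆ - pullInner g (A v) ⁅u, w⁆ -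
        pullInner g ⁅v, u⁆ (A w) - pullInner g u ⁅v, A w⁆ - pullInner g v ⁅u, A w⁆ := by
  obtain ⟨U, rfl⟩ := exists_Ad_inv_eq b u
  obtain ⟨V, rfl⟩ := exists_Ad_inv_eq b v
  obtain ⟨W, rfl⟩ := exists_Ad_inv_eq b w
  obtain ⟨V', hV'⟩ := exists_Ad_inv_eq b (A (Ad b⁻¹ V))
  obtain ⟨W', hW'⟩ := exists_Ad_inv_eq b (A (Ad b⁻¹ W))
  rw [← fundField_mk hM] at hX hY
  rw [covEndo_congr cov hf.smooth hX hY hYd (mdifferentiableAt_fundField hM V _),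
    ← fundField_mk hM]
  have hfd := mdifferentiableAt_app hf.smooth
    (mdifferentiableAt_fundField (F := F) hM V (QuotientGroup.mk b))
  have hfV : ∀ V (x : G), f (QuotientGroup.mk x) (fundField H V (QuotientGroup.mk x)) =
      push F H x (A (Ad x⁻¹ V)) := fun V x => by
    rw [fundField_mk hM, endo_push hM hfinv x (hA _)]
  -- `[U*, f V*] = f [U*, V*]`, so the two brackets cancel in `∇_U (f V) - f ∇_U V`
  have hb : mlieBracket 𝓘(ℝ, F) (fundField H U) (app f (fundField H V)) (QuotientGroup.mk b) =
      push F H b (A (-⁅Ad b⁻¹ U, Ad b⁻¹ V⁆)) :=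
    mlieBracket_fundField hM
      (LinearMap.toContinuousLinearMap (E := E) (F' := E) (A : E →ₗ[ℝ] E)) U V b hfd
      (fun x => hfV V x)
  have t1 : cov (app f (fundField H V)) (QuotientGroup.mk b) (fundField H U (QuotientGroup.mk b)) -
      cov (fundField H U) (QuotientGroup.mk b) (app f (fundField H V) (QuotientGroup.mk b)) =
      push F H b (A (-⁅Ad b⁻¹ U, Ad b⁻¹ V⁆)) := by
    rw [← hb]
    exact cov.torsion_eq_zero_iff.1 hcov.torsion_eq_zero (mdifferentiableAt_fundField hM U _) hfd
  have t2 := cov_fundField_sub hM hcov U V b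
  have hfb := endo_push hM hfinv b (hA (-⁅Ad b⁻¹ U, Ad b⁻¹ V⁆))
  -- at `bH`, the vectors `f V*` and `f W*` are the values of fundamental fields `V'*` and `W'*`
  have e1 : (app f (fundField H V) (QuotientGroup.mk b)) = fundField H V' (QuotientGroup.mk b) := by
    rw [fundField_mk hM, hV']; exact hfV V b
  have e2 : f (QuotientGroup.mk b) (fundField H W (QuotientGroup.mk b)) =
      fundField H W' (QuotientGroup.mk b) := by
    rw [fundField_mk hM W', hW']; exact hfV W b
  have k1 := two_mul_inner_cov_fundField hM hg hcov V' U W b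
  have k2 := two_mul_inner_cov_fundField hM hg hcov V U W' b
  have hcomp := hf.compatible (QuotientGroup.mk b)
    (cov (fundField H U) (QuotientGroup.mk b) (fundField H V (QuotientGroup.mk b)))
    (fundField H W (QuotientGroup.mk b))
  rw [e2] at hcomp
  rw [e1, ← hfb, ← t2] at t1
  have hlin : ∀ (B : F →L[ℝ] F →L[ℝ] ℝ) (φ : F →L[ℝ] F) (p q r s w : F),
      p - q = φ (r - s) → B (p - φ r) w = B q w - B (φ s) w := by
    intro B φ p q r s w h
    have : p - φ r = q - φ s := by
      rw [map_sub] at h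
      rw [sub_eq_iff_eq_add] at h
      rw [h]; abel
    rw [this]; simp
  have hfin := hlin (g.inner (QuotientGroup.mk b) : F →L[ℝ] F →L[ℝ] ℝ)
    (f (QuotientGroup.mk b) : F →L[ℝ] F) _ _ _ _ (fundField H W (QuotientGroup.mk b)) t1
  rw [hV'] at k1
  rw [hW'] at k2
  have hreal : ∀ P Q R S c d₁ d₂ d₃ : ℝ, P = Q - R → R + S = 0 → 2 * Q = c →
      2 * S = -d₁ - d₂ - d₃ → 2 * P = c - d₁ - d₂ - d₃ := by
    intros; linarith
  exact hreal _ _ _ _ _ _ _ _ hfin hcomp k1 k2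

end LeviCivita

/-! ### The algebra of three cyclically bracketing summands -/

section ThreeSummands

variable {L : Type*} [LieRing L] [LieAlgebra ℝ L]

/-- The algebraic data at the origin: subspaces `V₁`, `V₂`, `V₃` of a Lie algebra that bracket
cyclically into each other modulo `𝔥`, an invariant form `κ`, a form `P` that is a multiple `aₛ κ`
on each `Vₛ` and vanishes along `𝔥`, and a `P`-skew operator `A` that vanishes on `V₁` and is a
complex structure on `V₂` and on `V₃`. -/
structure IsFTriple (𝔥 V₁ V₂ V₃ : Submodule ℝ L) (κ P : LinearMap.BilinForm ℝ L)
    (A : L →ₗ[ℝ] L) (a₁ a₂ a₃ : ℝ) : Prop where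
  lie_self₁ : ∀ x ∈ V₁, ∀ y ∈ V₁, ⁅x, y⁆ ∈ 𝔥
  lie_self₂ : ∀ x ∈ V₂, ∀ y ∈ V₂, ⁅x, y⁆ ∈ 𝔥
  lie_self₃ : ∀ x ∈ V₃, ∀ y ∈ V₃, ⁅x, y⁆ ∈ 𝔥
  lie₁₂ : ∀ x ∈ V₁, ∀ y ∈ V₂, ⁅x, y⁆ ∈ V₃
  lie₂₃ : ∀ x ∈ V₂, ∀ y ∈ V₃, ⁅x, y⁆ ∈ V₁
  lie₃₁ : ∀ x ∈ V₃, ∀ y ∈ V₁, ⁅x, y⁆ ∈ V₂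
  κ_comm : ∀ x y, κ x y = κ y x
  κ_lie : ∀ x y z, κ ⁅x, y⁆ z = κ x ⁅y, z⁆
  P_comm : ∀ x y, P x y = P y x
  P_𝔥 : ∀ x ∈ 𝔥, ∀ y, P x y = 0
  P₁₁ : ∀ x ∈ V₁, ∀ y ∈ V₁, P x y = a₁ * κ x y
  P₂₂ : ∀ x ∈ V₂, ∀ y ∈ V₂, P x y = a₂ * κ x y
  P₃₃ : ∀ x ∈ V₃, ∀ y ∈ V₃, P x y = a₃ * κ x y
  P₁₂ : ∀ x ∈ V₁, ∀ y ∈ V₂, P x y = 0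
  P₂₃ : ∀ x ∈ V₂, ∀ y ∈ V₃, P x y = 0
  P₃₁ : ∀ x ∈ V₃, ∀ y ∈ V₁, P x y = 0
  A₁ : ∀ x ∈ V₁, A x = 0
  A₂ : ∀ x ∈ V₂, A x ∈ V₂
  A₃ : ∀ x ∈ V₃, A x ∈ V₃
  A_sq₂ : ∀ x ∈ V₂, A (A x) = -x
  A_sq₃ : ∀ x ∈ V₃, A (A x) = -x
  A_skew : ∀ x y, P (A x) y = -P x (A y)

/-- Twice the scalar product of `∇_u (f) v` with `w`, in terms of the brackets of `𝔤`. -/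
def covForm (P : LinearMap.BilinForm ℝ L) (A : L →ₗ[ℝ] L) (u v w : L) : ℝ :=
  -P ⁅A v, u⁆ w - P u ⁅A v, w⁆ - P (A v) ⁅u, w⁆ - P ⁅v, u⁆ (A w) - P u ⁅v, A w⁆ - P v ⁅u, A w⁆

/-- The symmetry `κ([x, y], A z) = κ([x, A y], z)` that all bracket conditions amount to. -/
def IsBalanced (V₁ V₂ V₃ : Submodule ℝ L) (κ : LinearMap.BilinForm ℝ L)
    (A : L →ₗ[ℝ] L) : Prop :=
  ∀ x ∈ V₁, ∀ y ∈ V₂, ∀ z ∈ V₃, κ ⁅x, y⁆ (A z) = κ ⁅x, A y⁆ z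

namespace IsFTriple

variable {𝔥 V₁ V₂ V₃ : Submodule ℝ L} {κ P : LinearMap.BilinForm ℝ L}
  {A : L →ₗ[ℝ] L} {a₁ a₂ a₃ : ℝ} (D : IsFTriple 𝔥 V₁ V₂ V₃ κ P A a₁ a₂ a₃)
include D

theorem P_apply {h x y z x' y' z' : L} (hh : h ∈ 𝔥) (hx : x ∈ V₁) (hy : y ∈ V₂) (hz : z ∈ V₃)
    (hx' : x' ∈ V₁) (hy' : y' ∈ V₂) (hz' : z' ∈ V₃) :
    P (h + (x + y + z)) (x' + y' + z') = a₁ * κ x x' + a₂ * κ y y' + a₃ * κ z z' := by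
  simp only [map_add, LinearMap.add_apply, D.P_𝔥 h hh, D.P₁₁ x hx x' hx', D.P₂₂ y hy y' hy',
    D.P₃₃ z hz z' hz', D.P₁₂ x hx y' hy', D.P₂₃ y hy z' hz', D.P₃₁ z hz x' hx',
    (D.P_comm x z').trans (D.P₃₁ z' hz' x hx), (D.P_comm y x').trans (D.P₁₂ x' hx' y hy),
    (D.P_comm z y').trans (D.P₂₃ y' hy' z hz)]
  ring

theorem κ_rotate (x y z : L) : κ ⁅y, z⁆ x = κ ⁅x, y⁆ z := by
  rw [D.κ_comm, ← D.κ_lie]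

/-- All values of `P` on brackets of elements of `V₁ ⊕ V₂ ⊕ V₃` come from the one trilinear form
`κ([x, y], z)` on `V₁ × V₂ × V₃`. -/
theorem P_lie {x y z x' y' z' x'' y'' z'' : L} (hx : x ∈ V₁) (hy : y ∈ V₂) (hz : z ∈ V₃)
    (hx' : x' ∈ V₁) (hy' : y' ∈ V₂) (hz' : z' ∈ V₃)
    (hx'' : x'' ∈ V₁) (hy'' : y'' ∈ V₂) (hz'' : z'' ∈ V₃) :
    P ⁅x + y + z, x' + y' + z'⁆ (x'' + y'' + z'') =
      a₁ * (κ ⁅x'', y⁆ z' - κ ⁅x'', y'⁆ z) + a₂ * (κ ⁅x', y''⁆ z - κ ⁅x, y''⁆ z') +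
        a₃ * (κ ⁅x, y'⁆ z'' - κ ⁅x', y⁆ z'') := by
  have e : ⁅x + y + z, x' + y' + z'⁆ = (⁅x, x'⁆ + ⁅y, y'⁆ + ⁅z, z'⁆) +
      ((⁅y, z'⁆ - ⁅y', z⁆) + (⁅z, x'⁆ - ⁅z', x⁆) + (⁅x, y'⁆ - ⁅x', y⁆)) := by
    simp only [lie_add, add_lie]
    rw [← lie_skew z y', ← lie_skew x z', ← lie_skew y x']
    abel
  rw [e, D.P_apply
    (add_mem (add_mem (D.lie_self₁ x hx x' hx') (D.lie_self₂ y hy y' hy')) (D.lie_self₃ z hz z' hz'))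
    (sub_mem (D.lie₂₃ y hy z' hz') (D.lie₂₃ y' hy' z hz))
    (sub_mem (D.lie₃₁ z hz x' hx') (D.lie₃₁ z' hz' x hx))
    (sub_mem (D.lie₁₂ x hx y' hy') (D.lie₁₂ x' hx' y hy)) hx'' hy'' hz'']
  simp only [map_sub, LinearMap.sub_apply]
  rw [D.κ_rotate x'' y z', D.κ_rotate x'' y' z, ← D.κ_rotate z x' y'', ← D.κ_rotate z' x y'']

theorem A_apply {x y z : L} (hx : x ∈ V₁) : A (x + y + z) = 0 + A y + A z := by
  rw [map_add, map_add, D.A₁ x hx]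

/-- The values of `⟨∇_u (f) u, w⟩`: the components of `w` in `V₁`, `V₂` and `V₃` give the three lines
on the right. -/
theorem covForm_self {x y z x' y' z' : L} (hx : x ∈ V₁) (hy : y ∈ V₂) (hz : z ∈ V₃)
    (hx' : x' ∈ V₁) (hy' : y' ∈ V₂) (hz' : z' ∈ V₃) :
    covForm P A (x + y + z) (x + y + z) (x' + y' + z') =
      (a₁ * (κ ⁅x', y⁆ (A z) - κ ⁅x', A y⁆ z) + (a₃ - a₂) * (κ ⁅x', y⁆ (A z) + κ ⁅x', A y⁆ z)) +
      ((a₁ - a₂ - a₃) * κ ⁅x, y'⁆ (A z) + 2 * (a₁ - a₃) * κ ⁅x, A y'⁆ z) +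
      ((a₂ + a₃ - a₁) * κ ⁅x, A y⁆ z' - 2 * (a₁ - a₂) * κ ⁅x, y⁆ (A z')) := by
  have h0 := V₁.zero_mem
  unfold covForm
  rw [lie_self, D.P_comm (x + y + z) ⁅A _, _⁆, D.P_comm (A _) ⁅_, _⁆, D.P_comm (x + y + z) ⁅_, A _⁆,
    D.A_apply hx, D.A_apply hx',
    D.P_lie h0 (D.A₂ y hy) (D.A₃ z hz) hx hy hz hx' hy' hz',
    D.P_lie h0 (D.A₂ y hy) (D.A₃ z hz) hx' hy' hz' hx hy hz,
    D.P_lie hx hy hz hx' hy' hz' h0 (D.A₂ y hy) (D.A₃ z hz),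
    D.P_lie hx hy hz h0 (D.A₂ y' hy') (D.A₃ z' hz') hx hy hz]
  simp only [zero_lie, map_zero, LinearMap.zero_apply]
  ring

/-- For `p ∈ V₂ ⊕ V₃` the vector `∇_p (f) p` has no component in `V₂ ⊕ V₃`. -/
theorem covForm_eq_zero_of_mem {y z y' z' : L} (hy : y ∈ V₂) (hz : z ∈ V₃)
    (hy' : y' ∈ V₂) (hz' : z' ∈ V₃) : covForm P A (y + z) (y + z) (y' + z') = 0 := by
  have := D.covForm_self V₁.zero_mem hy hz V₁.zero_mem hy' hz'
  simpa using this

/-- `∇_p (f) p = 0` for all `p ∈ V₂ ⊕ V₃` exactly if `a₂ = a₃` and the triple is balanced. -/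
theorem forall_covForm_eq_zero_iff (ha₁ : 0 < a₁) (hne : ∃ x ∈ V₁, ∃ y ∈ V₂, ∃ z ∈ V₃, κ ⁅x, y⁆ z ≠ 0) :
    (∀ y ∈ V₂, ∀ z ∈ V₃, ∀ x' ∈ V₁, ∀ y' ∈ V₂, ∀ z' ∈ V₃,
      covForm P A (y + z) (y + z) (x' + y' + z') = 0) ↔ a₂ = a₃ ∧ IsBalanced V₁ V₂ V₃ κ A := by
  have key : ∀ y ∈ V₂, ∀ z ∈ V₃, ∀ x' ∈ V₁, ∀ y' ∈ V₂, ∀ z' ∈ V₃,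
      covForm P A (y + z) (y + z) (x' + y' + z') =
      a₁ * (κ ⁅x', y⁆ (A z) - κ ⁅x', A y⁆ z) +
        (a₃ - a₂) * (κ ⁅x', y⁆ (A z) + κ ⁅x', A y⁆ z) := by
    intro y hy z hz x' hx' y' hy' z' hz'
    have := D.covForm_self V₁.zero_mem hy hz hx' hy' hz'
    simpa using this
  constructor
  · intro h
    have h1 : ∀ y ∈ V₂, ∀ z ∈ V₃, ∀ x ∈ V₁, a₁ * (κ ⁅x, y⁆ (A z) - κ ⁅x, A y⁆ z) +
        (a₃ - a₂) * (κ ⁅x, y⁆ (A z) + κ ⁅x, A y⁆ z) = 0 := fun y hy z hz x hx =>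
      (key y hy z hz x hx 0 V₂.zero_mem 0 V₃.zero_mem).symm.trans
        (h y hy z hz x hx 0 V₂.zero_mem 0 V₃.zero_mem)
    -- replacing `(y, z)` by `(A y, A z)` exchanges the two trilinear terms up to sign
    have h2 : ∀ y ∈ V₂, ∀ z ∈ V₃, ∀ x ∈ V₁, a₁ * (κ ⁅x, y⁆ (A z) - κ ⁅x, A y⁆ z) -
        (a₃ - a₂) * (κ ⁅x, y⁆ (A z) + κ ⁅x, A y⁆ z) = 0 := fun y hy z hz x hx => by
      have := h1 (A y) (D.A₂ y hy) (A z) (D.A₃ z hz) x hx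
      rw [D.A_sq₂ y hy, D.A_sq₃ z hz, lie_neg, map_neg, map_neg, LinearMap.neg_apply] at this
      linarith
    have hb : IsBalanced V₁ V₂ V₃ κ A := fun x hx y hy z hz => by
      have : a₁ * (κ ⁅x, y⁆ (A z) - κ ⁅x, A y⁆ z) = 0 := by
        linarith [h1 y hy z hz x hx, h2 y hy z hz x hx]
      linarith [(mul_eq_zero.1 this).resolve_left ha₁.ne']
    refine ⟨?_, hb⟩
    obtain ⟨x, hx, y, hy, z, hz, hxyz⟩ := hne
    have h3 := h1 y hy (A z) (D.A₃ z hz) x hx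
    rw [← hb x hx y hy (A z) (D.A₃ z hz), D.A_sq₃ z hz, map_neg] at h3
    have h4 : (a₃ - a₂) * κ ⁅x, y⁆ z = 0 := by linarith
    linarith [(mul_eq_zero.1 h4).resolve_right hxyz]
  · rintro ⟨ha, hb⟩ y hy z hz x' hx' y' hy' z' hz'
    rw [key y hy z hz x' hx' y' hy' z' hz', hb x' hx' y hy z hz, ha]
    ring

/-- `∇_u (f) u = 0` for all `u ∈ V₁ ⊕ V₂ ⊕ V₃` exactly if `a₂ = a₃ = ¾ a₁` and the triple is
balanced. -/
theorem forall_covForm_self_eq_zero_iff (ha₁ : 0 < a₁)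
    (hne : ∃ x ∈ V₁, ∃ y ∈ V₂, ∃ z ∈ V₃, κ ⁅x, y⁆ z ≠ 0) :
    (∀ x ∈ V₁, ∀ y ∈ V₂, ∀ z ∈ V₃, ∀ x' ∈ V₁, ∀ y' ∈ V₂, ∀ z' ∈ V₃,
      covForm P A (x + y + z) (x + y + z) (x' + y' + z') = 0) ↔
      a₂ = a₃ ∧ a₃ = 3 / 4 * a₁ ∧ IsBalanced V₁ V₂ V₃ κ A := by
  constructor
  · intro h
    obtain ⟨ha, hb⟩ := (D.forall_covForm_eq_zero_iff ha₁ hne).1 fun y hy z hz x' hx' y' hy' z' hz' => by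
      simpa using h 0 V₁.zero_mem y hy z hz x' hx' y' hy' z' hz'
    refine ⟨ha, ?_, hb⟩
    obtain ⟨x, hx, y, hy, z, hz, hxyz⟩ := hne
    -- the `V₂`-component of `∇_u (f) u` for `u = x + A z`
    have h1 := h x hx 0 V₂.zero_mem (A z) (D.A₃ z hz) 0 V₁.zero_mem y hy 0 V₃.zero_mem
    rw [D.covForm_self hx V₂.zero_mem (D.A₃ z hz) V₁.zero_mem hy V₃.zero_mem,
      ← hb x hx y hy (A z) (D.A₃ z hz), D.A_sq₃ z hz] at h1
    simp only [map_zero, lie_zero, LinearMap.zero_apply, map_neg] at h1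
    have h2 : (4 * a₃ - 3 * a₁) * κ ⁅x, y⁆ z = 0 := by
      subst ha; linarith
    linarith [(mul_eq_zero.1 h2).resolve_right hxyz]
  · rintro ⟨ha, ha', hb⟩ x hx y hy z hz x' hx' y' hy' z' hz'
    rw [D.covForm_self hx hy hz hx' hy' hz', ← hb x' hx' y hy z hz, ← hb x hx y' hy' z hz,
      ← hb x hx y hy z' hz', ha, ha']
    ring

theorem P_lie_A {y z x' y' z' : L} (hy : y ∈ V₂) (hz : z ∈ V₃)
    (hx' : x' ∈ V₁) (hy' : y' ∈ V₂) (hz' : z' ∈ V₃) :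
    P ⁅y + z, A (y + z)⁆ (x' + y' + z') = a₁ * (κ ⁅x', y⁆ (A z) - κ ⁅x', A y⁆ z) := by
  have := D.P_lie V₁.zero_mem hy hz V₁.zero_mem (D.A₂ y hy) (D.A₃ z hz) hx' hy' hz'
  simpa using this

/-- `[p, A p]` is `P`-orthogonal to `𝔪` for all `p ∈ V₂ ⊕ V₃` exactly in the balanced case. -/
theorem forall_P_lie_A_eq_zero_iff (ha₁ : 0 < a₁) :
    (∀ y ∈ V₂, ∀ z ∈ V₃, ∀ x' ∈ V₁, ∀ y' ∈ V₂, ∀ z' ∈ V₃,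
      P ⁅y + z, A (y + z)⁆ (x' + y' + z') = 0) ↔ IsBalanced V₁ V₂ V₃ κ A := by
  constructor
  · intro h x hx y hy z hz
    have := h y hy z hz x hx 0 V₂.zero_mem 0 V₃.zero_mem
    rw [D.P_lie_A hy hz hx V₂.zero_mem V₃.zero_mem] at this
    linarith [(mul_eq_zero.1 this).resolve_left ha₁.ne']
  · intro hb y hy z hz x' hx' y' hy' z' hz'
    rw [D.P_lie_A hy hz hx' hy' hz', hb x' hx' y hy z hz]
    ring

theorem P_lie_A_add_A_lie_eq_zero (hb : IsBalanced V₁ V₂ V₃ κ A) {x y z x' y' z' : L}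
    (hx : x ∈ V₁) (hy : y ∈ V₂) (hz : z ∈ V₃) (hx' : x' ∈ V₁) (hy' : y' ∈ V₂) (hz' : z' ∈ V₃) :
    P (⁅x, A (y + z)⁆ + A ⁅x, y + z⁆) (x' + y' + z') = 0 := by
  have e1 := D.P_lie hx V₂.zero_mem V₃.zero_mem V₁.zero_mem (D.A₂ y hy) (D.A₃ z hz) hx' hy' hz'
  have e2 := D.P_lie hx V₂.zero_mem V₃.zero_mem V₁.zero_mem hy hz V₁.zero_mem (D.A₂ y' hy')
    (D.A₃ z' hz')
  rw [map_add P, LinearMap.add_apply, D.A_skew, D.A_apply hx']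
  simp only [add_zero, zero_add, map_zero, zero_lie, lie_zero, LinearMap.zero_apply,
    sub_zero, zero_sub, ← map_add A y z] at e1 e2 ⊢
  rw [e1, e2, hb x hx y' hy' z hz, hb x hx y hy z' hz']
  ring

end IsFTriple

end ThreeSummands

/-! ### Schur's lemma for a set of operators -/

section Schur

variable {V : Type*} [AddCommGroup V] [Module ℝ V]

/-- Schur's lemma: a nonzero equivariant map between irreducible subspaces is bijective. -/
theorem bijective_restrict_of_irreducible {S : Set (V →ₗ[ℝ] V)} {U W : Submodule ℝ V}
    (hU : ∀ ρ ∈ S, ∀ x ∈ U, ρ x ∈ U)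
    (hUirr : ∀ U' ≤ U, (∀ ρ ∈ S, ∀ x ∈ U', ρ x ∈ U') → U' = ⊥ ∨ U' = U)
    (hWirr : ∀ W' ≤ W, (∀ ρ ∈ S, ∀ x ∈ W', ρ x ∈ W') → W' = ⊥ ∨ W' = W)
    (e : V →ₗ[ℝ] V) (he : ∀ x ∈ U, e x ∈ W) (heq : ∀ ρ ∈ S, ∀ x ∈ U, e (ρ x) = ρ (e x))
    {x₀ : V} (hx₀ : x₀ ∈ U) (hne : e x₀ ≠ 0) : Function.Bijective (e.restrict he) := by
  constructor
  · rw [← LinearMap.ker_eq_bot, LinearMap.ker_eq_bot']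
    intro x hx
    have hx' : e x = 0 := congrArg Subtype.val hx
    rcases hUirr (U ⊓ LinearMap.ker e) inf_le_left (fun ρ hρ y hy => ⟨hU ρ hρ y hy.1, by
      have : e y = 0 := hy.2
      rw [SetLike.mem_coe, LinearMap.mem_ker, heq ρ hρ y hy.1, this, map_zero]⟩) with h | h
    · have : (x : V) ∈ U ⊓ LinearMap.ker e := ⟨x.2, hx'⟩
      rw [h] at this
      exact Subtype.ext this
    · exact absurd (h.ge hx₀).2 hne
  · rintro ⟨w, hw⟩
    rcases hWirr (U.map e) (Submodule.map_le_iff_le_comap.2 he) (by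
      rintro ρ hρ _ ⟨y, hy, rfl⟩
      exact ⟨ρ y, hU ρ hρ y hy, heq ρ hρ y hy⟩) with h | h
    · exact absurd ((Submodule.eq_bot_iff _).1 h _ ⟨x₀, hx₀, rfl⟩) hne
    · obtain ⟨y, hy, rfl⟩ := h.ge hw
      exact ⟨⟨y, hy⟩, rfl⟩

/-- An equivariant map sends an irreducible summand into itself if its other component would be a
map to an inequivalent irreducible summand. -/
theorem map_mem_of_inequivalent {S : Set (V →ₗ[ℝ] V)} {U W : Submodule ℝ V} (hd : Disjoint U W)
    (hU : ∀ ρ ∈ S, ∀ x ∈ U, ρ x ∈ U) (hW : ∀ ρ ∈ S, ∀ x ∈ W, ρ x ∈ W)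
    (hUirr : ∀ U' ≤ U, (∀ ρ ∈ S, ∀ x ∈ U', ρ x ∈ U') → U' = ⊥ ∨ U' = U)
    (hWirr : ∀ W' ≤ W, (∀ ρ ∈ S, ∀ x ∈ W', ρ x ∈ W') → W' = ⊥ ∨ W' = W)
    (hineq : ¬ ∃ e : U ≃ₗ[ℝ] W, ∀ ρ (hρ : ρ ∈ S) (x : U), (e ⟨ρ x, hU ρ hρ x x.2⟩ : V) = ρ (e x))
    (A : V →ₗ[ℝ] V) (hA : ∀ x ∈ U, A x ∈ U ⊔ W) (hAeq : ∀ ρ ∈ S, ∀ x ∈ U, A (ρ x) = ρ (A x))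
    {x : V} (hx : x ∈ U) : A x ∈ U := by
  obtain ⟨W', hWW', hUW'⟩ := hd.exists_isCompl
  have hc : IsCompl W W' := hUW'.symm
  -- `pr ∘ A` is the component of `A` from `U` to `W`
  let pr : V →ₗ[ℝ] V := W.subtype ∘ₗ Submodule.projectionOnto W W' hc
  have hprW : ∀ w ∈ W, pr w = w := fun w hw =>
    congrArg Subtype.val (Submodule.projectionOnto_apply_left hc ⟨w, hw⟩)
  have hprU : ∀ u ∈ U, pr u = 0 := fun u hu =>
    congrArg Subtype.val ((Submodule.projectionOnto_apply_eq_zero_iff hc).2 (hWW' hu))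
  by_contra hxA
  refine hineq ⟨LinearEquiv.ofBijective ((pr ∘ₗ A).restrict (p := U) (q := W) fun y _ =>
    (Submodule.projectionOnto W W' hc (A y)).2) ?_, fun ρ hρ y => ?_⟩
  · refine bijective_restrict_of_irreducible hU hUirr hWirr (pr ∘ₗ A) _ ?_ hx ?_
    · intro ρ hρ y hy
      obtain ⟨p, hp, q, hq, hpq⟩ := Submodule.mem_sup.1 (hA y hy)
      simp only [LinearMap.comp_apply]
      rw [hAeq ρ hρ y hy, ← hpq]
      simp only [map_add]
      rw [hprU _ hp, hprU _ (hU ρ hρ p hp), hprW _ hq, hprW _ (hW ρ hρ q hq), map_zero]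
    · intro h0
      obtain ⟨p, hp, q, hq, hpq⟩ := Submodule.mem_sup.1 (hA x hx)
      rw [LinearMap.comp_apply, ← hpq, map_add, hprU p hp, hprW q hq, zero_add] at h0
      rw [← hpq, h0, add_zero] at hxA
      exact hxA hp
  · obtain ⟨p, hp, q, hq, hpq⟩ := Submodule.mem_sup.1 (hA y y.2)
    change pr (A (ρ y)) = ρ (pr (A y))
    rw [hAeq ρ hρ y y.2, ← hpq]
    simp only [map_add]
    rw [hprU _ hp, hprU _ (hU ρ hρ p hp), hprW _ hq, hprW _ (hW ρ hρ q hq), map_zero]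

end Schur

/-! ### The metric and the field `f` at the origin -/

section Origin

variable {E : Type*} [NormedAddCommGroup E] [NormedSpace ℝ E] [FiniteDimensional ℝ E]
  {F : Type*} [NormedAddCommGroup F] [NormedSpace ℝ F] [FiniteDimensional ℝ F]
  {G : Type*} [TopologicalSpace G] [ChartedSpace E G] [Group G] [LieGroup 𝓘(ℝ, E) ∞ G]
  {H : Subgroup G} [ChartedSpace F (G ⧸ H)] [IsManifold 𝓘(ℝ, F) ∞ (G ⧸ H)]
  {𝔪 : Submodule ℝ (GroupLieAlgebra 𝓘(ℝ, E) G)}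

/-- The operator on `𝔤` that is `φ` on `𝔪` and `0` on `𝔥`. -/
def extendO (h𝔪 : IsReductive H 𝔪) (φ : 𝔪 →ₗ[ℝ] 𝔪) :
    GroupLieAlgebra 𝓘(ℝ, E) G →ₗ[ℝ] GroupLieAlgebra 𝓘(ℝ, E) G :=
  𝔪.subtype ∘ₗ φ ∘ₗ projM h𝔪

theorem projM_coe (h𝔪 : IsReductive H 𝔪) (X : 𝔪) : projM h𝔪 (X : GroupLieAlgebra 𝓘(ℝ, E) G) = X :=
  Submodule.projectionOnto_apply_left h𝔪.isCompl X

theorem extendO_coe (h𝔪 : IsReductive H 𝔪) (φ : 𝔪 →ₗ[ℝ] 𝔪) (X : 𝔪) :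
    extendO h𝔪 φ (X : GroupLieAlgebra 𝓘(ℝ, E) G) = φ X := by
  change ((φ (projM h𝔪 X) : 𝔪) : GroupLieAlgebra 𝓘(ℝ, E) G) = φ X
  rw [projM_coe]

theorem sub_projM_mem (h𝔪 : IsReductive H 𝔪) (u : GroupLieAlgebra 𝓘(ℝ, E) G) :
    u - projM h𝔪 u ∈ lieAlg H := by
  have h : projM h𝔪 (u - projM h𝔪 u) = 0 := by rw [map_sub, projM_coe, sub_self]
  exact (Submodule.projectionOnto_apply_eq_zero_iff h𝔪.isCompl).1 h

theorem dproj_projM (hM : IsHomogeneousManifold E F H) (h𝔪 : IsReductive H 𝔪)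
    (u : GroupLieAlgebra 𝓘(ℝ, E) G) : dproj E F H (projM h𝔪 u) = dproj E F H u := by
  have h := lieAlg_le_ker H hM (sub_projM_mem h𝔪 u)
  rw [map_sub, sub_eq_zero] at h
  exact h.symm

/-- `extendO` of `f_o` lifts `f_o` to `𝔤`. -/
theorem apply_dproj_eq (hM : IsHomogeneousManifold E F H) (h𝔪 : IsReductive H 𝔪)
    (f : EndoField F (G ⧸ H)) (u : GroupLieAlgebra 𝓘(ℝ, E) G) :
    f (QuotientGroup.mk 1) (dproj E F H u) = dproj E F H (extendO h𝔪 (atO hM h𝔪 f) u) := by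
  rw [← dproj_projM hM h𝔪]
  exact ((tangentEquiv hM h𝔪).apply_symm_apply _).symm

theorem eq_of_dproj_eq (hM : IsHomogeneousManifold E F H) (h𝔪 : IsReductive H 𝔪)
    {u v : GroupLieAlgebra 𝓘(ℝ, E) G} (hu : u ∈ 𝔪) (hv : v ∈ 𝔪)
    (h : dproj E F H u = dproj E F H v) : u = v :=
  congrArg Subtype.val ((dproj_bijective hM h𝔪).1 (a₁ := ⟨u, hu⟩) (a₂ := ⟨v, hv⟩) h)

/-- The value at `o` of an invariant field of endomorphisms commutes with `Ad(H)`. -/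
theorem extendO_Ad (hM : IsHomogeneousManifold E F H) (h𝔪 : IsReductive H 𝔪)
    {f : EndoField F (G ⧸ H)} (hf : IsInvariantEndo f) {h : G} (hh : h ∈ H)
    (u : GroupLieAlgebra 𝓘(ℝ, E) G) :
    extendO h𝔪 (atO hM h𝔪 f) (Ad h u) = Ad h (extendO h𝔪 (atO hM h𝔪 f) u) := by
  refine eq_of_dproj_eq hM h𝔪 (Subtype.mem _) (h𝔪.ad_mem h hh _ (Subtype.mem _)) ?_
  rw [← apply_dproj_eq]
  -- `H` fixes the origin
  have ho : h • (QuotientGroup.mk 1 : G ⧸ H) = QuotientGroup.mk 1 :=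
    QuotientGroup.eq.2 (by simpa using hh)
  have hc : ∀ (y z : G ⧸ H), y = z → ∀ w w' : F, w = w' →
      (f y : F →L[ℝ] F) w = (f z : F →L[ℝ] F) w' := by
    rintro _ _ rfl _ _ rfl; rfl
  have e1 := hc _ _ ho _ _ (dtau_dproj hM hh u)
  have e2 := hf h (QuotientGroup.mk 1) (dproj E F H u)
  rw [apply_dproj_eq hM h𝔪] at e2
  exact e1.symm.trans (e2.symm.trans (dtau_dproj hM hh _))

/-- `pullInner` as a bilinear form. -/
def pullForm (g : Metric F (G ⧸ H)) : LinearMap.BilinForm ℝ (GroupLieAlgebra 𝓘(ℝ, E) G) :=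
  LinearMap.mk₂ ℝ (pullInner g)
    (fun u v w => by
      have h : ∀ (B : F →L[ℝ] F →L[ℝ] ℝ) (L : E →L[ℝ] F) (u v w : E),
        B (L (u + v)) (L w) = B (L u) (L w) + B (L v) (L w) := by intros; simp
      exact h (g.inner (QuotientGroup.mk 1 : G ⧸ H)) (dproj E F H) u v w)
    (fun c u w => by
      have h : ∀ (B : F →L[ℝ] F →L[ℝ] ℝ) (L : E →L[ℝ] F) (u w : E),
        B (L (c • u)) (L w) = c • B (L u) (L w) := by intros; simp
      exact h (g.inner (QuotientGroup.mk 1 : G ⧸ H)) (dproj E F H) u w)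
    (fun u v w => by
      have h : ∀ (B : F →L[ℝ] F →L[ℝ] ℝ) (L : E →L[ℝ] F) (u v w : E),
        B (L u) (L (v + w)) = B (L u) (L v) + B (L u) (L w) := by intros; simp
      exact h (g.inner (QuotientGroup.mk 1 : G ⧸ H)) (dproj E F H) u v w)
    (fun c u w => by
      have h : ∀ (B : F →L[ℝ] F →L[ℝ] ℝ) (L : E →L[ℝ] F) (u w : E),
        B (L u) (L (c • w)) = c • B (L u) (L w) := by intros; simp
      exact h (g.inner (QuotientGroup.mk 1 : G ⧸ H)) (dproj E F H) u w)

theorem pullForm_of_mem_lieAlg (hM : IsHomogeneousManifold E F H) (g : Metric F (G ⧸ H))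
    {u : GroupLieAlgebra 𝓘(ℝ, E) G} (hu : u ∈ lieAlg H) (v : GroupLieAlgebra 𝓘(ℝ, E) G) :
    pullForm g u v = 0 := by
  change g.inner (QuotientGroup.mk 1 : G ⧸ H) (dproj E F H u) (dproj E F H v) = 0
  rw [lieAlg_le_ker H hM hu, map_zero]
  rfl

/-- The form `pullForm g` is positive definite on `𝔪`. -/
theorem pullForm_self_pos (hM : IsHomogeneousManifold E F H) (h𝔪 : IsReductive H 𝔪)
    (g : Metric F (G ⧸ H)) {u : GroupLieAlgebra 𝓘(ℝ, E) G} (hu : u ∈ 𝔪) (hu0 : u ≠ 0) :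
    0 < pullForm g u u :=
  g.pos _ _ fun h => hu0 (eq_of_dproj_eq hM h𝔪 hu 𝔪.zero_mem (by rw [h, map_zero]))

theorem eq_zero_of_pullForm (hM : IsHomogeneousManifold E F H) (h𝔪 : IsReductive H 𝔪)
    (g : Metric F (G ⧸ H)) {u : GroupLieAlgebra 𝓘(ℝ, E) G} (hu : u ∈ 𝔪)
    (h : ∀ w ∈ 𝔪, pullForm g u w = 0) : u = 0 := by
  by_contra h0
  exact (pullForm_self_pos hM h𝔪 g hu h0).ne' (h u hu)

/-- `X_𝔪 = 0` if and only if `X` is orthogonal to `𝔪`. -/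
theorem projM_eq_zero_iff (hM : IsHomogeneousManifold E F H) (h𝔪 : IsReductive H 𝔪)
    (g : Metric F (G ⧸ H)) (u : GroupLieAlgebra 𝓘(ℝ, E) G) :
    projM h𝔪 u = 0 ↔ ∀ w ∈ 𝔪, pullForm g u w = 0 := by
  have h : ∀ w, pullForm g u w =
      pullForm g (projM h𝔪 u : GroupLieAlgebra 𝓘(ℝ, E) G) w := fun w => by
    have := pullForm_of_mem_lieAlg hM g (sub_projM_mem h𝔪 u) w
    rw [map_sub, LinearMap.sub_apply, sub_eq_zero] at this
    exact this
  constructor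
  · intro h0 w _
    rw [h, h0, Submodule.coe_zero, map_zero, LinearMap.zero_apply]
  · intro h0
    exact Subtype.ext (eq_zero_of_pullForm hM h𝔪 g (projM h𝔪 u).2 fun w hw => (h w).symm.trans (h0 w hw))

/-- Every tangent vector at `bH` is the translate of an element of `𝔪`. -/
theorem exists_push_eq (hM : IsHomogeneousManifold E F H) (h𝔪 : IsReductive H 𝔪)
    {g : Metric F (G ⧸ H)} (hg : IsInvariantMetric g) (b : G)
    (v : TangentSpace 𝓘(ℝ, F) (QuotientGroup.mk b : G ⧸ H)) : ∃ u ∈ 𝔪, v = push F H b u := by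
  obtain ⟨u, rfl⟩ := push_surjective hM b v
  refine ⟨projM h𝔪 u, (projM h𝔪 u).2, ?_⟩
  rw [← sub_eq_zero, ← map_sub]
  by_contra h0
  refine (g.pos (QuotientGroup.mk b) _ h0).ne' ?_
  rw [inner_push hM hg]
  exact pullForm_of_mem_lieAlg hM g (sub_projM_mem h𝔪 u) _

theorem eq_zero_of_inner_push (hM : IsHomogeneousManifold E F H) (h𝔪 : IsReductive H 𝔪)
    {g : Metric F (G ⧸ H)} (hg : IsInvariantMetric g) {b : G}
    {v : TangentSpace 𝓘(ℝ, F) (QuotientGroup.mk b : G ⧸ H)}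
    (h : ∀ w ∈ 𝔪, g.inner (QuotientGroup.mk b) v (push F H b w) = 0) : v = 0 := by
  obtain ⟨u, hu, hv⟩ := exists_push_eq hM h𝔪 hg b v
  by_contra h0
  refine (g.pos (QuotientGroup.mk b) _ h0).ne' ?_
  conv_lhs => arg 2; rw [hv]
  exact h u hu

end Origin

/-! ### The three classes of `f`-structures in terms of brackets -/

section Assembly

variable {E : Type*} [NormedAddCommGroup E] [NormedSpace ℝ E] [FiniteDimensional ℝ E]
  {F : Type*} [NormedAddCommGroup F] [NormedSpace ℝ F] [FiniteDimensional ℝ F]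
  {G : Type*} [TopologicalSpace G] [ChartedSpace E G] [Group G] [LieGroup 𝓘(ℝ, E) ∞ G]
  {H : Subgroup G} [ChartedSpace F (G ⧸ H)] [IsManifold 𝓘(ℝ, F) ∞ (G ⧸ H)]
  {𝔪 : Submodule ℝ (GroupLieAlgebra 𝓘(ℝ, E) G)}
  {m : Fin 3 → Submodule ℝ (GroupLieAlgebra 𝓘(ℝ, E) G)}

namespace IsThreeSummand

theorem le (hm : IsThreeSummand H 𝔪 m) (i : Fin 3) : m i ≤ 𝔪 := hm.iSup_eq ▸ le_iSup m i

theorem lie_mem (hm : IsThreeSummand H 𝔪 m) {i j k : Fin 3} (hij : i ≠ j) (hjk : j ≠ k)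
    (hik : i ≠ k) {X Y : GroupLieAlgebra 𝓘(ℝ, E) G} (hX : X ∈ m i) (hY : Y ∈ m j) :
    ⁅X, Y⁆ ∈ m k := by
  have h : j = i + 1 ∧ k = i + 2 ∨ i = j + 1 ∧ k = j + 2 := by
    clear hX hY
    revert i j k
    decide
  rcases h with ⟨rfl, rfl⟩ | ⟨rfl, rfl⟩
  · exact hm.bracket_mem i X hX Y hY
  · rw [← lie_skew]
    exact neg_mem (hm.bracket_mem j Y hY X hX)

theorem exists_add_eq (hm : IsThreeSummand H 𝔪 m) {i j k : Fin 3} (hij : i ≠ j) (hjk : j ≠ k)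
    (hik : i ≠ k) {u : GroupLieAlgebra 𝓘(ℝ, E) G} (hu : u ∈ 𝔪) :
    ∃ x ∈ m i, ∃ y ∈ m j, ∃ z ∈ m k, x + y + z = u := by
  have hle : 𝔪 ≤ m i ⊔ m j ⊔ m k := by
    rw [← hm.iSup_eq]
    refine iSup_le fun l => ?_
    have : l = i ∨ l = j ∨ l = k := by
      revert i j k l; decide
    rcases this with rfl | rfl | rfl
    · exact le_sup_left.trans le_sup_left
    · exact le_sup_right.trans le_sup_left
    · exact le_sup_right
  obtain ⟨v, hv, z, hz, rfl⟩ := Submodule.mem_sup.1 (hle hu)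
  obtain ⟨x, hx, y, hy, rfl⟩ := Submodule.mem_sup.1 hv
  exact ⟨x, hx, y, hy, z, hz, rfl⟩

/-- An `Ad(H)`-equivariant operator that preserves `𝔪ⱼ ⊕ 𝔪ₖ` preserves `𝔪ⱼ`. -/
theorem map_mem (hm : IsThreeSummand H 𝔪 m) {j k : Fin 3} (hjk : j ≠ k)
    {A : GroupLieAlgebra 𝓘(ℝ, E) G →ₗ[ℝ] GroupLieAlgebra 𝓘(ℝ, E) G}
    (hA : ∀ X ∈ m j, A X ∈ m j ⊔ m k) (hAd : ∀ h ∈ H, ∀ X, A (Ad h X) = Ad h (A X))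
    {X : GroupLieAlgebra 𝓘(ℝ, E) G} (hX : X ∈ m j) : A X ∈ m j := by
  refine map_mem_of_inequivalent
    (S := {ρ | ∃ h ∈ H, ρ = (Ad h : GroupLieAlgebra 𝓘(ℝ, E) G →L[ℝ] _).toLinearMap})
    (hm.indep.pairwiseDisjoint hjk) ?_ ?_ ?_ ?_ ?_ A hA ?_ hX
  · rintro _ ⟨h, hh, rfl⟩ Y hY
    exact hm.ad_mem j h hh Y hY
  · rintro _ ⟨h, hh, rfl⟩ Y hY
    exact hm.ad_mem k h hh Y hY
  · exact fun U hU h => hm.irreducible j U hU fun a ha Y hY => h _ ⟨a, ha, rfl⟩ Y hY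
  · exact fun U hU h => hm.irreducible k U hU fun a ha Y hY => h _ ⟨a, ha, rfl⟩ Y hY
  · rintro ⟨e, he⟩
    exact hm.inequivalent j k hjk ⟨e, fun h hh Y => he _ ⟨h, hh, rfl⟩ Y⟩
  · rintro _ ⟨h, hh, rfl⟩ Y _
    exact hAd h hh Y

/-- Minus the Killing form is positive definite on each summand, since the metric is. -/
theorem killingForm_self_ne_zero (hm : IsThreeSummand H 𝔪 m) (hM : IsHomogeneousManifold E F H)
    (h𝔪 : IsReductive H 𝔪) {g : Metric F (G ⧸ H)} {a : Fin 3 → ℝ} (ha : HasCharNumbers m g a)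
    {i : Fin 3} {X : GroupLieAlgebra 𝓘(ℝ, E) G} (hX : X ∈ m i) (hX0 : X ≠ 0) :
    killingForm ℝ (GroupLieAlgebra 𝓘(ℝ, E) G) X X ≠ 0 := by
  intro h0
  refine (pullForm_self_pos hM h𝔪 g (hm.le i hX) hX0).ne' ?_
  refine (ha.inner_same i X hX X hX).trans ?_
  rw [h0, neg_zero, mul_zero]

theorem exists_killingForm_lie_ne_zero (hm : IsThreeSummand H 𝔪 m)
    (hM : IsHomogeneousManifold E F H) (h𝔪 : IsReductive H 𝔪) {g : Metric F (G ⧸ H)}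
    {a : Fin 3 → ℝ} (ha : HasCharNumbers m g a) {i j k : Fin 3} (hij : i ≠ j) (hjk : j ≠ k)
    (hik : i ≠ k) : ∃ x ∈ m i, ∃ y ∈ m j, ∃ z ∈ m k,
      (-killingForm ℝ (GroupLieAlgebra 𝓘(ℝ, E) G)) ⁅x, y⁆ z ≠ 0 := by
  -- for `0 ≠ [X, Y] ∈ 𝔪ₗ`, the trilinear form does not vanish at `X`, `Y`, `[X, Y]`
  obtain ⟨X, hX, Y, hY, hne⟩ := hm.bracket_ne i
  have hk := hm.killingForm_self_ne_zero hM h𝔪 ha (hm.bracket_mem i X hX Y hY) hne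
  have h : j = i + 1 ∧ k = i + 2 ∨ k = i + 1 ∧ j = i + 2 := by
    clear hX hY hk
    revert i j k
    decide
  rcases h with ⟨rfl, rfl⟩ | ⟨rfl, rfl⟩
  · exact ⟨X, hX, Y, hY, _, hm.bracket_mem i X hX Y hY, neg_ne_zero.2 hk⟩
  · refine ⟨X, hX, _, hm.bracket_mem i X hX Y hY, Y, hY, neg_ne_zero.2 ?_⟩
    rw [← lie_skew X, map_neg, LinearMap.neg_apply, killingForm,
      LieModule.traceForm_apply_lie_apply]
    exact neg_ne_zero.2 hk

/-- The three summands with the value of `f` at `o` form an `IsFTriple`. -/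
theorem isFTriple (hm : IsThreeSummand H 𝔪 m) (hM : IsHomogeneousManifold E F H)
    (h𝔪 : IsReductive H 𝔪) {g : Metric F (G ⧸ H)} {a : Fin 3 → ℝ} (ha : HasCharNumbers m g a)
    {f : EndoField F (G ⧸ H)} (hf : IsMetricFStructure g f) (hfinv : IsInvariantEndo f)
    {i j k : Fin 3} (hij : i ≠ j) (hjk : j ≠ k) (hik : i ≠ k)
    (hφi : ∀ X : 𝔪, (X : GroupLieAlgebra 𝓘(ℝ, E) G) ∈ m i → atO hM h𝔪 f X = 0)
    (hφjk : ∀ X : 𝔪, (X : GroupLieAlgebra 𝓘(ℝ, E) G) ∈ m j ⊔ m k →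
      (atO hM h𝔪 f X : GroupLieAlgebra 𝓘(ℝ, E) G) ∈ m j ⊔ m k ∧
        atO hM h𝔪 f (atO hM h𝔪 f X) = -X) :
    IsFTriple (lieAlg H) (m i) (m j) (m k) (-killingForm ℝ (GroupLieAlgebra 𝓘(ℝ, E) G))
      (pullForm g) (extendO h𝔪 (atO hM h𝔪 f)) (a i) (a j) (a k) := by
  have hmem : ∀ X ∈ m j ⊔ m k, extendO h𝔪 (atO hM h𝔪 f) X ∈ m j ⊔ m k ∧
      extendO h𝔪 (atO hM h𝔪 f) (extendO h𝔪 (atO hM h𝔪 f) X) = -X := by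
    intro X hX
    have h := hφjk ⟨X, sup_le (hm.le j) (hm.le k) hX⟩ hX
    have e := extendO_coe h𝔪 (atO hM h𝔪 f) ⟨X, sup_le (hm.le j) (hm.le k) hX⟩
    change extendO h𝔪 (atO hM h𝔪 f) X = _ at e
    rw [e, extendO_coe]
    exact ⟨h.1, congrArg Subtype.val h.2⟩
  have hAd : ∀ h ∈ H, ∀ X, extendO h𝔪 (atO hM h𝔪 f) (Ad h X) =
      Ad h (extendO h𝔪 (atO hM h𝔪 f) X) := fun h hh X => extendO_Ad hM h𝔪 hfinv hh X
  refine
    { lie_self₁ := hm.bracket_self i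
      lie_self₂ := hm.bracket_self j
      lie_self₃ := hm.bracket_self k
      lie₁₂ := fun x hx y hy => hm.lie_mem hij hjk hik hx hy
      lie₂₃ := fun x hx y hy => hm.lie_mem hjk hik.symm hij.symm hx hy
      lie₃₁ := fun x hx y hy => hm.lie_mem hik.symm hij hjk.symm hx hy
      κ_comm := fun x y => congrArg Neg.neg (LieModule.traceForm_comm ℝ _ _ x y)
      κ_lie := fun x y z => congrArg Neg.neg (LieModule.traceForm_apply_lie_apply ℝ _ _ x y z)
      P_comm := pullInner_comm g
      P_𝔥 := fun x hx y => pullForm_of_mem_lieAlg hM g hx y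
      P₁₁ := ha.inner_same i
      P₂₂ := ha.inner_same j
      P₃₃ := ha.inner_same k
      P₁₂ := ha.inner_ne i j hij
      P₂₃ := ha.inner_ne j k hjk
      P₃₁ := ha.inner_ne k i hik.symm
      A₁ := fun x hx => (extendO_coe h𝔪 _ ⟨x, hm.le i hx⟩).trans
        (congrArg Subtype.val (hφi ⟨x, hm.le i hx⟩ hx))
      A₂ := fun x hx => hm.map_mem hjk (fun X hX => (hmem X (Submodule.mem_sup_left hX)).1) hAd hx
      A₃ := fun x hx => hm.map_mem hjk.symm
        (fun X hX => sup_comm (m j) (m k) ▸ (hmem X (Submodule.mem_sup_right hX)).1) hAd hx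
      A_sq₂ := fun x hx => (hmem x (Submodule.mem_sup_left hx)).2
      A_sq₃ := fun x hx => (hmem x (Submodule.mem_sup_right hx)).2
      A_skew := fun x y => ?_ }
  have h := hf.compatible (QuotientGroup.mk 1) (dproj E F H x) (dproj E F H y)
  rw [apply_dproj_eq hM h𝔪, apply_dproj_eq hM h𝔪] at h
  exact eq_neg_of_add_eq_zero_left h

end IsThreeSummand

theorem two_mul_inner_covEndo_eq_covForm (hM : IsHomogeneousManifold E F H) (h𝔪 : IsReductive H 𝔪)
    {g : Metric F (G ⧸ H)} (hg : IsInvariantMetric g) {cov : Connection F (G ⧸ H)}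
    (hcov : IsLeviCivita g cov) {f : EndoField F (G ⧸ H)} (hf : IsMetricFStructure g f)
    (hfinv : IsInvariantEndo f) {X : VField F (G ⧸ H)} {b : G} {u : GroupLieAlgebra 𝓘(ℝ, E) G}
    (hX : X (QuotientGroup.mk b) = push F H b u)
    (hXd : MDifferentiableAt 𝓘(ℝ, F) 𝓘(ℝ, F).tangent
      (fun y => (X y : TangentBundle 𝓘(ℝ, F) (G ⧸ H))) (QuotientGroup.mk b))
    (w : GroupLieAlgebra 𝓘(ℝ, E) G) :
    2 * g.inner (QuotientGroup.mk b) (covEndo cov f X X (QuotientGroup.mk b)) (push F H b w) =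
      covForm (pullForm g) (extendO h𝔪 (atO hM h𝔪 f)) u u w :=
  two_mul_inner_covEndo hM hg hcov hf hfinv (apply_dproj_eq hM h𝔪 f) hX hX hXd w

/-- `∇_X (f) X = 0` at `bH` is a condition on the element `u ∈ 𝔤` that represents `X` there. -/
theorem covEndo_eq_zero_iff (hM : IsHomogeneousManifold E F H) (h𝔪 : IsReductive H 𝔪)
    {g : Metric F (G ⧸ H)} (hg : IsInvariantMetric g) {cov : Connection F (G ⧸ H)}
    (hcov : IsLeviCivita g cov) {f : EndoField F (G ⧸ H)} (hf : IsMetricFStructure g f)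
    (hfinv : IsInvariantEndo f) {X : VField F (G ⧸ H)} {b : G} {u : GroupLieAlgebra 𝓘(ℝ, E) G}
    (hX : X (QuotientGroup.mk b) = push F H b u)
    (hXd : MDifferentiableAt 𝓘(ℝ, F) 𝓘(ℝ, F).tangent
      (fun y => (X y : TangentBundle 𝓘(ℝ, F) (G ⧸ H))) (QuotientGroup.mk b)) :
    covEndo cov f X X (QuotientGroup.mk b) = 0 ↔
      ∀ w ∈ 𝔪, covForm (pullForm g) (extendO h𝔪 (atO hM h𝔪 f)) u u w = 0 := by
  have key := two_mul_inner_covEndo_eq_covForm hM h𝔪 hg hcov hf hfinv hX hXd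
  constructor
  · intro h w _
    rw [← key w, h, map_zero]
    exact mul_zero _
  · intro h
    refine eq_zero_of_inner_push hM h𝔪 hg fun w hw => ?_
    have := (key w).trans (h w hw)
    exact (mul_eq_zero.1 this).resolve_left two_ne_zero

theorem app_mk (hM : IsHomogeneousManifold E F H) (h𝔪 : IsReductive H 𝔪)
    {f : EndoField F (G ⧸ H)} (hfinv : IsInvariantEndo f) {X : VField F (G ⧸ H)} {b : G}
    {u : GroupLieAlgebra 𝓘(ℝ, E) G} (hX : X (QuotientGroup.mk b) = push F H b u) :
    app f X (QuotientGroup.mk b) = push F H b (extendO h𝔪 (atO hM h𝔪 f) u) := by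
  unfold app
  rw [hX]
  exact endo_push hM hfinv b (apply_dproj_eq hM h𝔪 f u)

/-- The Killing condition is one on `𝔪`, as fundamental fields take all values. -/
theorem isKillf_iff (hM : IsHomogeneousManifold E F H) (h𝔪 : IsReductive H 𝔪)
    {g : Metric F (G ⧸ H)} (hg : IsInvariantMetric g) {cov : Connection F (G ⧸ H)}
    (hcov : IsLeviCivita g cov) {f : EndoField F (G ⧸ H)} (hf : IsMetricFStructure g f)
    (hfinv : IsInvariantEndo f) : IsKillf cov f ↔
      ∀ u ∈ 𝔪, ∀ w ∈ 𝔪, covForm (pullForm g) (extendO h𝔪 (atO hM h𝔪 f)) u u w = 0 := by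
  constructor
  · intro h u _
    obtain ⟨U, rfl⟩ := exists_Ad_inv_eq (1 : G) u
    exact (covEndo_eq_zero_iff hM h𝔪 hg hcov hf hfinv (fundField_mk hM U 1)
      (mdifferentiableAt_fundField hM U _)).1 (h _ (smooth_fundField hM U) _)
  · intro h X hX x
    obtain ⟨b, rfl⟩ := QuotientGroup.mk_surjective x
    obtain ⟨u, hu, hXu⟩ := exists_push_eq hM h𝔪 hg b (X (QuotientGroup.mk b))
    exact (covEndo_eq_zero_iff hM h𝔪 hg hcov hf hfinv hXu (hX.mdifferentiableAt _)).2 (h u hu)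

theorem isNKf_iff (hM : IsHomogeneousManifold E F H) (h𝔪 : IsReductive H 𝔪)
    {g : Metric F (G ⧸ H)} (hg : IsInvariantMetric g) {cov : Connection F (G ⧸ H)}
    (hcov : IsLeviCivita g cov) {f : EndoField F (G ⧸ H)} (hf : IsMetricFStructure g f)
    (hfinv : IsInvariantEndo f) : IsNKf cov f ↔
      ∀ u ∈ 𝔪, ∀ w ∈ 𝔪, covForm (pullForm g) (extendO h𝔪 (atO hM h𝔪 f))
        (extendO h𝔪 (atO hM h𝔪 f) u) (extendO h𝔪 (atO hM h𝔪 f) u) w = 0 := by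
  constructor
  · intro h u _
    obtain ⟨U, rfl⟩ := exists_Ad_inv_eq (1 : G) u
    exact (covEndo_eq_zero_iff hM h𝔪 hg hcov hf hfinv
      (app_mk hM h𝔪 hfinv (fundField_mk hM U 1))
      (mdifferentiableAt_app hf.smooth (mdifferentiableAt_fundField hM U _))).1
      (h _ (smooth_fundField hM U) _)
  · intro h X hX x
    obtain ⟨b, rfl⟩ := QuotientGroup.mk_surjective x
    obtain ⟨u, hu, hXu⟩ := exists_push_eq hM h𝔪 hg b (X (QuotientGroup.mk b))
    exact (covEndo_eq_zero_iff hM h𝔪 hg hcov hf hfinv (app_mk hM h𝔪 hfinv hXu)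
      (mdifferentiableAt_app hf.smooth (hX.mdifferentiableAt _))).2 (h u hu)

/-- If `⟨∇_p (f) p, A w⟩ = 0` for all `p`, `A w` in the image of `A`, then `f` is a `G₁f`-structure. -/
theorem isG1f_of_covForm_eq_zero (hM : IsHomogeneousManifold E F H) (h𝔪 : IsReductive H 𝔪)
    {g : Metric F (G ⧸ H)} (hg : IsInvariantMetric g) {cov : Connection F (G ⧸ H)}
    (hcov : IsLeviCivita g cov) {f : EndoField F (G ⧸ H)} (hf : IsMetricFStructure g f)
    (hfinv : IsInvariantEndo f)
    (h : ∀ u ∈ 𝔪, ∀ w ∈ 𝔪, covForm (pullForm g) (extendO h𝔪 (atO hM h𝔪 f))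
        (extendO h𝔪 (atO hM h𝔪 f) u) (extendO h𝔪 (atO hM h𝔪 f) u)
        (extendO h𝔪 (atO hM h𝔪 f) w) = 0) : IsG1f cov f := by
  intro X hX x
  obtain ⟨b, rfl⟩ := QuotientGroup.mk_surjective x
  obtain ⟨u, hu, hXu⟩ := exists_push_eq hM h𝔪 hg b (X (QuotientGroup.mk b))
  have hd := mdifferentiableAt_app hf.smooth (hX.mdifferentiableAt (QuotientGroup.mk b))
  have hd' := mdifferentiableAt_app hf.smooth hd
  have hu' := app_mk hM h𝔪 hfinv hXu
  have k1 := two_mul_inner_covEndo_eq_covForm hM h𝔪 hg hcov hf hfinv hu' hd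
  have k2 := two_mul_inner_covEndo_eq_covForm hM h𝔪 hg hcov hf hfinv (app_mk hM h𝔪 hfinv hu') hd'
  have hAm : ∀ v, extendO h𝔪 (atO hM h𝔪 f) v ∈ 𝔪 := fun v => Subtype.mem _
  suffices hs : f (QuotientGroup.mk b) (covEndo cov f (app f X) (app f X) (QuotientGroup.mk b) -
      covEndo cov f (app f (app f X)) (app f (app f X)) (QuotientGroup.mk b)) = 0 by
    unfold compositionTensor
    rw [hs, smul_zero]
  refine eq_zero_of_inner_push hM h𝔪 hg fun w hw => ?_
  have h1 := (k1 (extendO h𝔪 (atO hM h𝔪 f) w)).trans (h u hu w hw)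
  have h2 := (k2 (extendO h𝔪 (atO hM h𝔪 f) w)).trans (h _ (hAm u) w hw)
  rw [← endo_push hM hfinv b (apply_dproj_eq hM h𝔪 f w)] at h1 h2
  have hc := hf.compatible (QuotientGroup.mk b)
    (covEndo cov f (app f X) (app f X) (QuotientGroup.mk b) -
      covEndo cov f (app f (app f X)) (app f (app f X)) (QuotientGroup.mk b)) (push F H b w)
  have hl : ∀ (B : F →L[ℝ] F →L[ℝ] ℝ) (p q r : F) (s : ℝ), 2 * B p r = 0 → 2 * B q r = 0 →
      s + B (p - q) r = 0 → s = 0 := by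
    intro B p q r s hp hq hs
    rw [map_sub, sub_apply] at hs
    linarith
  exact hl (g.inner (QuotientGroup.mk b)) _ _ _ _ h1 h2 hc

end Assembly

end HomSpace

end

open MetricF HomSpace in
theorem theorem3
    {E : Type*} [NormedAddCommGroup E] [NormedSpace ℝ E] [FiniteDimensional ℝ E]
    {F : Type*} [NormedAddCommGroup F] [NormedSpace ℝ F] [FiniteDimensional ℝ F]
    -- `G` is a compact connected semisimple Lie group
    {G : Type*} [TopologicalSpace G] [T2Space G] [ChartedSpace E G] [Group G]
    [LieGroup 𝓘(ℝ, E) ∞ G] [ConnectedSpace G] [CompactSpace G]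
    [LieAlgebra.IsSemisimple ℝ (GroupLieAlgebra 𝓘(ℝ, E) G)]
    -- `G ⧸ H` is a homogeneous reductive space
    (H : Subgroup G) (hH : IsClosed (H : Set G))
    [ChartedSpace F (G ⧸ H)] [IsManifold 𝓘(ℝ, F) ∞ (G ⧸ H)]
    (hM : IsHomogeneousManifold E F H)
    (𝔪 : Submodule ℝ (GroupLieAlgebra 𝓘(ℝ, E) G)) (h𝔪 : IsReductive H 𝔪)
    (m : Fin 3 → Submodule ℝ (GroupLieAlgebra 𝓘(ℝ, E) G)) (hm : IsThreeSummand H 𝔪 m)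
    -- an invariant metric with its characteristic numbers and its Levi-Civita connection
    (g : Metric F (G ⧸ H)) (hg : IsInvariantMetric g)
    (a : Fin 3 → ℝ) (ha : HasCharNumbers m g a)
    (cov : Connection F (G ⧸ H)) (hcov : IsLeviCivita g cov)
    -- an invariant metric `f`-structure
    (f : EndoField F (G ⧸ H)) (hf : IsMetricFStructure g f) (hfinv : IsInvariantEndo f)
    (i j k : Fin 3) (hij : i ≠ j) (hjk : j ≠ k) (hik : i ≠ k)
    -- `φ` is the value of `f` at `o`; `φ = 0` on `𝔪ᵢ` and `φ = J` on `𝔪ⱼ ⊕ 𝔪ₖ`, with `J² = -1`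
    (φ : 𝔪 →ₗ[ℝ] 𝔪) (hφ : φ = atO hM h𝔪 f)
    (hφi : ∀ X : 𝔪, (X : GroupLieAlgebra 𝓘(ℝ, E) G) ∈ m i → φ X = 0)
    (hφjk : ∀ X : 𝔪, (X : GroupLieAlgebra 𝓘(ℝ, E) G) ∈ m j ⊔ m k →
      (φ X : GroupLieAlgebra 𝓘(ℝ, E) G) ∈ m j ⊔ m k ∧ φ (φ X) = -X) :
    IsG1f cov f ∧
    (IsNKf cov f ↔
      a j = a k ∧
        ∀ X : 𝔪, projM h𝔪 ⁅(φ X : GroupLieAlgebra 𝓘(ℝ, E) G),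
          (φ (φ X) : GroupLieAlgebra 𝓘(ℝ, E) G)⁆ = 0) ∧
    (IsKillf cov f ↔
      a j = a k ∧ a k = 3 / 4 * a i ∧
        ∀ Y Z : 𝔪, (Y : GroupLieAlgebra 𝓘(ℝ, E) G) ∈ m i →
          (Z : GroupLieAlgebra 𝓘(ℝ, E) G) ∈ m j ⊔ m k →
          projM h𝔪 ⁅(Z : GroupLieAlgebra 𝓘(ℝ, E) G), (φ Z : GroupLieAlgebra 𝓘(ℝ, E) G)⁆ = 0 ∧
          ⁅(Y : GroupLieAlgebra 𝓘(ℝ, E) G), (φ Z : GroupLieAlgebra 𝓘(ℝ, E) G)⁆ +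
            (φ (projM h𝔪 ⁅(Y : GroupLieAlgebra 𝓘(ℝ, E) G),
              (Z : GroupLieAlgebra 𝓘(ℝ, E) G)⁆) : GroupLieAlgebra 𝓘(ℝ, E) G) = 0) := by
  subst hφ
  have D := hm.isFTriple hM h𝔪 ha hf hfinv hij hjk hik hφi hφjk
  have hne := hm.exists_killingForm_lie_ne_zero hM h𝔪 ha hij hjk hik
  have hai := ha.pos i
  have hdec : ∀ u ∈ 𝔪, ∃ x ∈ m i, ∃ y ∈ m j, ∃ z ∈ m k, x + y + z = u :=
    fun u hu => hm.exists_add_eq hij hjk hik hu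
  have hadd : ∀ x ∈ m i, ∀ y ∈ m j, ∀ z ∈ m k, x + y + z ∈ 𝔪 := fun x hx y hy z hz =>
    add_mem (add_mem (hm.le i hx) (hm.le j hy)) (hm.le k hz)
  have hadd' : ∀ y ∈ m j, ∀ z ∈ m k, y + z ∈ 𝔪 := fun y hy z hz =>
    add_mem (hm.le j hy) (hm.le k hz)
  set A := extendO h𝔪 (atO hM h𝔪 f) with hA
  have hAφ : ∀ X : 𝔪, (atO hM h𝔪 f X : GroupLieAlgebra 𝓘(ℝ, E) G) = A X := fun X =>
    (extendO_coe h𝔪 _ X).symm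
  -- `A` maps `𝔪` onto `𝔪ⱼ ⊕ 𝔪ₖ`
  have hAim : ∀ u ∈ 𝔪, ∃ y ∈ m j, ∃ z ∈ m k, A u = y + z := by
    intro u hu
    obtain ⟨x, hx, y, hy, z, hz, rfl⟩ := hdec u hu
    exact ⟨A y, D.A₂ y hy, A z, D.A₃ z hz, by rw [D.A_apply hx, zero_add]⟩
  have hAsurj : ∀ y ∈ m j, ∀ z ∈ m k, ∃ u ∈ 𝔪, A u = y + z := fun y hy z hz =>
    ⟨A (-y) + A (-z), hadd' _ (D.A₂ _ (neg_mem hy)) _ (D.A₃ _ (neg_mem hz)), by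
      rw [map_add, D.A_sq₂ _ (neg_mem hy), D.A_sq₃ _ (neg_mem hz), neg_neg, neg_neg]⟩
  -- `[p, A p]_𝔪 = 0` on `𝔪ⱼ ⊕ 𝔪ₖ`
  have hbal : (∀ y ∈ m j, ∀ z ∈ m k, projM h𝔪 ⁅y + z, A (y + z)⁆ = 0) ↔
      IsBalanced (m i) (m j) (m k) (-killingForm ℝ (GroupLieAlgebra 𝓘(ℝ, E) G)) A := by
    rw [← D.forall_P_lie_A_eq_zero_iff hai]
    refine forall₄_congr fun y hy z hz => ?_
    rw [projM_eq_zero_iff hM h𝔪 g]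
    constructor
    · exact fun h x' hx' y' hy' z' hz' => h _ (hadd x' hx' y' hy' z' hz')
    · intro h w hw
      obtain ⟨x', hx', y', hy', z', hz', rfl⟩ := hdec w hw
      exact h x' hx' y' hy' z' hz'
  refine ⟨?_, ?_, ?_⟩
  · refine isG1f_of_covForm_eq_zero hM h𝔪 hg hcov hf hfinv fun u hu w hw => ?_
    obtain ⟨y, hy, z, hz, e⟩ := hAim u hu
    obtain ⟨y', hy', z', hz', e'⟩ := hAim w hw
    rw [← hA, e, e']
    exact D.covForm_eq_zero_of_mem hy hz hy' hz'
  · rw [isNKf_iff hM h𝔪 hg hcov hf hfinv, ← hA]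
    refine Iff.trans ?_ ((D.forall_covForm_eq_zero_iff hai hne).trans (and_congr_right' ?_))
    · constructor
      · intro h y hy z hz x' hx' y' hy' z' hz'
        obtain ⟨u, hu, e⟩ := hAsurj y hy z hz
        rw [← e]
        exact h u hu _ (hadd x' hx' y' hy' z' hz')
      · intro h u hu w hw
        obtain ⟨y, hy, z, hz, e⟩ := hAim u hu
        obtain ⟨x', hx', y', hy', z', hz', rfl⟩ := hdec w hw
        rw [e]
        exact h y hy z hz x' hx' y' hy' z' hz'
    · rw [← hbal]
      constructor
      · intro h X
        obtain ⟨y, hy, z, hz, e⟩ := hAim X X.2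
        rw [hAφ (atO hM h𝔪 f X), hAφ X, e]
        exact h y hy z hz
      · intro h y hy z hz
        obtain ⟨u, hu, e⟩ := hAsurj y hy z hz
        have := h ⟨u, hu⟩
        rw [hAφ (atO hM h𝔪 f _), hAφ, e] at this
        exact this
  · rw [isKillf_iff hM h𝔪 hg hcov hf hfinv, ← hA]
    refine Iff.trans ?_ ((D.forall_covForm_self_eq_zero_iff hai hne).trans
      (and_congr_right' (and_congr_right' ?_)))
    · constructor
      · exact fun h x hx y hy z hz x' hx' y' hy' z' hz' =>
          h _ (hadd x hx y hy z hz) _ (hadd x' hx' y' hy' z' hz')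
      · intro h u hu w hw
        obtain ⟨x, hx, y, hy, z, hz, rfl⟩ := hdec u hu
        obtain ⟨x', hx', y', hy', z', hz', rfl⟩ := hdec w hw
        exact h x hx y hy z hz x' hx' y' hy' z' hz'
    · constructor
      · rintro hb ⟨Y, hY⟩ ⟨Z, hZ⟩ hYi hZjk
        obtain ⟨y, hy, z, hz, rfl⟩ := Submodule.mem_sup.1 hZjk
        refine ⟨?_, ?_⟩
        · rw [hAφ]
          exact hbal.2 hb y hy z hz
        · rw [hAφ]
          have h1 : ⁅Y, A (y + z)⁆ + A ⁅Y, y + z⁆ ∈ 𝔪 := by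
            refine add_mem ?_ (Subtype.mem _)
            rw [map_add, lie_add]
            exact add_mem (hm.le k (D.lie₁₂ _ hYi _ (D.A₂ y hy)))
              (hm.le j (hm.lie_mem hik hjk.symm hij hYi (D.A₃ z hz)))
          refine eq_zero_of_pullForm hM h𝔪 g h1 fun w hw => ?_
          obtain ⟨x', hx', y', hy', z', hz', rfl⟩ := hdec w hw
          exact D.P_lie_A_add_A_lie_eq_zero hb hYi hy hz hx' hy' hz'
      · intro h
        refine hbal.1 fun y hy z hz => ?_
        have := (h 0 ⟨y + z, hadd' y hy z hz⟩ (m i).zero_mem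
          (Submodule.add_mem_sup hy hz)).1
        rw [hAφ] at this
        exact this
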